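/- Let $n\ge 2$, let $U\subseteq\mathbb R^n$ be open (for instance $U=\mathbb R^n$, or the coordinate image of a chart of a manifold of dimension $n$ with a flat projective structure), and let $p\in\mathbb N$. Let $sl_{n+1}$ be the Lie algebra of vector fields on $U$ spanned by $\partial_r$, $x^s\partial_r$ and $x^r\mathcal E$ ($1\le r,s\le n$), where $\mathcal E=\sum_i x^i\partial_i$. Let $\mathcal S^k_p=\Gamma(\wedge^pTU\otimes S^kTU)$, whose elements are written as smooth functions of $x\in U$ with values in $\wedge^p\mathbb R^n\otimes\mathbb R[\xi_1,\dots,\xi_n]_k$ (polynomials homogeneous of degree $k$), and let $\mathcal S_p=\bigoplus_{k\ge0}\mathcal S^k_p$. A vector field $X$ acts on $\mathcal S_p$ by the Lie derivative $L_Xu=X.u-\rho(DX)u$, where $DX$ is the Jacobian matrix of $X$ and $\rho$ is the natural action of $gl(n,\mathbb R)$. Let $\mathcal D_p$ be the space of differential operators $D$ from smooth $p$-forms to smooth functions on $U$, $D\omega=\sum_{|\alpha|\le k}\langle A_\alpha,\partial^\alpha\omega\rangle$ with $k\in\mathbb N$ and $A_\alpha\in\Gamma(\wedge^pTU)$, on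 which $X$ acts by $\mathcal L_XD=L_X\circ D-D\circ L_X$. The $k$-th order principal symbol of such a $D$ is $\sigma_k(D)=\sum_{|\alpha|=k}\xi^\alpha A_\alpha\in\mathcal S^k_p$. The linear bijection $\sum_\alpha\xi^\alpha A_\alpha\mapsto\sum_\alpha\langle A_\alpha,\partial^\alpha\,\cdot\,\rangle$ is used to identify $\mathcal S_p$ with $\mathcal D_p$ as vector spaces. An $sl_{n+1}$-equivariant quantization map is a linear bijection $\mathcal Q:\mathcal S_p\to\mathcal D_p$ such that $\mathcal Q\circ L_X=\mathcal L_X\circ\mathcal Q$ for all $X\in sl_{n+1}$ and such that $\mathcal Q^{-1}(D)-\sigma_k(D)\in\bigoplus_{r<k}\mathcal S^r_p$ for every $k$ and every $D\in\mathcal D_p$ of order at most $k$. On symbols define $$\delta(\Lambda\otimes P)=\sum_j (e_j\wedge\Lambda)\otimes\partial_{\xi_j}P,\qquad \delta^*(\Lambda\otimes P)=\sum_j (i_{e^j}\Lambda)\otimes\xi_jP,\qquad \eta\partial=\sum_j\partial_{x^j}\partial_{\xi_j},$$ where $(e_j)$ is the standard basis of $\mathbb R^n$, $(e^j)$ its dual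 basis and $\delta,\delta^*$ are extended linearly over smooth functions of $x$, and put $$\alpha^k_p=\frac{(k+n+1)(k+p)}{n+1},\qquad \beta^k_p=\frac{(k+n)(k+p)}{n+1}.$$ **Theorem.** There is exactly one $sl_{n+1}$-equivariant quantization map $\mathcal Q:\mathcal S_p\to\mathcal D_p$. Under the above identification of $\mathcal S_p$ with $\mathcal D_p$, it is given for every $k\ge0$ by $$\mathcal Q|_{\mathcal S^k_p}=\mathrm{id}+\sum_{l=1}^k(\mathcal Q'_{l,p}+\mathcal Q''_{l,p}),$$ where $$\mathcal Q'_{l,p}=\Big(\frac1{n+1}\Big)^l\Big(\prod_{1\le j\le l}\frac1{\alpha^k_p-\alpha^{k-j}_p}\Big)\big(\delta\circ(\eta\partial)\circ\delta^*\big)^l,\qquad \mathcal Q''_{l,p}=\Big(\frac1{n+1}\Big)^l\Big(\prod_{1\le j\le l}\frac1{\beta^k_p-\beta^{k-j}_p}\Big)\big(\delta^*\circ(\eta\partial)\circ\delta\big)^l.$$ -/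

import Mathlib

open TopologicalSpace
open scoped TensorProduct

namespace ProjQuant

noncomputable section

/-! ### Smooth functions and vector fields on an open subset of `ℝⁿ` -/

/-- The extension by zero to `ℝⁿ` of a function on an open set `U`; only its values and its
derivatives at points of `U` are ever used. -/
def ext {n : ℕ} {U : Opens (Fin n → ℝ)} (f : U → ℝ) : (Fin n → ℝ) → ℝ :=
  Function.extend Subtype.val f 0

theorem ext_apply {n : ℕ} {U : Opens (Fin n → ℝ)} (f : U → ℝ) (x : U) :
    ext f (x : Fin n → ℝ) = f x :=
  Subtype.val_injective.extend_apply f 0 x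

theorem ext_congr {n : ℕ} {U : Opens (Fin n → ℝ)} (f : U → ℝ) (g : (Fin n → ℝ) → ℝ)
    (h : ∀ x : U, f x = g x) (x : Fin n → ℝ) (hx : x ∈ (U : Set (Fin n → ℝ))) :
    ext f x = g x := by
  rw [← h ⟨x, hx⟩, ← ext_apply f ⟨x, hx⟩]

/-- The algebra of smooth real functions on the open set `U ⊆ ℝⁿ`, as a subalgebra of all
real functions on `U`. -/
def smoothSubalgebra {n : ℕ} (U : Opens (Fin n → ℝ)) : Subalgebra ℝ (U → ℝ) where
  carrier := {f | ContDiffOn ℝ (⊤ : ℕ∞) (ext f) U}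
  mul_mem' {f g} hf hg :=
    (ContDiffOn.mul hf hg).congr (ext_congr (f * g) _ fun x => by simp [ext_apply])
  add_mem' {f g} hf hg :=
    (ContDiffOn.add hf hg).congr (ext_congr (f + g) _ fun x => by simp [ext_apply])
  algebraMap_mem' r :=
    (contDiffOn_const (c := r)).congr (ext_congr _ (fun _ => r) fun _ => rfl)

/-- `C^∞(U)`. -/
def SmoothFun {n : ℕ} (U : Opens (Fin n → ℝ)) : Type := smoothSubalgebra U

instance {n : ℕ} (U : Opens (Fin n → ℝ)) : CommRing (SmoothFun U) :=
  inferInstanceAs (CommRing (smoothSubalgebra U))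

instance {n : ℕ} (U : Opens (Fin n → ℝ)) : Algebra ℝ (SmoothFun U) :=
  inferInstanceAs (Algebra ℝ (smoothSubalgebra U))

theorem SmoothFun.contDiffOn {n : ℕ} {U : Opens (Fin n → ℝ)} (f : SmoothFun U) :
    ContDiffOn ℝ (⊤ : ℕ∞) (ext f.1) U :=
  f.2

theorem SmoothFun.differentiableAt {n : ℕ} {U : Opens (Fin n → ℝ)} (f : SmoothFun U) (x : U) :
    DifferentiableAt ℝ (ext f.1) (x : Fin n → ℝ) :=
  (f.contDiffOn.contDiffAt (U.isOpen.mem_nhds x.2)).differentiableAt (by simp)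

/-- The partial derivative `∂_i : C^∞(U) → C^∞(U)`. -/
def partialD {n : ℕ} (U : Opens (Fin n → ℝ)) (i : Fin n) : SmoothFun U →ₗ[ℝ] SmoothFun U where
  toFun f := ⟨fun x => fderiv ℝ (ext f.1) (x : Fin n → ℝ) (Pi.single i 1), by
    have h1 : ContDiffOn ℝ (⊤ : ℕ∞) (fun x => fderiv ℝ (ext f.1) x (Pi.single i 1)) U :=
      (f.contDiffOn.fderiv_of_isOpen U.isOpen (by simp)).clm_apply contDiffOn_const
    exact h1.congr (ext_congr _ _ fun _ => rfl)⟩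
  map_add' f g := by
    apply Subtype.ext
    funext x
    have h : ext (f + g).1 =ᶠ[nhds (x : Fin n → ℝ)] ext f.1 + ext g.1 := by
      filter_upwards [U.isOpen.mem_nhds x.2] with y hy
      refine ext_congr _ (ext f.1 + ext g.1) (fun z => ?_) y hy
      rw [Pi.add_apply, ext_apply, ext_apply]
      rfl
    change fderiv ℝ (ext (f + g).1) (x : Fin n → ℝ) _ =
      fderiv ℝ (ext f.1) (x : Fin n → ℝ) _ + fderiv ℝ (ext g.1) (x : Fin n → ℝ) _
    rw [h.fderiv_eq, fderiv_add (f.differentiableAt x) (g.differentiableAt x)]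
    rfl
  map_smul' c f := by
    apply Subtype.ext
    funext x
    have h : ext (c • f).1 =ᶠ[nhds (x : Fin n → ℝ)] c • ext f.1 := by
      filter_upwards [U.isOpen.mem_nhds x.2] with y hy
      refine ext_congr _ (c • ext f.1) (fun z => ?_) y hy
      rw [Pi.smul_apply, ext_apply]
      rfl
    change fderiv ℝ (ext (c • f).1) (x : Fin n → ℝ) _ =
      c • fderiv ℝ (ext f.1) (x : Fin n → ℝ) _
    rw [h.fderiv_eq, fderiv_const_smul (f.differentiableAt x)]
    rfl

/-- The coordinate function `x^i` on `U`. -/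
def coord {n : ℕ} (U : Opens (Fin n → ℝ)) (i : Fin n) : SmoothFun U :=
  ⟨fun x => (x : Fin n → ℝ) i,
    (contDiff_apply ℝ ℝ i).contDiffOn.congr (ext_congr _ (fun x => x i) fun _ => rfl)⟩

/-- Multiplication by a smooth function. -/
abbrev mulFun {n : ℕ} {U : Opens (Fin n → ℝ)} (f : SmoothFun U) : SmoothFun U →ₗ[ℝ] SmoothFun U :=
  LinearMap.mulLeft ℝ f

/-- Smooth vector fields `∑ X^i ∂_i` on `U`, given by their components `X^i`. -/
abbrev VectorField {n : ℕ} (U : Opens (Fin n → ℝ)) : Type := Fin n → SmoothFun U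

/-- The Lie derivative of functions along `X`: `f ↦ ∑ X^i ∂_i f`. -/
def lieFun {n : ℕ} {U : Opens (Fin n → ℝ)} (X : VectorField U) : SmoothFun U →ₗ[ℝ] SmoothFun U :=
  ∑ i, mulFun (X i) ∘ₗ partialD U i

/-- The projective Lie algebra `sl_{n+1}`, spanned by the vector fields
`∂_r`, `x^s ∂_r` and `x^r 𝓔`, where `𝓔 = ∑ x^i ∂_i` is the Euler field. -/
def projectiveAlgebra {n : ℕ} (U : Opens (Fin n → ℝ)) : Submodule ℝ (VectorField U) :=
  Submodule.span ℝ
    (Set.range (fun r : Fin n => (Pi.single r 1 : VectorField U)) ∪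
      Set.range (fun rs : Fin n × Fin n => (Pi.single rs.1 (coord U rs.2) : VectorField U)) ∪
      Set.range (fun r : Fin n => (fun i => coord U r * coord U i : VectorField U)))

/-! ### Differential forms -/

/-- Smooth `p`-forms on `U`: a form is given by its values
`ω(v₁, …, v_p) ∈ C^∞(U)` on constant vector fields `v₁, …, v_p ∈ ℝⁿ`. -/
abbrev Form {n : ℕ} (U : Opens (Fin n → ℝ)) (p : ℕ) : Type :=
  (Fin n → ℝ) [⋀^Fin p]→ₗ[ℝ] SmoothFun U

/-- The action of an operator on functions on the coefficients of a `p`-form. -/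
abbrev onForm {n : ℕ} {U : Opens (Fin n → ℝ)} (p : ℕ) (T : SmoothFun U →ₗ[ℝ] SmoothFun U) :
    Form U p →ₗ[ℝ] Form U p :=
  LinearMap.compAlternatingMapₗ ℝ T

/-- `(formAct A ω)(v₁, …, v_p) = ∑_m ω(v₁, …, A v_m, …, v_p)`, which is
`-ρ(A) ω` for the natural action `ρ` of `gl(n, ℝ)` on covariant antisymmetric tensors. -/
def formAct {n : ℕ} {U : Opens (Fin n → ℝ)} (p : ℕ) (A : (Fin n → ℝ) →ₗ[ℝ] (Fin n → ℝ)) :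
    Form U p →ₗ[ℝ] Form U p where
  toFun ω :=
    { toFun := fun v => ∑ m, ω (Function.update v m (A (v m)))
      map_update_add' := by
        intro inst v i x y
        obtain rfl := Subsingleton.elim inst (instDecidableEqFin p)
        rw [← Finset.sum_add_distrib]
        refine Finset.sum_congr rfl fun m _ => ?_
        rcases eq_or_ne m i with rfl | h
        · simp
        · simp only [Function.update_of_ne h]
          rw [Function.update_comm h.symm, Function.update_comm h.symm, Function.update_comm h.symm,
            ω.map_update_add]
      map_update_smul' := by
        intro inst v i c x
        obtain rfl := Subsingleton.elim inst (instDecidableEqFin p)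
        rw [Finset.smul_sum]
        refine Finset.sum_congr rfl fun m _ => ?_
        rcases eq_or_ne m i with rfl | h
        · simp
        · simp only [Function.update_of_ne h]
          rw [Function.update_comm h.symm, Function.update_comm h.symm, ω.map_update_smul]
      map_eq_zero_of_eq' := by
        intro v i j hv hij
        rw [Finset.sum_eq_add i j hij]
        · have h : Function.update v j (A (v j)) =
              Function.update v i (A (v i)) ∘ Equiv.swap i j := by
            funext m
            rcases eq_or_ne m i with rfl | hi
            · simp [hij, hij.symm, hv]
            · rcases eq_or_ne m j with rfl | hj
              · simp [hv]
              · simp [hi, hj, Equiv.swap_apply_of_ne_of_ne]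
          rw [h, ω.map_swap _ hij, add_neg_cancel]
        · intro m _ hm
          refine ω.map_eq_zero_of_eq _ ?_ hij
          rw [Function.update_of_ne hm.1.symm, Function.update_of_ne hm.2.symm, hv]
        · simp
        · simp }
  map_add' ω η := by
    ext v : 1
    simp [Finset.sum_add_distrib]
  map_smul' c ω := by
    ext v : 1
    simp [Finset.smul_sum]

/-- The elementary endomorphism `E_{ij}` of `ℝⁿ`, `v ↦ v_j e_i`. -/
def elemEnd (n : ℕ) (i j : Fin n) : (Fin n → ℝ) →ₗ[ℝ] (Fin n → ℝ) :=
  (LinearMap.proj j : (Fin n → ℝ) →ₗ[ℝ] ℝ).smulRight (Pi.single i (1 : ℝ))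

/-- The Lie derivative of `p`-forms, `L_X ω = X.ω - ρ(DX) ω`, where `DX = ∑ (∂_j X^i) E_{ij}`
is the Jacobian matrix of `X`. -/
def lieForm {n : ℕ} {U : Opens (Fin n → ℝ)} (p : ℕ) (X : VectorField U) :
    Form U p →ₗ[ℝ] Form U p :=
  onForm p (lieFun X) +
    ∑ i, ∑ j, onForm p (mulFun (partialD U j (X i))) ∘ₗ formAct p (elemEnd n i j)

/-! ### Symbols -/

/-- The fibre `⨁_{k,p} ∧^p ℝⁿ ⊗ S^k ℝⁿ`: the tensor product of the exterior algebra and of the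
symmetric algebra of `ℝⁿ`, the latter being the polynomials in `ξ_1, …, ξ_n`. -/
abbrev Fibre (n : ℕ) : Type :=
  ExteriorAlgebra ℝ (Fin n → ℝ) ⊗[ℝ] MvPolynomial (Fin n) ℝ

/-- Symbols of all bidegrees: (finite sums of) smooth sections over `U` of the trivial bundles with
fibres `∧^p ℝⁿ ⊗ S^k ℝⁿ`. -/
abbrev TotalSymbol {n : ℕ} (U : Opens (Fin n → ℝ)) : Type :=
  SmoothFun U ⊗[ℝ] Fibre n

/-- `𝒮^k_p`: the smooth sections of `∧^p TU ⊗ S^k TU`. -/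
def symbolDeg {n : ℕ} (U : Opens (Fin n → ℝ)) (p k : ℕ) : Submodule ℝ (TotalSymbol U) :=
  Submodule.span ℝ
    {u | ∃ f : SmoothFun U, ∃ Λ ∈ ⋀[ℝ]^p (Fin n → ℝ),
      ∃ P ∈ MvPolynomial.homogeneousSubmodule (Fin n) ℝ k, u = f ⊗ₜ[ℝ] (Λ ⊗ₜ[ℝ] P)}

/-- `⨁_{r < k} 𝒮^r_p`. -/
def symbolLT {n : ℕ} (U : Opens (Fin n → ℝ)) (p k : ℕ) : Submodule ℝ (TotalSymbol U) :=
  ⨆ r : Fin k, symbolDeg U p r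

/-- The symbol space `𝒮_p = ⨁_k 𝒮^k_p`. -/
def symbolSpace {n : ℕ} (U : Opens (Fin n → ℝ)) (p : ℕ) : Submodule ℝ (TotalSymbol U) :=
  ⨆ k : ℕ, symbolDeg U p k

/-- Exterior multiplication by the basis vector `e_i`. -/
def wedge {n : ℕ} (i : Fin n) :
    ExteriorAlgebra ℝ (Fin n → ℝ) →ₗ[ℝ] ExteriorAlgebra ℝ (Fin n → ℝ) :=
  LinearMap.mulLeft ℝ (ExteriorAlgebra.ι ℝ (Pi.single i (1 : ℝ)))

/-- Inner product (contraction) with the dual basis covector `e^i`. -/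
def contract {n : ℕ} (i : Fin n) :
    ExteriorAlgebra ℝ (Fin n → ℝ) →ₗ[ℝ] ExteriorAlgebra ℝ (Fin n → ℝ) :=
  CliffordAlgebra.contractLeft (LinearMap.proj i : (Fin n → ℝ) →ₗ[ℝ] ℝ)

/-- Multiplication by `ξ_i`. -/
def mulXi {n : ℕ} (i : Fin n) : MvPolynomial (Fin n) ℝ →ₗ[ℝ] MvPolynomial (Fin n) ℝ :=
  LinearMap.mulLeft ℝ (MvPolynomial.X i)

/-- The derivative `∂_{ξ_i}`. -/
def partialXi {n : ℕ} (i : Fin n) : MvPolynomial (Fin n) ℝ →ₗ[ℝ] MvPolynomial (Fin n) ℝ :=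
  (MvPolynomial.pderiv i).toLinearMap

/-- The action `ρ(E_{ij})` of `gl(n, ℝ)` on the fibres `∧^p ℝⁿ ⊗ S^k ℝⁿ`: the derivation which
sends the vector `e_j` to `e_i` and the other basis vectors to zero. -/
def glAct {n : ℕ} (i j : Fin n) : Fibre n →ₗ[ℝ] Fibre n :=
  TensorProduct.map (wedge i ∘ₗ contract j) LinearMap.id +
    TensorProduct.map LinearMap.id (mulXi i ∘ₗ partialXi j)

/-- The Lie derivative of symbols, `L_X u = X.u - ρ(DX) u`. -/
def lieSymbol {n : ℕ} {U : Opens (Fin n → ℝ)} (X : VectorField U) :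
    TotalSymbol U →ₗ[ℝ] TotalSymbol U :=
  TensorProduct.map (lieFun X) LinearMap.id -
    ∑ i, ∑ j, TensorProduct.map (mulFun (partialD U j (X i))) (glAct i j)

/-- The Koszul differential `δ : Λ ⊗ P ↦ ∑_j (e_j ∧ Λ) ⊗ ∂_{ξ_j} P`. -/
def delta {n : ℕ} (U : Opens (Fin n → ℝ)) : TotalSymbol U →ₗ[ℝ] TotalSymbol U :=
  LinearMap.lTensor (SmoothFun U) (∑ j, TensorProduct.map (wedge j) (partialXi j))

/-- The differential `δ^* : Λ ⊗ P ↦ ∑_j (i_{e^j} Λ) ⊗ ξ_j P`. -/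
def deltaStar {n : ℕ} (U : Opens (Fin n → ℝ)) : TotalSymbol U →ₗ[ℝ] TotalSymbol U :=
  LinearMap.lTensor (SmoothFun U) (∑ j, TensorProduct.map (contract j) (mulXi j))

/-- The divergence operator `η∂ = ∑_j ∂_{x^j} ∂_{ξ_j}` on symbols. -/
def divergence {n : ℕ} (U : Opens (Fin n → ℝ)) : TotalSymbol U →ₗ[ℝ] TotalSymbol U :=
  ∑ j, TensorProduct.map (partialD U j) (TensorProduct.map LinearMap.id (partialXi j))

/-! ### Differential operators from `p`-forms to functions -/

/-- The constant coefficient operator `∂_1^{α_1} ⋯ ∂_n^{α_n}` on `C^∞(U)`. -/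
def iterPartial {n : ℕ} (U : Opens (Fin n → ℝ)) (α : Fin n →₀ ℕ) : Module.End ℝ (SmoothFun U) :=
  ((List.finRange n).map fun i => (partialD U i : Module.End ℝ (SmoothFun U)) ^ α i).prod

/-- The linear map `P ↦ P(∂)` which sends `ξ^α` to `∂^α`. -/
def constCoeffOp {n : ℕ} (U : Opens (Fin n → ℝ)) :
    MvPolynomial (Fin n) ℝ →ₗ[ℝ] Module.End ℝ (SmoothFun U) :=
  (MvPolynomial.basisMonomials (Fin n) ℝ).constr ℝ (iterPartial U)

/-- The evaluation `⟨Λ, ω⟩ ∈ C^∞(U)` of `Λ ∈ ∧^p ℝⁿ` on a `p`-form `ω`, such that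
`⟨v₁ ∧ ⋯ ∧ v_p, ω⟩ = ω(v₁, …, v_p)`. -/
def evalForm {n : ℕ} (U : Opens (Fin n → ℝ)) (p : ℕ) :
    ExteriorAlgebra ℝ (Fin n → ℝ) →ₗ[ℝ] Form U p →ₗ[ℝ] SmoothFun U :=
  (ExteriorAlgebra.liftAlternating (R := ℝ) (M := Fin n → ℝ) (N := SmoothFun U) ∘ₗ
    LinearMap.single ℝ (fun i => (Fin n → ℝ) [⋀^Fin i]→ₗ[ℝ] SmoothFun U) p).flip

/-- The linear map which sends the symbol `∑_α ξ^α A_α` to the differential operator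
`ω ↦ ∑_α ⟨A_α, ∂^α ω⟩` from `p`-forms to functions. -/
def toDiffOp {n : ℕ} (U : Opens (Fin n → ℝ)) (p : ℕ) :
    TotalSymbol U →ₗ[ℝ] Form U p →ₗ[ℝ] SmoothFun U :=
  TensorProduct.lift (LinearMap.mk₂ ℝ
    (fun (f : SmoothFun U) (w : Fibre n) => mulFun f ∘ₗ
      TensorProduct.lift (LinearMap.mk₂ ℝ
        (fun Λ P => evalForm U p Λ ∘ₗ onForm p (constCoeffOp U P))
        (fun _ _ _ => by ext; simp) (fun _ _ _ => by ext; simp)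
        (fun _ _ _ => by ext; simp) (fun _ _ _ => by ext; simp)) w)
    (fun _ _ _ => by ext; simp [add_mul]) (fun _ _ _ => by ext; simp)
    (fun _ _ _ => by ext; simp [mul_add]) (fun _ _ _ => by ext; simp))

/-- On a monomial symbol, `toDiffOp` gives the operator `ω ↦ f ⟨v₁ ∧ ⋯ ∧ v_p, ∂^α ω⟩`. -/
theorem toDiffOp_tmul {n : ℕ} (U : Opens (Fin n → ℝ)) (p : ℕ) (f : SmoothFun U)
    (v : Fin p → Fin n → ℝ) (α : Fin n →₀ ℕ) (ω : Form U p) :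
    toDiffOp U p (f ⊗ₜ[ℝ] (ExteriorAlgebra.ιMulti ℝ p v ⊗ₜ[ℝ] MvPolynomial.monomial α 1)) ω =
      f * iterPartial U α (ω v) := by
  have h : constCoeffOp U (MvPolynomial.monomial α 1) = iterPartial U α := by
    have := (MvPolynomial.basisMonomials (Fin n) ℝ).constr_basis ℝ (iterPartial U) α
    rwa [MvPolynomial.coe_basisMonomials] at this
  simp [toDiffOp, evalForm, ExteriorAlgebra.liftAlternating_apply_ιMulti, h]

/-- `𝒟_p`: the differential operators `ω ↦ ∑_{|α| ≤ k} ⟨A_α, ∂^α ω⟩`, `k ∈ ℕ`, from `p`-forms to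
functions on `U`, with smooth coefficients `A_α ∈ Γ(∧^p TU)`. -/
def diffOpSpace {n : ℕ} (U : Opens (Fin n → ℝ)) (p : ℕ) :
    Submodule ℝ (Form U p →ₗ[ℝ] SmoothFun U) :=
  (symbolSpace U p).map (toDiffOp U p)

/-- `σ` is the `k`-th order principal symbol `∑_{|α| = k} ξ^α A_α` of the operator
`D = ∑_{|α| ≤ k} ⟨A_α, ∂^α ·⟩` of order at most `k`. -/
def IsPrincipalSymbol {n : ℕ} {U : Opens (Fin n → ℝ)} (p k : ℕ)
    (D : Form U p →ₗ[ℝ] SmoothFun U) (σ : TotalSymbol U) : Prop :=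
  σ ∈ symbolDeg U p k ∧ ∃ τ ∈ symbolLT U p k, D = toDiffOp U p (σ + τ)

/-- The Lie derivative `𝓛_X D = L_X ∘ D - D ∘ L_X` of differential operators. -/
def lieDiffOp {n : ℕ} {U : Opens (Fin n → ℝ)} {p : ℕ} (X : VectorField U)
    (D : Form U p →ₗ[ℝ] SmoothFun U) : Form U p →ₗ[ℝ] SmoothFun U :=
  lieFun X ∘ₗ D - D ∘ₗ lieForm p X

/-! ### Equivariant quantization -/

theorem wedge_contract_mem {n : ℕ} (i j : Fin n) (p : ℕ) (Λ : ExteriorAlgebra ℝ (Fin n → ℝ))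
    (h : Λ ∈ ⋀[ℝ]^p (Fin n → ℝ)) : wedge i (contract j Λ) ∈ ⋀[ℝ]^p (Fin n → ℝ) := by
  induction h using Submodule.pow_induction_on_left' with
  | algebraMap r =>
    have : contract j (algebraMap ℝ (ExteriorAlgebra ℝ (Fin n → ℝ)) r) = 0 :=
      CliffordAlgebra.contractLeft_algebraMap _ _ _
    rw [this, map_zero]
    exact Submodule.zero_mem _
  | add x y i hx hy ihx ihy =>
    rw [map_add, map_add]
    exact Submodule.add_mem _ ihx ihy
  | mem_mul m hm q x hx ih =>
    obtain ⟨v, rfl⟩ := hm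
    have h1 : contract j (ExteriorAlgebra.ι ℝ v * x) =
        v j • x - ExteriorAlgebra.ι ℝ v * contract j x :=
      CliffordAlgebra.contractLeft_ι_mul _ _ _
    have h2 (y : ExteriorAlgebra ℝ (Fin n → ℝ)) :
        wedge i (ExteriorAlgebra.ι ℝ v * y) = -(ExteriorAlgebra.ι ℝ v * wedge i y) := by
      have := ExteriorAlgebra.ι_add_mul_swap (R := ℝ) (Pi.single i (1 : ℝ)) v
      simp only [wedge, LinearMap.mulLeft_apply]
      rw [← mul_assoc, ← mul_assoc, eq_neg_of_add_eq_zero_left this, neg_mul]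
    rw [h1, map_sub, map_smul, h2, sub_neg_eq_add]
    change _ ∈ LinearMap.range (ExteriorAlgebra.ι ℝ) ^ (q + 1)
    rw [pow_succ']
    exact Submodule.add_mem _
      (Submodule.smul_mem _ _ (Submodule.mul_mem_mul ⟨Pi.single i 1, rfl⟩ hx))
      (Submodule.mul_mem_mul ⟨_, rfl⟩ ih)

theorem mulXi_partialXi_mem {n : ℕ} (i j : Fin n) (k : ℕ) (P : MvPolynomial (Fin n) ℝ)
    (h : P ∈ MvPolynomial.homogeneousSubmodule (Fin n) ℝ k) :
    mulXi i (partialXi j P) ∈ MvPolynomial.homogeneousSubmodule (Fin n) ℝ k := by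
  rw [MvPolynomial.mem_homogeneousSubmodule] at h ⊢
  change (MvPolynomial.X i * MvPolynomial.pderiv j P).IsHomogeneous k
  rcases k with _ | k
  · rw [← MvPolynomial.totalDegree_zero_iff_isHomogeneous,
      MvPolynomial.totalDegree_eq_zero_iff_eq_C] at h
    rw [h, MvPolynomial.pderiv_C, mul_zero]
    exact MvPolynomial.isHomogeneous_zero _ _ _
  · have := (MvPolynomial.isHomogeneous_X ℝ i).mul (h.pderiv (i := j))
    rwa [Nat.add_sub_cancel, add_comm] at this

theorem lieSymbol_mem_deg {n : ℕ} {U : Opens (Fin n → ℝ)} {p k : ℕ} (X : VectorField U)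
    {u : TotalSymbol U} (hu : u ∈ symbolDeg U p k) : lieSymbol X u ∈ symbolDeg U p k := by
  induction hu using Submodule.span_induction with
  | zero => rw [map_zero]; exact Submodule.zero_mem _
  | add x y _ _ hx hy => rw [map_add]; exact Submodule.add_mem _ hx hy
  | smul c x _ hx => rw [map_smul]; exact Submodule.smul_mem _ _ hx
  | mem x hx =>
    obtain ⟨f, Λ, hΛ, P, hP, rfl⟩ := hx
    simp only [lieSymbol, glAct, LinearMap.sub_apply, LinearMap.sum_apply, LinearMap.add_apply,
      TensorProduct.map_tmul, TensorProduct.tmul_add, LinearMap.id_apply, LinearMap.comp_apply]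
    refine Submodule.sub_mem _ (Submodule.subset_span ⟨_, Λ, hΛ, P, hP, rfl⟩)
      (Submodule.sum_mem _ fun i _ => Submodule.sum_mem _ fun j _ => Submodule.add_mem _ ?_ ?_)
    · exact Submodule.subset_span ⟨_, _, wedge_contract_mem i j p Λ hΛ, P, hP, rfl⟩
    · exact Submodule.subset_span ⟨_, Λ, hΛ, _, mulXi_partialXi_mem i j k P hP, rfl⟩

theorem lieSymbol_mem {n : ℕ} {U : Opens (Fin n → ℝ)} {p : ℕ} (X : VectorField U)
    {u : TotalSymbol U} (hu : u ∈ symbolSpace U p) : lieSymbol X u ∈ symbolSpace U p := by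
  induction hu using Submodule.iSup_induction' with
  | mem k x hx => exact Submodule.mem_iSup_of_mem k (lieSymbol_mem_deg X hx)
  | zero => rw [map_zero]; exact Submodule.zero_mem _
  | add x y _ _ hx hy => rw [map_add]; exact Submodule.add_mem _ hx hy

/-- An `sl_{n+1}`-equivariant quantization map: a linear bijection `Q : 𝒮_p → 𝒟_p` which
intertwines the actions of `sl_{n+1}` and is such that, for every operator `D` of order at most
`k`, the symbol `Q⁻¹(D)` equals the `k`-th order principal symbol of `D` up to
`⨁_{r < k} 𝒮^r_p`. -/
structure IsEquivariantQuantization {n : ℕ} (U : Opens (Fin n → ℝ)) (p : ℕ)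
    (Q : symbolSpace U p ≃ₗ[ℝ] diffOpSpace U p) : Prop where
  equivariant : ∀ X ∈ projectiveAlgebra U, ∀ u : symbolSpace U p,
    (Q ⟨lieSymbol X u, lieSymbol_mem X u.2⟩ : Form U p →ₗ[ℝ] SmoothFun U) =
      lieDiffOp X (Q u : Form U p →ₗ[ℝ] SmoothFun U)
  normalized : ∀ (k : ℕ) (D : diffOpSpace U p) (σ : TotalSymbol U),
    IsPrincipalSymbol p k (D : Form U p →ₗ[ℝ] SmoothFun U) σ →
      (Q.symm D : TotalSymbol U) - σ ∈ symbolLT U p k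

/-- The Casimir eigenvalue `α^k_p = (k+n+1)(k+p)/(n+1)`. -/
def casimirA (n p k : ℕ) : ℝ := ((k : ℝ) + n + 1) * (k + p) / (n + 1)

/-- The Casimir eigenvalue `β^k_p = (k+n)(k+p)/(n+1)`. -/
def casimirB (n p k : ℕ) : ℝ := ((k : ℝ) + n) * (k + p) / (n + 1)

/-- `Q'_{l,p} = (n+1)^{-l} (∏_{1 ≤ j ≤ l} (α^k_p - α^{k-j}_p)⁻¹) (δ ∘ (η∂) ∘ δ^*)^l` on `𝒮^k_p`,
for `l ≤ k`. -/
def quantA {n : ℕ} (U : Opens (Fin n → ℝ)) (p k l : ℕ) : Module.End ℝ (TotalSymbol U) :=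
  ((1 / ((n : ℝ) + 1)) ^ l *
      ∏ j ∈ Finset.Icc 1 l, 1 / (casimirA n p k - casimirA n p (k - j))) •
    (delta U ∘ₗ divergence U ∘ₗ deltaStar U : Module.End ℝ (TotalSymbol U)) ^ l

/-- `Q''_{l,p} = (n+1)^{-l} (∏_{1 ≤ j ≤ l} (β^k_p - β^{k-j}_p)⁻¹) (δ^* ∘ (η∂) ∘ δ)^l` on `𝒮^k_p`,
for `l ≤ k`. -/
def quantB {n : ℕ} (U : Opens (Fin n → ℝ)) (p k l : ℕ) : Module.End ℝ (TotalSymbol U) :=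
  ((1 / ((n : ℝ) + 1)) ^ l *
      ∏ j ∈ Finset.Icc 1 l, 1 / (casimirB n p k - casimirB n p (k - j))) •
    (deltaStar U ∘ₗ divergence U ∘ₗ delta U : Module.End ℝ (TotalSymbol U)) ^ l

end

end ProjQuant

/-!
The operators on symbols which occur in the theorem are polynomials in the coordinates `x`, `ξ`, the
derivatives `d`, `η` along them, the exterior multiplications `w` and the contractions `c`, which
form a `WeylClifford` system (`symbolWC`); most of the proof is a computation with its relations.
Write `N` for the total degree on the fibre (`deg`), `N_ξ` for the polynomial degree (`degξ`) and
`L_r` for the Lie derivative of symbols along `x^r 𝓔` (`lieQuad`).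

*Existence.* The map `toDiffOp` from symbols to operators commutes with the affine fields `∂_r` and
`x^s ∂_r`, and along `x^r 𝓔` the Lie derivative of operators becomes `L_r - (a_r + b_r)`, where
`a_r = δ η_r δ^*` and `b_r = δ^* η_r δ` (`lieDiffOp_quadratic`, which rests on `a_add_b`). The
operators `A = δ (η∂) δ^*` and `B = δ^* (η∂) δ` are invariant under the affine fields and satisfy
`[A, L_r] = -a_r (N + N_ξ + n)` and `[B, L_r] = -b_r (N + N_ξ + n - 1)` (`A_mul_lieQuad`,
`B_mul_lieQuad`). Moreover `a_r` commutes with `A` and `b_r` with `B`, and `a_r B = b_r A = 0` since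
`δ² = δ^*² = 0`. Hence `1 + ∑ (s_l A^l + t_l B^l)` is equivariant as soon as the coefficients
satisfy two-term recurrences (`quantization_lieQuad`), whose factors are `n + 1` times differences
of the numbers `α` and `β` in the theorem (`coefA_succ`, `coefB_succ`). This operator is the
identity up to terms of lower degree, so it is bijective, and since a symbol is determined by its
operator (`eq_zero_of_toDiffOp_eq_zero`) it defines a quantization map.

*Uniqueness.* If `Q` and `Q'` are equivariant quantization maps, then `S = Q'⁻¹ Q` commutes with
`sl_{n+1}` and is the identity up to terms of lower degree. So `S` commutes with the Casimir
operator of the action on symbols. In degree `k` the latter is `2 δ δ^*` plus a scalar, and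
`δ δ^* + δ^* δ = N` gives it at most the two eigenvalues `2 (n + 1) α^k_p` and `2 (n + 1) β^k_p`
(`casimir_quadratic`). These differ from the eigenvalues in all lower degrees (`casimir_lt`,
`casimir_le`), which forces `S = 1` (`IsUnitriangular.eq_id_of_commute`).
-/

namespace ProjQuant

/-! ### Weyl–Clifford systems -/

/-- A system of `n` coordinates `x`, `ξ`, the derivatives `d`, `η` along them, and the exterior
multiplications `w` and contractions `c`, in an arbitrary ring: the Weyl relations hold for `(x, d)`
and for `(ξ, η)`, the Clifford relations for `(w, c)`, and the three families commute with each
other. -/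
structure WeylClifford (n : ℕ) (R : Type*) [Ring R] where
  x : Fin n → R
  d : Fin n → R
  ξ : Fin n → R
  η : Fin n → R
  w : Fin n → R
  c : Fin n → R
  xx : ∀ i j, Commute (x i) (x j)
  xξ : ∀ i j, Commute (x i) (ξ j)
  xη : ∀ i j, Commute (x i) (η j)
  xw : ∀ i j, Commute (x i) (w j)
  xc : ∀ i j, Commute (x i) (c j)
  dd : ∀ i j, Commute (d i) (d j)
  dξ : ∀ i j, Commute (d i) (ξ j)
  dη : ∀ i j, Commute (d i) (η j)
  dw : ∀ i j, Commute (d i) (w j)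
  dc : ∀ i j, Commute (d i) (c j)
  ξξ : ∀ i j, Commute (ξ i) (ξ j)
  ηη : ∀ i j, Commute (η i) (η j)
  ξw : ∀ i j, Commute (ξ i) (w j)
  ξc : ∀ i j, Commute (ξ i) (c j)
  ηw : ∀ i j, Commute (η i) (w j)
  ηc : ∀ i j, Commute (η i) (c j)
  d_mul_x : ∀ i j, d i * x j = x j * d i + if i = j then 1 else 0
  η_mul_ξ : ∀ i j, η i * ξ j = ξ j * η i + if i = j then 1 else 0
  c_mul_w : ∀ i j, c i * w j = -(w j * c i) + if i = j then 1 else 0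
  w_mul_w : ∀ i j, w i * w j = -(w j * w i)
  c_mul_c : ∀ i j, c i * c j = -(c j * c i)

namespace WeylClifford

variable {n : ℕ} {R : Type*} [Ring R] (W : WeylClifford n R)

/-- The Koszul differential. -/
def δ : R := ∑ j, W.w j * W.η j

/-- The adjoint Koszul differential. -/
def δs : R := ∑ j, W.c j * W.ξ j

/-- The divergence operator. -/
def div : R := ∑ j, W.d j * W.η j

/-- The Euler operator in the variables `x`. -/
def eulerX : R := ∑ j, W.x j * W.d j

/-- The operator which counts the exterior degree. -/
def degW : R := ∑ j, W.w j * W.c j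

/-- The operator which counts the polynomial degree. -/
def degξ : R := ∑ j, W.ξ j * W.η j

/-- The total degree on the fibre. -/
def deg : R := W.degW + W.degξ

/-- The action of the elementary matrix `E_{ij}` on the fibre. -/
def ρ (i j : Fin n) : R := W.w i * W.c j + W.ξ i * W.η j

/-- The Lie derivative along `x^s ∂_r`. -/
def lieLin (s r : Fin n) : R := W.x s * W.d r - W.ρ r s

/-- The Lie derivative along `x^r 𝓔`. -/
def lieQuad (r : Fin n) : R := W.x r * (W.eulerX - W.deg) - ∑ i, W.x i * W.ρ i r

theorem deg_eq_sum : W.deg = ∑ i, W.ρ i i := by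
  simp [deg, ρ, degW, degξ, Finset.sum_add_distrib]

theorem degξ_eq_sum_η_mul_ξ : ∑ j, W.η j * W.ξ j = W.degξ + n := by
  simp [degξ, W.η_mul_ξ, Finset.sum_add_distrib]

theorem degW_eq_sum_c_mul_w : ∑ j, W.c j * W.w j = n - W.degW := by
  simp [degW, W.c_mul_w, Finset.sum_add_distrib]
  abel

/-! ### Commutators with the Koszul differentials -/

theorem δ_η (r : Fin n) : Commute W.δ (W.η r) :=
  .sum_left _ _ _ fun j _ => (W.ηw r j).symm.mul_left (W.ηη j r)

theorem δs_ξ (r : Fin n) : Commute W.δs (W.ξ r) :=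
  .sum_left _ _ _ fun j _ => (W.ξc r j).symm.mul_left (W.ξξ j r)

theorem δ_x (r : Fin n) : Commute (W.x r) W.δ :=
  .sum_right _ _ _ fun j _ => (W.xw r j).mul_right (W.xη r j)

theorem δs_x (r : Fin n) : Commute (W.x r) W.δs :=
  .sum_right _ _ _ fun j _ => (W.xc r j).mul_right (W.xξ r j)

theorem δ_d (r : Fin n) : Commute (W.d r) W.δ :=
  .sum_right _ _ _ fun j _ => (W.dw r j).mul_right (W.dη r j)

theorem δs_d (r : Fin n) : Commute (W.d r) W.δs :=
  .sum_right _ _ _ fun j _ => (W.dc r j).mul_right (W.dξ r j)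

theorem c_mul_δ (r : Fin n) : W.c r * W.δ = W.η r - W.δ * W.c r := by
  have h (j : Fin n) : W.c r * (W.w j * W.η j) =
      (if r = j then W.η j else 0) - W.w j * W.η j * W.c r := by
    rw [mul_assoc, (W.ηc j r).eq, ← mul_assoc, ← mul_assoc, W.c_mul_w]
    split_ifs <;> noncomm_ring
  simp [δ, Finset.mul_sum, Finset.sum_mul, h]

theorem w_mul_δs (r : Fin n) : W.w r * W.δs = W.ξ r - W.δs * W.w r := by
  have h (j : Fin n) : W.w r * (W.c j * W.ξ j) =
      (if r = j then W.ξ j else 0) - W.c j * W.ξ j * W.w r := by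
    rw [mul_assoc, (W.ξw j r).eq, ← mul_assoc (W.c j), W.c_mul_w, ← mul_assoc]
    rcases eq_or_ne r j with rfl | h
    · simp [add_mul, mul_assoc]
    · simp [h, h.symm, mul_assoc]
  simp [δs, Finset.mul_sum, Finset.sum_mul, h]

theorem w_mul_δ (r : Fin n) : W.w r * W.δ = -(W.δ * W.w r) := by
  have h (j : Fin n) : W.w r * (W.w j * W.η j) = -(W.w j * W.η j * W.w r) := by
    rw [mul_assoc (W.w j), (W.ηw j r).eq, ← mul_assoc, ← mul_assoc, W.w_mul_w r j, neg_mul]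
  simp [δ, Finset.mul_sum, Finset.sum_mul, h]

theorem c_mul_δs (r : Fin n) : W.c r * W.δs = -(W.δs * W.c r) := by
  have h (j : Fin n) : W.c r * (W.c j * W.ξ j) = -(W.c j * W.ξ j * W.c r) := by
    rw [mul_assoc (W.c j), (W.ξc j r).eq, ← mul_assoc, ← mul_assoc, W.c_mul_c r j, neg_mul]
  simp [δs, Finset.mul_sum, Finset.sum_mul, h]

theorem ξ_mul_δ (r : Fin n) : W.ξ r * W.δ = W.δ * W.ξ r - W.w r := by
  have h (j : Fin n) : W.ξ r * (W.w j * W.η j) =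
      W.w j * W.η j * W.ξ r - (if r = j then W.w j else 0) := by
    rw [mul_assoc, W.η_mul_ξ, ← mul_assoc, (W.ξw r j).eq]
    rcases eq_or_ne r j with rfl | h
    · simp [mul_add, mul_assoc]
    · simp [h, h.symm, mul_assoc]
  simp [δ, Finset.mul_sum, Finset.sum_mul, h]

theorem η_mul_δs (r : Fin n) : W.η r * W.δs = W.δs * W.η r + W.c r := by
  have h (j : Fin n) : W.η r * (W.c j * W.ξ j) =
      W.c j * W.ξ j * W.η r + (if r = j then W.c j else 0) := by
    rw [← mul_assoc, (W.ηc r j).eq, mul_assoc, W.η_mul_ξ]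
    rcases eq_or_ne r j with rfl | h
    · simp [mul_add, mul_assoc]
    · simp [h, mul_assoc]
  simp [δs, Finset.mul_sum, Finset.sum_mul, Finset.sum_add_distrib, h]

theorem ρ_δ (i j : Fin n) : Commute (W.ρ i j) W.δ := by
  have h1 : W.w i * W.c j * W.δ = W.w i * W.η j + W.δ * (W.w i * W.c j) := by
    rw [mul_assoc, c_mul_δ, mul_sub, ← mul_assoc, w_mul_δ]; noncomm_ring
  have h2 : W.ξ i * W.η j * W.δ = W.δ * (W.ξ i * W.η j) - W.w i * W.η j := by
    rw [mul_assoc, ← (W.δ_η j).eq, ← mul_assoc, ξ_mul_δ]; noncomm_ring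
  rw [Commute, SemiconjBy, ρ, add_mul, h1, h2]; noncomm_ring

theorem ρ_δs (i j : Fin n) : Commute (W.ρ i j) W.δs := by
  have h1 : W.w i * W.c j * W.δs = W.δs * (W.w i * W.c j) - W.ξ i * W.c j := by
    rw [mul_assoc, c_mul_δs, mul_neg, ← mul_assoc, w_mul_δs]; noncomm_ring
  have h2 : W.ξ i * W.η j * W.δs = W.δs * (W.ξ i * W.η j) + W.ξ i * W.c j := by
    rw [mul_assoc, η_mul_δs, mul_add, ← mul_assoc, ← (W.δs_ξ i).eq]; noncomm_ring
  rw [Commute, SemiconjBy, ρ, add_mul, h1, h2]; noncomm_ring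

theorem deg_δ : Commute W.deg W.δ := by
  rw [deg_eq_sum]; exact .sum_left _ _ _ fun j _ => W.ρ_δ j j

theorem deg_δs : Commute W.deg W.δs := by
  rw [deg_eq_sum]; exact .sum_left _ _ _ fun j _ => W.ρ_δs j j

/-- The Laplacian of the Koszul complex is the total degree. -/
theorem δ_mul_δs : W.δ * W.δs = W.deg - W.δs * W.δ := by
  have h (j : Fin n) : W.δ * (W.c j * W.ξ j) =
      W.η j * W.ξ j - W.c j * W.w j - W.c j * W.ξ j * W.δ := by
    have h1 : W.δ * W.c j = W.η j - W.c j * W.δ := by rw [c_mul_δ]; abel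
    have h2 : W.δ * W.ξ j = W.ξ j * W.δ + W.w j := by rw [ξ_mul_δ]; abel
    rw [← mul_assoc, h1, sub_mul, mul_assoc (W.c j), h2]; noncomm_ring
  conv_lhs => rw [δs, Finset.mul_sum]
  simp only [h, Finset.sum_sub_distrib, degξ_eq_sum_η_mul_ξ, degW_eq_sum_c_mul_w, ← Finset.sum_mul]
  rw [deg, ← δs]; abel

theorem degξ_mul_ξ (r : Fin n) : W.degξ * W.ξ r = W.ξ r * W.degξ + W.ξ r := by
  have h (j : Fin n) : W.ξ j * W.η j * W.ξ r =
      W.ξ r * (W.ξ j * W.η j) + (if j = r then W.ξ j else 0) := by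
    rw [mul_assoc, W.η_mul_ξ, mul_add, ← mul_assoc, (W.ξξ j r).eq, mul_assoc]; simp
  simp [degξ, Finset.sum_mul, Finset.mul_sum, h, Finset.sum_add_distrib]

theorem degξ_mul_η (r : Fin n) : W.degξ * W.η r = W.η r * W.degξ - W.η r := by
  have h (j : Fin n) : W.η r * (W.ξ j * W.η j) =
      W.ξ j * W.η j * W.η r + (if r = j then W.η j else 0) := by
    rw [← mul_assoc, W.η_mul_ξ, add_mul, mul_assoc, (W.ηη r j).eq, mul_assoc]; simp
  simp [degξ, Finset.sum_mul, Finset.mul_sum, h, Finset.sum_add_distrib]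

theorem degξ_w (r : Fin n) : Commute W.degξ (W.w r) :=
  .sum_left _ _ _ fun j _ => (W.ξw j r).mul_left (W.ηw j r)

theorem degξ_c (r : Fin n) : Commute W.degξ (W.c r) :=
  .sum_left _ _ _ fun j _ => (W.ξc j r).mul_left (W.ηc j r)

theorem degξ_d (r : Fin n) : Commute W.degξ (W.d r) :=
  .sum_left _ _ _ fun j _ => (W.dξ r j).symm.mul_left (W.dη r j).symm

theorem degW_d (r : Fin n) : Commute W.degW (W.d r) :=
  .sum_left _ _ _ fun j _ => (W.dw r j).symm.mul_left (W.dc r j).symm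

theorem degW_x (r : Fin n) : Commute W.degW (W.x r) :=
  .sum_left _ _ _ fun j _ => (W.xw r j).symm.mul_left (W.xc r j).symm

theorem degξ_x (r : Fin n) : Commute W.degξ (W.x r) :=
  .sum_left _ _ _ fun j _ => (W.xξ r j).symm.mul_left (W.xη r j).symm

theorem degW_η (r : Fin n) : Commute W.degW (W.η r) :=
  .sum_left _ _ _ fun j _ => (W.ηw r j).symm.mul_left (W.ηc r j).symm

theorem degξ_mul_δ : W.degξ * W.δ = W.δ * W.degξ - W.δ := by
  have h (j : Fin n) : W.degξ * (W.w j * W.η j) = W.w j * W.η j * W.degξ - W.w j * W.η j := by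
    rw [← mul_assoc, (W.degξ_w j).eq, mul_assoc, degξ_mul_η]; noncomm_ring
  conv_lhs => rw [δ, Finset.mul_sum]
  simp only [h, Finset.sum_sub_distrib, ← Finset.sum_mul]
  rw [← δ]

theorem degξ_mul_δs : W.degξ * W.δs = W.δs * W.degξ + W.δs := by
  have h (j : Fin n) : W.degξ * (W.c j * W.ξ j) = W.c j * W.ξ j * W.degξ + W.c j * W.ξ j := by
    rw [← mul_assoc, (W.degξ_c j).eq, mul_assoc, degξ_mul_ξ]; noncomm_ring
  conv_lhs => rw [δs, Finset.mul_sum]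
  simp only [h, Finset.sum_add_distrib, ← Finset.sum_mul]
  rw [← δs]

theorem δ_mul_δ [IsAddTorsionFree R] : W.δ * W.δ = 0 := by
  have h (j : Fin n) : W.δ * (W.w j * W.η j) = -(W.w j * W.η j * W.δ) := by
    rw [← mul_assoc, ← neg_neg (W.δ * W.w j), ← w_mul_δ, neg_mul, mul_assoc, (W.δ_η j).eq,
      mul_assoc]
  have : W.δ * W.δ = -(W.δ * W.δ) := by
    conv_lhs => rhs; rw [δ]
    rw [Finset.mul_sum]
    simp only [h, Finset.sum_neg_distrib, ← Finset.sum_mul]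
    rw [← δ]
  exact self_eq_neg.mp this

theorem δs_mul_δs [IsAddTorsionFree R] : W.δs * W.δs = 0 := by
  have h (j : Fin n) : W.δs * (W.c j * W.ξ j) = -(W.c j * W.ξ j * W.δs) := by
    rw [← mul_assoc, ← neg_neg (W.δs * W.c j), ← c_mul_δs, neg_mul, mul_assoc, (W.δs_ξ j).eq,
      mul_assoc]
  have : W.δs * W.δs = -(W.δs * W.δs) := by
    conv_lhs => rhs; rw [δs]
    rw [Finset.mul_sum]
    simp only [h, Finset.sum_neg_distrib, ← Finset.sum_mul]
    rw [← δs]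
  exact self_eq_neg.mp this

variable {n : ℕ} {R : Type*} [Ring R] (W : WeylClifford n R)

/-! ### Commutators with the divergence -/

theorem div_d (r : Fin n) : Commute (W.d r) W.div :=
  .sum_right _ _ _ fun j _ => (W.dd r j).mul_right (W.dη r j)

theorem div_mul_x (r : Fin n) : W.div * W.x r = W.x r * W.div + W.η r := by
  have h (j : Fin n) : W.d j * W.η j * W.x r =
      W.x r * (W.d j * W.η j) + (if j = r then W.η j else 0) := by
    rw [mul_assoc, ← (W.xη r j).eq, ← mul_assoc, W.d_mul_x, add_mul, mul_assoc]; simp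
  simp [div, Finset.sum_mul, Finset.mul_sum, h, Finset.sum_add_distrib]

theorem div_mul_ρ (i j : Fin n) : W.div * W.ρ i j = W.ρ i j * W.div + W.η j * W.d i := by
  have h (r : Fin n) : W.d r * W.η r * W.ρ i j =
      W.ρ i j * (W.d r * W.η r) + (if r = i then W.d r * W.η j else 0) := by
    have h1 : W.d r * W.η r * (W.w i * W.c j) = W.w i * W.c j * (W.d r * W.η r) :=
      (((W.dw r i).mul_right (W.dc r j)).mul_left ((W.ηw r i).mul_right (W.ηc r j))).eq
    have h2 : W.d r * W.η r * (W.ξ i * W.η j) =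
        W.ξ i * W.η j * (W.d r * W.η r) + (if r = i then W.d r * W.η j else 0) := by
      have h3 : W.d r * (W.ξ i * W.η j) = W.ξ i * W.η j * W.d r :=
        ((W.dξ r i).mul_right (W.dη r j)).eq
      calc W.d r * W.η r * (W.ξ i * W.η j) = W.d r * (W.η r * W.ξ i) * W.η j := by noncomm_ring
        _ = W.d r * (W.ξ i * (W.η r * W.η j)) + (if r = i then W.d r * W.η j else 0) := by
          rw [W.η_mul_ξ, mul_add, add_mul]; simp [mul_assoc]
        _ = _ := by
          rw [(W.ηη r j).eq, ← mul_assoc (W.ξ i), ← mul_assoc (W.d r), h3, mul_assoc]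
    rw [ρ, mul_add, h1, h2]; noncomm_ring
  simp only [div, Finset.sum_mul, h, Finset.sum_add_distrib, ← Finset.mul_sum]
  simp [(W.dη i j).eq]

theorem div_eulerX : W.div * W.eulerX = W.eulerX * W.div + W.div := by
  have h (j : Fin n) : W.div * (W.x j * W.d j) = W.x j * W.d j * W.div + W.d j * W.η j := by
    rw [← mul_assoc, div_mul_x, add_mul, mul_assoc, ← (W.div_d j).eq, (W.dη j j).eq, mul_assoc]
  simp only [eulerX, Finset.mul_sum, h, Finset.sum_add_distrib, ← Finset.sum_mul]
  rfl

theorem div_mul_deg : W.div * W.deg = W.deg * W.div + W.div := by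
  simp only [deg_eq_sum, Finset.mul_sum, div_mul_ρ, Finset.sum_add_distrib, ← Finset.sum_mul]
  simp [div, fun j => (W.dη j j).eq]

theorem x_ρ (r i j : Fin n) : Commute (W.x r) (W.ρ i j) :=
  ((W.xw r i).mul_right (W.xc r j)).add_right ((W.xξ r i).mul_right (W.xη r j))

theorem d_ρ (r i j : Fin n) : Commute (W.d r) (W.ρ i j) :=
  ((W.dw r i).mul_right (W.dc r j)).add_right ((W.dξ r i).mul_right (W.dη r j))

theorem lieLin_div (s r : Fin n) : Commute (W.lieLin s r) W.div := by
  have h1 : W.div * (W.x s * W.d r) = W.x s * W.d r * W.div + W.η s * W.d r := by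
    rw [← mul_assoc, div_mul_x, add_mul, mul_assoc, ← (W.div_d r).eq, mul_assoc]
  rw [Commute, SemiconjBy, lieLin, mul_sub, h1, div_mul_ρ]; noncomm_ring

theorem lieLin_δ (s r : Fin n) : Commute (W.lieLin s r) W.δ :=
  ((W.δ_x s).mul_left (W.δ_d r)).sub_left (W.ρ_δ r s)

theorem lieLin_δs (s r : Fin n) : Commute (W.lieLin s r) W.δs :=
  ((W.δs_x s).mul_left (W.δs_d r)).sub_left (W.ρ_δs r s)

theorem eulerX_δ : Commute W.eulerX W.δ :=
  .sum_left _ _ _ fun j _ => (W.δ_x j).mul_left (W.δ_d j)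

theorem eulerX_δs : Commute W.eulerX W.δs :=
  .sum_left _ _ _ fun j _ => (W.δs_x j).mul_left (W.δs_d j)

theorem lieQuad_δ (r : Fin n) : Commute (W.lieQuad r) W.δ :=
  ((W.δ_x r).mul_left (W.eulerX_δ.sub_left W.deg_δ)).sub_left
    (.sum_left _ _ _ fun i _ => (W.δ_x i).mul_left (W.ρ_δ i r))

theorem lieQuad_δs (r : Fin n) : Commute (W.lieQuad r) W.δs :=
  ((W.δs_x r).mul_left (W.eulerX_δs.sub_left W.deg_δs)).sub_left
    (.sum_left _ _ _ fun i _ => (W.δs_x i).mul_left (W.ρ_δs i r))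

/-- The failure of invariance of the divergence under the quadratic field `x^r 𝓔`. -/
theorem div_mul_lieQuad (r : Fin n) : W.div * W.lieQuad r =
    W.lieQuad r * W.div -
      (W.η r * W.deg + W.δ * W.c r + (W.degξ + n) * W.η r) := by
  have h1 : W.div * (W.x r * (W.eulerX - W.deg)) =
      W.x r * (W.eulerX - W.deg) * W.div + W.η r * (W.eulerX - W.deg) := by
    rw [← mul_assoc, div_mul_x, add_mul, mul_assoc, mul_sub W.div, div_eulerX, div_mul_deg]
    noncomm_ring
  have h2 (i : Fin n) : W.div * (W.x i * W.ρ i r) = W.x i * W.ρ i r * W.div +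
      W.η r * (W.x i * W.d i) + (W.w i * W.η i * W.c r + W.η i * W.ξ i * W.η r) := by
    have h3 : W.x i * (W.η r * W.d i) = W.η r * (W.x i * W.d i) := by
      rw [← mul_assoc, (W.xη i r).eq, mul_assoc]
    have h4 : W.η i * W.ρ i r = W.w i * W.η i * W.c r + W.η i * W.ξ i * W.η r := by
      rw [ρ, mul_add, ← mul_assoc, (W.ηw i i).eq, mul_assoc (W.η i)]
    rw [← mul_assoc, div_mul_x, add_mul, mul_assoc, div_mul_ρ, mul_add, h3, h4, ← mul_assoc]
  have h5 : W.div * ∑ i, W.x i * W.ρ i r = (∑ i, W.x i * W.ρ i r) * W.div +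
      W.η r * W.eulerX + (W.δ * W.c r + (W.degξ + n) * W.η r) := by
    simp only [Finset.mul_sum, h2, Finset.sum_add_distrib, ← Finset.sum_mul,
      degξ_eq_sum_η_mul_ξ]
    rw [← Finset.mul_sum]; rfl
  rw [lieQuad, mul_sub, h1, h5]; noncomm_ring

theorem lieQuad_eq (r : Fin n) : W.x r * W.eulerX -
    (W.x r * W.deg + ∑ i, W.x i * W.ρ i r) = W.lieQuad r := by
  rw [lieQuad, mul_sub, sub_sub]

/-! ### The invariant operators `A` and `B` -/
/-- `δ ∘ ∂_{ξ_r} ∘ δ^*`. -/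
def a (r : Fin n) : R := W.δ * W.η r * W.δs

/-- `δ^* ∘ ∂_{ξ_r} ∘ δ`. -/
def b (r : Fin n) : R := W.δs * W.η r * W.δ

/-- `δ ∘ (η∂) ∘ δ^*`. -/
def A : R := W.δ * (W.div * W.δs)

/-- `δ^* ∘ (η∂) ∘ δ`. -/
def B : R := W.δs * (W.div * W.δ)

theorem A_eq_sum : W.A = ∑ r, W.d r * W.a r := by
  simp only [A, div, Finset.mul_sum, Finset.sum_mul]
  refine Finset.sum_congr rfl fun r _ => ?_
  rw [a, ← mul_assoc, ← mul_assoc, ← (W.δ_d r).eq]; noncomm_ring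

theorem B_eq_sum : W.B = ∑ r, W.d r * W.b r := by
  simp only [B, div, Finset.mul_sum, Finset.sum_mul]
  refine Finset.sum_congr rfl fun r _ => ?_
  rw [b, ← mul_assoc, ← mul_assoc, ← (W.δs_d r).eq]; noncomm_ring

theorem A_d (r : Fin n) : Commute (W.d r) W.A :=
  (W.δ_d r).mul_right ((W.div_d r).mul_right (W.δs_d r))

theorem B_d (r : Fin n) : Commute (W.d r) W.B :=
  (W.δs_d r).mul_right ((W.div_d r).mul_right (W.δ_d r))

theorem lieLin_A (s r : Fin n) : Commute (W.lieLin s r) W.A :=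
  (W.lieLin_δ s r).mul_right ((W.lieLin_div s r).mul_right (W.lieLin_δs s r))

theorem lieLin_B (s r : Fin n) : Commute (W.lieLin s r) W.B :=
  (W.lieLin_δs s r).mul_right ((W.lieLin_div s r).mul_right (W.lieLin_δ s r))

theorem d_a (i r : Fin n) : Commute (W.d i) (W.a r) :=
  ((W.δ_d i).mul_right (W.dη i r)).mul_right (W.δs_d i)

theorem d_b (i r : Fin n) : Commute (W.d i) (W.b r) :=
  ((W.δs_d i).mul_right (W.dη i r)).mul_right (W.δ_d i)

/-- The right-hand side is the defect of equivariance, along `x^r 𝓔`, of the identification of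
symbols with differential operators. -/
theorem a_add_b (r : Fin n) : W.a r + W.b r =
    W.degξ * W.η r + W.δ * W.c r + W.degW * W.η r := by
  have h1 : W.a r = W.deg * W.η r - W.δs * W.δ * W.η r + W.δ * W.c r := by
    rw [a, mul_assoc, η_mul_δs, mul_add, ← mul_assoc, δ_mul_δs]; noncomm_ring
  have h2 : W.b r = W.δs * W.δ * W.η r := by rw [b, mul_assoc, ← (W.δ_η r).eq, mul_assoc]
  rw [h1, h2, deg]; noncomm_ring

/-- The left-hand side is the composition on the left with `x^s ∂_r`, expressed on symbols; the
bracket is the composition on the right with the Lie derivative of forms. -/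
theorem lieLin_add_right (s r : Fin n) : W.x s * (W.d r + W.ξ r) =
    W.lieLin s r + (W.ξ r * (W.x s + W.η s) + W.w r * W.c s) := by
  rw [mul_add, mul_add, (W.xξ s r).eq, lieLin, ρ]; abel

/-- The first sum is the composition on the left with `x^r 𝓔`, expressed on symbols; the bracket is
the composition on the right with the Lie derivative of forms. Their difference is `L_r`, up to
`a_r + b_r`. -/
theorem lieQuad_add_right (r : Fin n) :
    ∑ i, W.x r * W.x i * (W.d i + W.ξ i) + (W.a r + W.b r) = W.lieQuad r +
      (∑ i, W.ξ i * ((W.x i + W.η i) * (W.x r + W.η r)) + ∑ i, ∑ j, W.w i * W.c j *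
        ((if j = i then W.x r + W.η r else 0) + (if j = r then W.x i + W.η i else 0))) := by
  have h1 : ∑ i, W.x r * W.x i * (W.d i + W.ξ i) =
      W.x r * W.eulerX + ∑ i, W.x r * W.x i * W.ξ i := by
    simp only [mul_add, Finset.sum_add_distrib, mul_assoc, ← Finset.mul_sum]
    rfl
  have h2 (i : Fin n) : W.ξ i * ((W.x i + W.η i) * (W.x r + W.η r)) =
      W.x r * W.x i * W.ξ i + W.x i * (W.ξ i * W.η r) + W.x r * (W.ξ i * W.η i) +
        W.ξ i * W.η i * W.η r := by
    have e1 : W.ξ i * (W.x i * W.x r) = W.x r * W.x i * W.ξ i := by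
      rw [(W.xx i r).eq, ((W.xξ r i).mul_left (W.xξ i i)).eq]
    have e2 : W.ξ i * (W.x i * W.η r) = W.x i * (W.ξ i * W.η r) := by
      rw [← mul_assoc, ← (W.xξ i i).eq, mul_assoc]
    have e3 : W.ξ i * (W.η i * W.x r) = W.x r * (W.ξ i * W.η i) := by
      rw [← mul_assoc, ((W.xξ r i).mul_right (W.xη r i)).eq]
    rw [add_mul, mul_add, mul_add, mul_add, mul_add, mul_add, e1, e2, e3]; noncomm_ring
  have h3 : ∑ i, ∑ j, W.w i * W.c j *
      ((if j = i then W.x r + W.η r else 0) + (if j = r then W.x i + W.η i else 0)) =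
      W.x r * W.degW + W.degW * W.η r + (∑ i, W.x i * (W.w i * W.c r) + W.δ * W.c r) := by
    have e (i : Fin n) : W.w i * W.c r * (W.x i + W.η i) =
        W.x i * (W.w i * W.c r) + W.w i * W.η i * W.c r := by
      rw [mul_add, ← ((W.xw i i).mul_right (W.xc i r)).eq, mul_assoc (W.w i) (W.c r) (W.η i),
        ← (W.ηc i r).eq, mul_assoc (W.w i) (W.η i)]
    simp only [mul_add (W.w _ * W.c _) (ite _ _ _), mul_ite, mul_zero, Finset.sum_add_distrib,
      Finset.sum_ite_eq', Finset.mem_univ, if_true, ← Finset.sum_mul, e]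
    rw [← (W.degW_x r).eq, ← mul_add]
    rfl
  have h4 : ∑ i, W.x i * W.ρ i r =
      ∑ i, W.x i * (W.w i * W.c r) + ∑ i, W.x i * (W.ξ i * W.η r) := by
    simp only [ρ, mul_add, Finset.sum_add_distrib]
  rw [h1, h3, ← lieQuad_eq, h4, a_add_b]
  simp only [h2, Finset.sum_add_distrib, ← Finset.mul_sum, ← Finset.sum_mul]
  have f : ∑ i, W.ξ i * W.η i = W.degξ := rfl
  rw [f, deg]
  noncomm_ring

section TorsionFree

variable [IsAddTorsionFree R]

/-- Sandwiching the commutator of `η∂` with `x^r 𝓔` between `δ` and `δ^*` kills its term `δ c_r`. -/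
theorem A_mul_lieQuad (r : Fin n) : W.A * W.lieQuad r =
    W.lieQuad r * W.A - W.a r * (W.deg + W.degξ + n) := by
  have h1 : W.δ * (W.η r * W.deg) * W.δs = W.a r * W.deg := by
    rw [← mul_assoc, mul_assoc _ W.deg, W.deg_δs.eq, a]; noncomm_ring
  have h2 : W.δ * (W.δ * W.c r) * W.δs = 0 := by
    rw [← mul_assoc, δ_mul_δ]; noncomm_ring
  have h3 : W.δ * ((W.degξ + n) * W.η r) * W.δs = W.a r * (W.degξ + n) := by
    have : (W.degξ + n) * W.η r = W.η r * (W.degξ + n - 1) := by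
      rw [add_mul, degξ_mul_η, Nat.cast_comm]; noncomm_ring
    have h4 : (W.degξ + n - 1) * W.δs = W.δs * (W.degξ + n) := by
      rw [sub_mul, add_mul, degξ_mul_δs, Nat.cast_comm]; noncomm_ring
    rw [this, ← mul_assoc, mul_assoc _ _ W.δs, h4, a]; noncomm_ring
  calc W.A * W.lieQuad r = W.δ * (W.div * W.lieQuad r) * W.δs := by
        rw [A, mul_assoc, mul_assoc, ← (W.lieQuad_δs r).eq]; noncomm_ring
    _ = W.δ * W.lieQuad r * W.div * W.δs - (W.δ * (W.η r * W.deg) * W.δs +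
          W.δ * (W.δ * W.c r) * W.δs + W.δ * ((W.degξ + n) * W.η r) * W.δs) := by
        rw [div_mul_lieQuad]; noncomm_ring
    _ = _ := by rw [h1, h2, h3, ← (W.lieQuad_δ r).eq, A]; noncomm_ring

theorem B_mul_lieQuad (r : Fin n) : W.B * W.lieQuad r =
    W.lieQuad r * W.B - W.b r * (W.deg + W.degξ + n - 1) := by
  have h1 : W.δs * (W.η r * W.deg) * W.δ = W.b r * W.deg := by
    rw [← mul_assoc, mul_assoc _ W.deg, W.deg_δ.eq, b]; noncomm_ring
  have h2 : W.δs * (W.δ * W.c r) * W.δ = W.b r := by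
    rw [mul_assoc, mul_assoc, c_mul_δ, mul_sub, ← mul_assoc W.δ W.δ, δ_mul_δ, zero_mul, sub_zero,
      (W.δ_η r).eq, b, mul_assoc]
  have h3 : W.δs * ((W.degξ + n) * W.η r) * W.δ = W.b r * (W.degξ + n - 2) := by
    have : (W.degξ + n) * W.η r = W.η r * (W.degξ + n - 1) := by
      rw [add_mul, degξ_mul_η, Nat.cast_comm]; noncomm_ring
    have h4 : (W.degξ + n - 1) * W.δ = W.δ * (W.degξ + n - 2) := by
      rw [sub_mul, add_mul, degξ_mul_δ, Nat.cast_comm]; noncomm_ring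
    rw [this, ← mul_assoc, mul_assoc _ _ W.δ, h4, b]; noncomm_ring
  calc W.B * W.lieQuad r = W.δs * (W.div * W.lieQuad r) * W.δ := by
        rw [B, mul_assoc, mul_assoc, ← (W.lieQuad_δ r).eq]; noncomm_ring
    _ = W.δs * W.lieQuad r * W.div * W.δ - (W.δs * (W.η r * W.deg) * W.δ +
          W.δs * (W.δ * W.c r) * W.δ + W.δs * ((W.degξ + n) * W.η r) * W.δ) := by
        rw [div_mul_lieQuad]; noncomm_ring
    _ = _ := by rw [h1, h2, h3, ← (W.lieQuad_δs r).eq, B]; noncomm_ring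

theorem a_a (i r : Fin n) : Commute (W.a i) (W.a r) := by
  have h (i r : Fin n) : W.a i * W.a r = W.δ * (W.η i * W.η r) * W.deg * W.δs -
      W.δ * (W.η i * W.η r) * W.δs := by
    have h1 : W.δs * W.δ = W.deg - W.δ * W.δs := by rw [δ_mul_δs]; abel
    have h2 : W.deg * W.η r = W.η r * W.deg - W.η r := by
      rw [deg, add_mul, degξ_mul_η, (W.degW_η r).eq]; noncomm_ring
    have h3 : W.δ * W.η i * W.δ = 0 := by
      rw [mul_assoc, ← (W.δ_η i).eq, ← mul_assoc, δ_mul_δ, zero_mul]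
    calc W.a i * W.a r = W.δ * W.η i * (W.δs * W.δ) * W.η r * W.δs := by
          rw [a, a]; noncomm_ring
      _ = W.δ * W.η i * (W.deg * W.η r) * W.δs - W.δ * W.η i * W.δ * (W.δs * W.η r * W.δs) := by
          rw [h1]; noncomm_ring
      _ = _ := by rw [h2, h3]; noncomm_ring
  rw [Commute, SemiconjBy, h, h, (W.ηη i r).eq]

theorem b_b (i r : Fin n) : Commute (W.b i) (W.b r) := by
  have h (i r : Fin n) : W.b i * W.b r = W.δs * (W.η i * W.η r) * W.deg * W.δ -
      W.δs * (W.η i * W.η r) * W.δ := by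
    have h1 : W.δ * W.δs = W.deg - W.δs * W.δ := δ_mul_δs _
    have h2 : W.deg * W.η r = W.η r * W.deg - W.η r := by
      rw [deg, add_mul, degξ_mul_η, (W.degW_η r).eq]; noncomm_ring
    have h3 : W.δ * W.η r * W.δ = 0 := by
      rw [mul_assoc, ← (W.δ_η r).eq, ← mul_assoc, δ_mul_δ, zero_mul]
    calc W.b i * W.b r = W.δs * W.η i * (W.δ * W.δs) * W.η r * W.δ := by
          rw [b, b]; noncomm_ring
      _ = W.δs * W.η i * (W.deg * W.η r) * W.δ - W.δs * W.η i * W.δs * (W.δ * W.η r * W.δ) := by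
          rw [h1]; noncomm_ring
      _ = _ := by rw [h2, h3]; noncomm_ring
  rw [Commute, SemiconjBy, h, h, (W.ηη i r).eq]

theorem a_A (r : Fin n) : Commute (W.a r) W.A := by
  rw [A_eq_sum]; exact .sum_right _ _ _ fun i _ => (W.d_a i r).symm.mul_right (W.a_a r i)

theorem b_B (r : Fin n) : Commute (W.b r) W.B := by
  rw [B_eq_sum]; exact .sum_right _ _ _ fun i _ => (W.d_b i r).symm.mul_right (W.b_b r i)

theorem a_mul_B (r : Fin n) : W.a r * W.B = 0 := by
  rw [a, B, mul_assoc, ← mul_assoc W.δs, δs_mul_δs, zero_mul, mul_zero]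

theorem b_mul_A (r : Fin n) : W.b r * W.A = 0 := by
  rw [b, A, mul_assoc, ← mul_assoc W.δ W.δ, δ_mul_δ, zero_mul, mul_zero]

end TorsionFree

/-! ### The Casimir operator -/

/-- The Casimir operator of `sl_{n+1}`, up to a scalar factor, as an expression in the images
`lin s r`, `quad r`, `tr r` of the fields `x^s ∂_r`, `x^r 𝓔`, `∂_r`. -/
def casimirOf {n : ℕ} {R : Type*} [Ring R] (lin : Fin n → Fin n → R) (quad tr : Fin n → R) : R :=
  ∑ i, ∑ j, lin j i * lin i j - 2 • ∑ i, quad i * tr i +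
    (∑ i, lin i i) * (∑ i, lin i i) - (n + 1 : ℕ) • ∑ i, lin i i

/-- The Casimir operator of the action of `sl_{n+1}` on symbols. -/
def casimir : R := casimirOf W.lieLin W.lieQuad W.d

theorem sum_lieLin : ∑ i, W.lieLin i i = W.eulerX - W.deg := by
  simp [lieLin, eulerX, deg_eq_sum, Finset.sum_sub_distrib]

theorem eulerX_mul_d (j : Fin n) : W.eulerX * W.d j = W.d j * W.eulerX - W.d j := by
  have h (i : Fin n) : W.d j * (W.x i * W.d i) =
      W.x i * W.d i * W.d j + (if j = i then W.d i else 0) := by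
    rw [← mul_assoc, W.d_mul_x, add_mul, mul_assoc, (W.dd j i).eq, mul_assoc]; simp
  simp [eulerX, Finset.sum_mul, Finset.mul_sum, h, Finset.sum_add_distrib]

theorem sum_d_mul_x : ∑ i, W.d i * W.x i = W.eulerX + n := by
  simp [W.d_mul_x, Finset.sum_add_distrib, eulerX]

theorem deg_x (r : Fin n) : Commute (W.x r) W.deg :=
  ((W.degW_x r).add_left (W.degξ_x r)).symm

/-- On symbols, the Casimir operator only involves the fibre. -/
theorem casimir_eq_sum_ρ : W.casimir =
    ∑ i, ∑ j, W.ρ i j * W.ρ j i + W.deg * W.deg + (n + 1 : ℕ) • W.deg := by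
  set T := ∑ i, ∑ j, W.x j * W.d i * W.ρ j i with hT
  have h1 : ∑ i, ∑ j, W.lieLin j i * W.lieLin i j =
      W.eulerX * W.eulerX - W.eulerX + n • W.eulerX - 2 • T + ∑ i, ∑ j, W.ρ i j * W.ρ j i := by
    have e (i j : Fin n) : W.lieLin j i * W.lieLin i j =
        W.x j * (W.d i * W.x i) * W.d j - W.x j * W.d i * W.ρ j i - W.x i * W.d j * W.ρ i j +
          W.ρ i j * W.ρ j i := by
      have : W.ρ i j * (W.x i * W.d j) = W.x i * W.d j * W.ρ i j :=
        ((W.x_ρ i i j).mul_left (W.d_ρ j i j)).symm.eq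
      rw [lieLin, lieLin, sub_mul, mul_sub, mul_sub, this]; noncomm_ring
    have e1 : ∑ i, ∑ j, W.x j * (W.d i * W.x i) * W.d j =
        W.eulerX * W.eulerX - W.eulerX + n • W.eulerX := by
      rw [Finset.sum_comm]
      simp only [← Finset.sum_mul, ← Finset.mul_sum, sum_d_mul_x]
      have (j : Fin n) : W.x j * (W.eulerX + n) * W.d j =
          W.x j * W.d j * W.eulerX - W.x j * W.d j + n • (W.x j * W.d j) := by
        rw [mul_assoc, add_mul, eulerX_mul_d, nsmul_eq_mul, Nat.cast_comm n (W.d j),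
          Nat.cast_comm n (W.x j * W.d j)]
        noncomm_ring
      simp only [this, Finset.sum_add_distrib, Finset.sum_sub_distrib, ← Finset.sum_mul,
        ← Finset.smul_sum]
      rfl
    have e2 : ∑ i, ∑ j, W.x i * W.d j * W.ρ i j = T := Finset.sum_comm
    simp only [e, Finset.sum_add_distrib, Finset.sum_sub_distrib]
    rw [e1, e2, ← hT]; abel
  have h2 : ∑ i, W.lieQuad i * W.d i =
      W.eulerX * W.eulerX - W.eulerX - W.deg * W.eulerX - T := by
    have e (i : Fin n) : W.lieQuad i * W.d i = W.x i * W.d i * W.eulerX - W.x i * W.d i -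
        W.deg * (W.x i * W.d i) - ∑ j, W.x j * W.d i * W.ρ j i := by
      have e1 : (∑ j, W.x j * W.ρ j i) * W.d i = ∑ j, W.x j * W.d i * W.ρ j i := by
        rw [Finset.sum_mul]
        refine Finset.sum_congr rfl fun j _ => ?_
        rw [mul_assoc, ← (W.d_ρ i j i).eq, mul_assoc]
      have e2 : W.x i * W.deg = W.deg * W.x i := (W.deg_x i).eq
      rw [lieQuad, sub_mul, e1, mul_sub, sub_mul, mul_assoc, eulerX_mul_d, e2]; noncomm_ring
    simp only [e, Finset.sum_sub_distrib, ← Finset.sum_mul, ← Finset.mul_sum]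
    rw [← hT, ← eulerX]
  have h3 : W.deg * W.eulerX = W.eulerX * W.deg := by
    rw [eulerX, Finset.sum_mul, Finset.mul_sum]
    refine Finset.sum_congr rfl fun i _ => ?_
    exact ((W.deg_x i).symm.mul_right ((W.degW_d i).add_left (W.degξ_d i))).eq
  rw [casimir, casimirOf, h1, h2, sum_lieLin, h3]
  simp only [sub_mul, mul_sub, smul_sub, h3, add_smul, one_smul]
  abel

/-- The quadratic Casimir operator of `gl(n)` on the fibre, in terms of the Koszul differentials. -/
theorem sum_ρ_mul_ρ : ∑ i, ∑ j, W.ρ i j * W.ρ j i =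
    2 • (W.δ * W.δs) - 2 • W.degW + W.degW * ((n + 1 : ℕ) - W.degW) +
      W.degξ * (W.degξ + n - 1) := by
  have e (i j : Fin n) : W.ρ i j * W.ρ j i = W.w i * (W.c j * W.w j) * W.c i +
      W.w i * (W.c j * W.ξ j) * W.η i + W.ξ i * (W.w j * W.η j) * W.c i +
      W.ξ i * (W.η j * W.ξ j) * W.η i := by
    have : W.ξ i * W.η j * (W.w j * W.c i) = W.ξ i * (W.w j * W.η j) * W.c i := by
      rw [mul_assoc, ← mul_assoc (W.η j), (W.ηw j j).eq]; noncomm_ring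
    rw [ρ, ρ, add_mul, mul_add, mul_add, this]; noncomm_ring
  have h1 (i : Fin n) : W.w i * (n - W.degW) * W.c i = W.w i * W.c i * ((n + 1 : ℕ) - W.degW) := by
    have h (j : Fin n) : W.c i * (W.w j * W.c j) =
        W.w j * W.c j * W.c i + (if i = j then W.c j else 0) := by
      rw [← mul_assoc, W.c_mul_w, add_mul, neg_mul, mul_assoc, W.c_mul_c i j, mul_neg, neg_neg,
        mul_assoc]; simp
    have : W.c i * W.degW = W.degW * W.c i + W.c i := by
      simp [degW, Finset.sum_mul, Finset.mul_sum, h, Finset.sum_add_distrib]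
    have h' : (n - W.degW) * W.c i = W.c i * ((n + 1 : ℕ) - W.degW) := by
      rw [mul_sub, this, sub_mul, ← Nat.cast_comm, Nat.cast_succ, add_mul]; noncomm_ring
    rw [mul_assoc, h', mul_assoc]
  have h2 (i : Fin n) : W.w i * W.δs * W.η i = W.w i * W.η i * W.δs -
      W.w i * W.c i := by
    rw [mul_assoc, mul_assoc (W.w i) (W.η i), η_mul_δs]; noncomm_ring
  have h3 (i : Fin n) : W.ξ i * W.δ * W.c i = W.δ * (W.c i * W.ξ i) - W.w i * W.c i := by
    rw [ξ_mul_δ, sub_mul, mul_assoc, (W.ξc i i).eq]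
  have h4 (i : Fin n) : W.ξ i * (W.degξ + n) * W.η i = W.ξ i * W.η i * (W.degξ + n - 1) := by
    have : (W.degξ + n) * W.η i = W.η i * (W.degξ + n - 1) := by
      rw [add_mul, degξ_mul_η, Nat.cast_comm]; noncomm_ring
    rw [mul_assoc, this, mul_assoc]
  simp only [e, Finset.sum_add_distrib, ← Finset.sum_mul, ← Finset.mul_sum,
    degξ_eq_sum_η_mul_ξ, degW_eq_sum_c_mul_w]
  have f1 : ∑ j, W.w j * W.η j = W.δ := rfl
  have f2 : ∑ j, W.c j * W.ξ j = W.δs := rfl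
  have f3 : ∑ j, W.w j * W.c j = W.degW := rfl
  have f4 : ∑ j, W.ξ j * W.η j = W.degξ := rfl
  simp only [f1, f2, h1, h2, h3, h4, Finset.sum_sub_distrib,
    ← Finset.sum_mul, ← Finset.mul_sum, f3, f4]
  noncomm_ring

/-! ### Equivariance of the explicit operator -/

section Shift

variable {n : ℕ} {R : Type*} [Ring R] (W : WeylClifford n R)

theorem degξ_mul_div : W.degξ * W.div = W.div * W.degξ - W.div := by
  have h (j : Fin n) : W.degξ * (W.d j * W.η j) = W.d j * W.η j * W.degξ - W.d j * W.η j := by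
    rw [← mul_assoc, (W.degξ_d j).eq, mul_assoc, degξ_mul_η]; noncomm_ring
  conv_lhs => rw [div, Finset.mul_sum]
  simp only [h, Finset.sum_sub_distrib, ← Finset.sum_mul]
  rfl

theorem deg_mul_div : W.deg * W.div = W.div * W.deg - W.div := by
  rw [div_mul_deg, add_sub_cancel_right]

theorem degξ_mul_A : W.degξ * W.A = W.A * W.degξ - W.A := by
  rw [A, ← mul_assoc, degξ_mul_δ, sub_mul, mul_assoc, ← mul_assoc W.degξ, degξ_mul_div, sub_mul,
    mul_assoc, degξ_mul_δs]
  noncomm_ring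

theorem degξ_mul_B : W.degξ * W.B = W.B * W.degξ - W.B := by
  rw [B, ← mul_assoc, degξ_mul_δs, add_mul, mul_assoc, ← mul_assoc W.degξ, degξ_mul_div, sub_mul,
    mul_assoc, degξ_mul_δ]
  noncomm_ring

theorem deg_mul_A : W.deg * W.A = W.A * W.deg - W.A := by
  rw [A, ← mul_assoc, W.deg_δ.eq, mul_assoc, ← mul_assoc W.deg, deg_mul_div, sub_mul,
    mul_assoc, W.deg_δs.eq]
  noncomm_ring

theorem deg_mul_B : W.deg * W.B = W.B * W.deg - W.B := by
  rw [B, ← mul_assoc, W.deg_δs.eq, mul_assoc, ← mul_assoc W.deg, deg_mul_div, sub_mul,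
    mul_assoc, W.deg_δ.eq]
  noncomm_ring

end Shift

variable {n : ℕ} {V : Type*} [AddCommGroup V] [Module ℝ V] (W : WeylClifford n (Module.End ℝ V))

/-- If `N T = T N - T`, then `T` lowers the eigenvalue of `N` by one. -/
theorem pow_apply_of_lowering {V : Type*} [AddCommGroup V] [Module ℝ V] {T N : Module.End ℝ V}
    (h : N * T = T * N - T) {u : V} {m : ℝ} (hu : N u = m • u) (l : ℕ) :
    N ((T ^ l) u) = (m - l) • (T ^ l) u := by
  induction l with
  | zero => simpa using hu
  | succ l ih =>
    have := congrArg (fun S : Module.End ℝ V => S ((T ^ l) u)) h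
    simp only [Module.End.mul_apply, LinearMap.sub_apply, ih] at this
    rw [pow_succ', Module.End.mul_apply, this, map_smul]
    push_cast
    module

instance : IsAddTorsionFree (Module.End ℝ V) :=
  letI := Module.compHom (Module.End ℝ V) (algebraMap ℚ ℝ)
  .of_module_rat _

variable {u : V} {k p : ℝ}

theorem A_pow_lieQuad (hξ : W.degξ u = k • u) (hd : W.deg u = (k + p) • u) (r : Fin n) (l : ℕ) :
    (W.A ^ (l + 1)) (W.lieQuad r u) = W.lieQuad r ((W.A ^ (l + 1)) u) -
      ((l + 1) * (n + p + 2 * k - l)) • W.a r ((W.A ^ l) u) := by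
  have hn (v : V) : (n : Module.End ℝ V) v = (n : ℝ) • v := by
    rw [Module.End.natCast_apply, Nat.cast_smul_eq_nsmul]
  have step (l : ℕ) : W.A (W.lieQuad r ((W.A ^ l) u)) = W.lieQuad r ((W.A ^ (l + 1)) u) -
      (n + p + 2 * k - 2 * l) • W.a r ((W.A ^ l) u) := by
    have := congrArg (fun S : Module.End ℝ V => S ((W.A ^ l) u)) (W.A_mul_lieQuad r)
    simp only [Module.End.mul_apply, LinearMap.sub_apply, LinearMap.add_apply, hn,
      pow_apply_of_lowering W.degξ_mul_A hξ, pow_apply_of_lowering W.deg_mul_A hd] at this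
    rw [this, pow_succ' W.A, Module.End.mul_apply, ← add_smul, ← add_smul, map_smul]
    congr 2
    ring
  induction l with
  | zero => simpa using step 0
  | succ l ih =>
    have h : W.A (W.a r ((W.A ^ l) u)) = W.a r ((W.A ^ (l + 1)) u) := by
      rw [pow_succ' W.A, Module.End.mul_apply, ← Module.End.mul_apply, ← (W.a_A r).eq]; rfl
    have e : (W.A ^ (l + 1 + 1)) (W.lieQuad r u) = W.A ((W.A ^ (l + 1)) (W.lieQuad r u)) := by
      rw [pow_succ', Module.End.mul_apply]
    rw [e, ih, map_sub, map_smul, h, step]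
    push_cast
    module

theorem B_pow_lieQuad (hξ : W.degξ u = k • u) (hd : W.deg u = (k + p) • u) (r : Fin n) (l : ℕ) :
    (W.B ^ (l + 1)) (W.lieQuad r u) = W.lieQuad r ((W.B ^ (l + 1)) u) -
      ((l + 1) * (n + p + 2 * k - 1 - l)) • W.b r ((W.B ^ l) u) := by
  have hn (v : V) : (n : Module.End ℝ V) v = (n : ℝ) • v := by
    rw [Module.End.natCast_apply, Nat.cast_smul_eq_nsmul]
  have step (l : ℕ) : W.B (W.lieQuad r ((W.B ^ l) u)) = W.lieQuad r ((W.B ^ (l + 1)) u) -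
      (n + p + 2 * k - 1 - 2 * l) • W.b r ((W.B ^ l) u) := by
    have := congrArg (fun S : Module.End ℝ V => S ((W.B ^ l) u)) (W.B_mul_lieQuad r)
    simp only [Module.End.mul_apply, LinearMap.sub_apply, LinearMap.add_apply, hn,
      pow_apply_of_lowering W.degξ_mul_B hξ, pow_apply_of_lowering W.deg_mul_B hd] at this
    rw [this, pow_succ' W.B, Module.End.mul_apply, Module.End.one_apply, ← add_smul, ← add_smul,
      map_sub, map_smul]
    module
  induction l with
  | zero => simpa using step 0
  | succ l ih =>
    have h : W.B (W.b r ((W.B ^ l) u)) = W.b r ((W.B ^ (l + 1)) u) := by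
      rw [pow_succ' W.B, Module.End.mul_apply, ← Module.End.mul_apply, ← (W.b_B r).eq]; rfl
    have e : (W.B ^ (l + 1 + 1)) (W.lieQuad r u) = W.B ((W.B ^ (l + 1)) (W.lieQuad r u)) := by
      rw [pow_succ', Module.End.mul_apply]
    rw [e, ih, map_sub, map_smul, h, step]
    push_cast
    module

/-- If the coefficients satisfy the recurrences dictated by the commutators of `A` and `B` with
`x^r 𝓔`, then `1 + ∑ (s_l A^l + t_l B^l)` turns the Lie derivative of symbols along `x^r 𝓔` into
the Lie derivative minus `a_r + b_r`. The vanishing hypotheses say that the series ends at `K`. -/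
theorem quantization_lieQuad (hξ : W.degξ u = k • u) (hd : W.deg u = (k + p) • u) (r : Fin n)
    {K : ℕ} {s t : ℕ → ℝ} (hs0 : s 0 = 1) (ht0 : t 0 = 1)
    (hs : ∀ l < K, s (l + 1) * ((l + 1) * (n + p + 2 * k - l)) = s l)
    (ht : ∀ l < K, t (l + 1) * ((l + 1) * (n + p + 2 * k - 1 - l)) = t l)
    (hA : W.a r ((W.A ^ K) u) = 0) (hB : W.b r ((W.B ^ K) u) = 0) {Q : Module.End ℝ V}
    (hQ : Q = 1 + ∑ l ∈ Finset.range K, (s (l + 1) • W.A ^ (l + 1) + t (l + 1) • W.B ^ (l + 1))) :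
    Q (W.lieQuad r u) = W.lieQuad r (Q u) - (W.a r + W.b r) (Q u) := by
  have haB (l : ℕ) : W.a r ((W.B ^ (l + 1)) u) = 0 := by
    rw [pow_succ', Module.End.mul_apply, ← Module.End.mul_apply, a_mul_B, LinearMap.zero_apply]
  have hbA (l : ℕ) : W.b r ((W.A ^ (l + 1)) u) = 0 := by
    rw [pow_succ', Module.End.mul_apply, ← Module.End.mul_apply, b_mul_A, LinearMap.zero_apply]
  have ha : W.a r (Q u) = ∑ l ∈ Finset.range K, s l • W.a r ((W.A ^ l) u) := by
    rw [← add_zero (∑ l ∈ Finset.range K, _), ← smul_zero (s K), ← hA,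
      ← Finset.sum_range_succ (fun l => s l • W.a r ((W.A ^ l) u)), Finset.sum_range_succ', hQ]
    simp [haB, hs0, LinearMap.sum_apply, add_comm]
  have hb : W.b r (Q u) = ∑ l ∈ Finset.range K, t l • W.b r ((W.B ^ l) u) := by
    rw [← add_zero (∑ l ∈ Finset.range K, _), ← smul_zero (t K), ← hB,
      ← Finset.sum_range_succ (fun l => t l • W.b r ((W.B ^ l) u)), Finset.sum_range_succ', hQ]
    simp [hbA, ht0, LinearMap.sum_apply, add_comm]
  have h1 : Q (W.lieQuad r u) = W.lieQuad r (Q u) -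
      ∑ l ∈ Finset.range K, (s l • W.a r ((W.A ^ l) u) + t l • W.b r ((W.B ^ l) u)) := by
    simp only [hQ, LinearMap.add_apply, LinearMap.sum_apply, LinearMap.smul_apply,
      Module.End.one_apply, map_add, map_sum, map_smul]
    rw [add_sub_assoc, ← Finset.sum_sub_distrib]
    congr 1
    refine Finset.sum_congr rfl fun l hl => ?_
    rw [Finset.mem_range] at hl
    rw [W.A_pow_lieQuad hξ hd, W.B_pow_lieQuad hξ hd, smul_sub, smul_sub, smul_smul, smul_smul,
      hs l hl, ht l hl]
    abel
  rw [h1, LinearMap.add_apply, ha, hb, Finset.sum_add_distrib]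

/-- In polynomial degree zero `∂_{ξ_r} δ^*` is the contraction `c_r`, and `δ c_r = ∂_{ξ_r} - c_r δ`
vanishes there. -/
theorem a_apply_eq_zero (h : ∀ i, W.η i u = 0) (r : Fin n) : W.a r u = 0 := by
  have hδ : W.δ u = 0 := by
    simp [δ, LinearMap.sum_apply, h]
  have h1 := LinearMap.congr_fun (W.η_mul_δs r) u
  have h2 := LinearMap.congr_fun (W.c_mul_δ r) u
  simp only [Module.End.mul_apply, LinearMap.add_apply, LinearMap.sub_apply, h, hδ, map_zero,
    zero_add, zero_sub, zero_eq_neg] at h1 h2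
  rw [a, mul_assoc, Module.End.mul_apply, Module.End.mul_apply, h1, h2]

theorem b_apply_eq_zero (h : ∀ i, W.η i u = 0) (r : Fin n) : W.b r u = 0 := by
  have hδ : W.δ u = 0 := by
    simp [δ, LinearMap.sum_apply, h]
  rw [b, Module.End.mul_apply, hδ, map_zero]

/-- On symbols of degree `k`, the Casimir operator has at most two eigenvalues, attained on the
images of `δ` and `δ^*`. -/
theorem casimir_quadratic (hξ : W.degξ u = k • u) (hw : W.degW u = p • u) :
    W.casimir (W.casimir u) -
      (2 * ((k + n + 1) * (k + p)) + 2 * ((k + n) * (k + p))) • W.casimir u +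
      ((2 * ((k + n + 1) * (k + p))) * (2 * ((k + n) * (k + p)))) • u = 0 := by
  have hn (m : ℕ) (v : V) : (m : Module.End ℝ V) v = (m : ℝ) • v := by
    rw [Module.End.natCast_apply, Nat.cast_smul_eq_nsmul]
  have hC {v : V} (hξ : W.degξ v = k • v) (hw : W.degW v = p • v) :
      W.casimir v = (2 : ℝ) • W.δ (W.δs v) + (2 * ((k + n) * (k + p))) • v := by
    rw [casimir_eq_sum_ρ, sum_ρ_mul_ρ, deg]
    simp only [LinearMap.add_apply, LinearMap.sub_apply, LinearMap.smul_apply,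
      Module.End.mul_apply, map_add, map_smul, hξ, hw, hn, smul_smul, Module.End.one_apply,
      ← Nat.cast_smul_eq_nsmul ℝ, map_sub, Nat.cast_add, Nat.cast_one]
    push_cast
    module
  have hdd {v : V} (hξ : W.degξ v = k • v) (hw : W.degW v = p • v) :
      W.δ (W.δs (W.δ (W.δs v))) = (k + p) • W.δ (W.δs v) := by
    have h1 := LinearMap.congr_fun W.δ_mul_δs (W.δ (W.δs v))
    have h2 := LinearMap.congr_fun W.δ_mul_δ (W.δs v)
    have h3 := LinearMap.congr_fun (W.deg_δ.mul_right W.deg_δs).eq v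
    simp only [Module.End.mul_apply, LinearMap.sub_apply, LinearMap.zero_apply] at h1 h2 h3
    rw [h1, h2, map_zero, sub_zero, h3, deg, LinearMap.add_apply, hξ, hw, ← add_smul, map_smul,
      map_smul, add_comm]
  have hdeg : W.degξ (W.δ (W.δs u)) = k • W.δ (W.δs u) := by
    have h1 := LinearMap.congr_fun W.degξ_mul_δ (W.δs u)
    have h2 := LinearMap.congr_fun W.degξ_mul_δs u
    simp only [Module.End.mul_apply, LinearMap.sub_apply, LinearMap.add_apply] at h1 h2
    rw [h1, h2, hξ, map_add, map_smul, map_smul, add_sub_cancel_right]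
  have hdegW : W.degW (W.δ (W.δs u)) = p • W.δ (W.δs u) := by
    have h3 := LinearMap.congr_fun (W.deg_δ.mul_right W.deg_δs).eq u
    simp only [Module.End.mul_apply, deg, LinearMap.add_apply, map_add, hdeg, hξ, hw,
      map_smul] at h3
    exact add_right_cancel h3
  rw [hC hξ hw, map_add, map_smul, map_smul, hC hξ hw, hC hdeg hdegW, hdd hξ hw]
  module

end WeylClifford

/-! ### Partial derivatives of smooth functions -/

section Smooth

variable {n : ℕ} {U : Opens (Fin n → ℝ)}

theorem SmoothFun.eq_of_apply_eq {f g : SmoothFun U} (h : ∀ x, f.1 x = g.1 x) : f = g :=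
  Subtype.ext (funext h)

theorem partialD_apply (i : Fin n) (f : SmoothFun U) (x : U) :
    (partialD U i f).1 x = fderiv ℝ (ext f.1) (x : Fin n → ℝ) (Pi.single i 1) :=
  rfl

theorem eventuallyEq_ext (f : U → ℝ) (g : (Fin n → ℝ) → ℝ) (h : ∀ x : U, f x = g x) (x : U) :
    ext f =ᶠ[nhds (x : Fin n → ℝ)] g := by
  filter_upwards [U.isOpen.mem_nhds x.2] with y hy
  exact ext_congr f g h y hy

theorem partialD_mul (i : Fin n) (f g : SmoothFun U) :
    partialD U i (f * g) = f * partialD U i g + partialD U i f * g := by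
  refine SmoothFun.eq_of_apply_eq fun x => ?_
  have h : ext (f * g).1 =ᶠ[nhds (x : Fin n → ℝ)] ext f.1 * ext g.1 :=
    eventuallyEq_ext _ _ (fun y => by rw [Pi.mul_apply, ext_apply, ext_apply]; rfl) x
  change _ = f.1 x * (partialD U i g).1 x + (partialD U i f).1 x * g.1 x
  rw [partialD_apply, h.fderiv_eq, fderiv_mul (f.differentiableAt x) (g.differentiableAt x)]
  simp [ext_apply, partialD_apply, mul_comm]

theorem partialD_one (i : Fin n) : partialD U i 1 = 0 := by
  have := partialD_mul i (1 : SmoothFun U) 1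
  simpa using this

theorem partialD_coord (i j : Fin n) :
    partialD U i (coord U j) = if i = j then 1 else 0 := by
  refine SmoothFun.eq_of_apply_eq fun x => ?_
  have h : ext (coord U j).1 =ᶠ[nhds (x : Fin n → ℝ)]
      (ContinuousLinearMap.proj (R := ℝ) (φ := fun _ : Fin n => ℝ) j) :=
    eventuallyEq_ext (coord U j).1 _ (fun y => rfl) x
  rw [partialD_apply, h.fderiv_eq, ContinuousLinearMap.fderiv, ContinuousLinearMap.proj_apply]
  rcases eq_or_ne i j with rfl | hij
  · rw [Pi.single_eq_same, if_pos rfl]; rfl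
  · rw [Pi.single_eq_of_ne hij.symm, if_neg hij]; rfl

theorem partialD_comm (i j : Fin n) (f : SmoothFun U) :
    partialD U i (partialD U j f) = partialD U j (partialD U i f) := by
  refine SmoothFun.eq_of_apply_eq fun x => ?_
  have hU := U.isOpen.mem_nhds x.2
  have hc : ContDiffAt ℝ (⊤ : ℕ∞) (ext f.1) x := f.contDiffOn.contDiffAt hU
  have hd : DifferentiableAt ℝ (fderiv ℝ (ext f.1)) (x : Fin n → ℝ) :=
    ((f.contDiffOn.fderiv_of_isOpen (m := (⊤ : ℕ∞)) U.isOpen (by simp)).contDiffAt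
      hU).differentiableAt (by simp)
  have key (i j : Fin n) : (partialD U i (partialD U j f)).1 x =
      fderiv ℝ (fderiv ℝ (ext f.1)) x (Pi.single i 1) (Pi.single j 1) := by
    have h : ext (partialD U j f).1 =ᶠ[nhds (x : Fin n → ℝ)]
        fun y => fderiv ℝ (ext f.1) y (Pi.single j 1) :=
      eventuallyEq_ext (partialD U j f).1 _ (fun y => rfl) x
    rw [partialD_apply, h.fderiv_eq, fderiv_clm_apply hd (differentiableAt_const _)]
    simp
  rw [key, key]
  exact (hc.isSymmSndFDerivAt (by simp; exact WithTop.coe_le_coe.2 le_top)).eq _ _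

end Smooth

/-! ### The Weyl–Clifford system acting on symbols -/

section Symbols

variable {n : ℕ} {U : Opens (Fin n → ℝ)}

theorem totalSymbol_hom_ext {V : Type*} [AddCommGroup V] [Module ℝ V] {S T : TotalSymbol U →ₗ[ℝ] V}
    (h : ∀ f Λ P, S (f ⊗ₜ[ℝ] (Λ ⊗ₜ[ℝ] P)) = T (f ⊗ₜ[ℝ] (Λ ⊗ₜ[ℝ] P))) : S = T := by
  refine TensorProduct.ext' fun f w => ?_
  induction w using TensorProduct.induction_on with
  | zero => simp
  | add a b ha hb => rw [TensorProduct.tmul_add, map_add, map_add, ha, hb]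
  | tmul Λ P => exact h f Λ P

variable (U) in
/-- Operators on functions, acting on the coefficients of symbols. -/
noncomputable def funOp : Module.End ℝ (SmoothFun U) →ₐ[ℝ] Module.End ℝ (TotalSymbol U) :=
  Module.End.rTensorAlgHom ℝ (SmoothFun U) (Fibre n)

variable (U) in
/-- Operators on the exterior algebra, acting on symbols. -/
noncomputable def extOp :
    Module.End ℝ (ExteriorAlgebra ℝ (Fin n → ℝ)) →ₐ[ℝ] Module.End ℝ (TotalSymbol U) :=
  (Module.End.lTensorAlgHom ℝ (Fibre n) (SmoothFun U)).comp
    (Module.End.rTensorAlgHom ℝ (ExteriorAlgebra ℝ (Fin n → ℝ)) (MvPolynomial (Fin n) ℝ))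

variable (U) in
/-- Operators on polynomials, acting on symbols. -/
noncomputable def polOp :
    Module.End ℝ (MvPolynomial (Fin n) ℝ) →ₐ[ℝ] Module.End ℝ (TotalSymbol U) :=
  (Module.End.lTensorAlgHom ℝ (Fibre n) (SmoothFun U)).comp
    (Module.End.lTensorAlgHom ℝ (MvPolynomial (Fin n) ℝ) (ExteriorAlgebra ℝ (Fin n → ℝ)))

@[simp]
theorem funOp_tmul (T : Module.End ℝ (SmoothFun U)) (f : SmoothFun U) (w : Fibre n) :
    funOp U T (f ⊗ₜ[ℝ] w) = T f ⊗ₜ[ℝ] w :=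
  rfl

@[simp]
theorem extOp_tmul (T : Module.End ℝ (ExteriorAlgebra ℝ (Fin n → ℝ))) (f : SmoothFun U)
    (Λ : ExteriorAlgebra ℝ (Fin n → ℝ)) (P : MvPolynomial (Fin n) ℝ) :
    extOp U T (f ⊗ₜ[ℝ] (Λ ⊗ₜ[ℝ] P)) = f ⊗ₜ[ℝ] (T Λ ⊗ₜ[ℝ] P) :=
  rfl

@[simp]
theorem polOp_tmul (T : Module.End ℝ (MvPolynomial (Fin n) ℝ)) (f : SmoothFun U)
    (Λ : ExteriorAlgebra ℝ (Fin n → ℝ)) (P : MvPolynomial (Fin n) ℝ) :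
    polOp U T (f ⊗ₜ[ℝ] (Λ ⊗ₜ[ℝ] P)) = f ⊗ₜ[ℝ] (Λ ⊗ₜ[ℝ] T P) :=
  rfl

theorem commute_funOp_extOp (S : Module.End ℝ (SmoothFun U))
    (T : Module.End ℝ (ExteriorAlgebra ℝ (Fin n → ℝ))) : Commute (funOp U S) (extOp U T) :=
  totalSymbol_hom_ext fun _ _ _ => rfl

theorem commute_funOp_polOp (S : Module.End ℝ (SmoothFun U))
    (T : Module.End ℝ (MvPolynomial (Fin n) ℝ)) : Commute (funOp U S) (polOp U T) :=
  totalSymbol_hom_ext fun _ _ _ => rfl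

theorem commute_polOp_extOp (S : Module.End ℝ (MvPolynomial (Fin n) ℝ))
    (T : Module.End ℝ (ExteriorAlgebra ℝ (Fin n → ℝ))) : Commute (polOp U S) (extOp U T) :=
  totalSymbol_hom_ext fun _ _ _ => rfl

variable (U) in
/-- Multiplication of symbols by smooth functions. -/
noncomputable def mulOp : SmoothFun U →ₐ[ℝ] Module.End ℝ (TotalSymbol U) :=
  (funOp U).comp (Algebra.lmul ℝ (SmoothFun U))

theorem mulOp_eq (f : SmoothFun U) : mulOp U f = funOp U (mulFun f) :=
  rfl

theorem wedge_apply (i : Fin n) (Λ : ExteriorAlgebra ℝ (Fin n → ℝ)) :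
    wedge i Λ = ExteriorAlgebra.ι ℝ (Pi.single i (1 : ℝ)) * Λ :=
  rfl

theorem contract_ι_mul (i : Fin n) (v : Fin n → ℝ) (Λ : ExteriorAlgebra ℝ (Fin n → ℝ)) :
    contract i (ExteriorAlgebra.ι ℝ v * Λ) = v i • Λ - ExteriorAlgebra.ι ℝ v * contract i Λ :=
  CliffordAlgebra.contractLeft_ι_mul _ _ _

theorem wedge_ι_mul (i : Fin n) (v : Fin n → ℝ) (Λ : ExteriorAlgebra ℝ (Fin n → ℝ)) :
    wedge i (ExteriorAlgebra.ι ℝ v * Λ) = -(ExteriorAlgebra.ι ℝ v * wedge i Λ) := by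
  have := ExteriorAlgebra.ι_add_mul_swap (R := ℝ) (Pi.single i (1 : ℝ)) v
  rw [wedge_apply, wedge_apply, ← mul_assoc, ← mul_assoc, eq_neg_of_add_eq_zero_left this, neg_mul]

/-- `ρ(E_{ij})` is a derivation of the exterior algebra. -/
theorem wedge_contract_ι_mul (i j : Fin n) (v : Fin n → ℝ) (Λ : ExteriorAlgebra ℝ (Fin n → ℝ)) :
    wedge i (contract j (ExteriorAlgebra.ι ℝ v * Λ)) =
      ExteriorAlgebra.ι ℝ (elemEnd n i j v) * Λ +
        ExteriorAlgebra.ι ℝ v * wedge i (contract j Λ) := by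
  rw [contract_ι_mul, map_sub, map_smul, wedge_ι_mul, sub_neg_eq_add, wedge_apply]
  congr 1
  rw [elemEnd, LinearMap.smulRight_apply, map_smul, smul_mul_assoc]
  rfl

theorem partialD_mul_mulFun_coord (i j : Fin n) :
    (partialD U i * mulFun (coord U j) : Module.End ℝ (SmoothFun U)) =
      mulFun (coord U j) * partialD U i + if i = j then 1 else 0 := by
  refine LinearMap.ext fun f => ?_
  change partialD U i (coord U j * f) = coord U j * partialD U i f + _
  rw [partialD_mul, partialD_coord]
  split_ifs <;> simp

theorem partialXi_apply (i : Fin n) (P : MvPolynomial (Fin n) ℝ) :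
    partialXi i P = MvPolynomial.pderiv i P :=
  rfl

theorem mulXi_apply (i : Fin n) (P : MvPolynomial (Fin n) ℝ) :
    mulXi i P = MvPolynomial.X i * P :=
  rfl

theorem partialXi_comm (i j : Fin n) :
    Commute (partialXi i : Module.End ℝ (MvPolynomial (Fin n) ℝ)) (partialXi j) := by
  have h : ⁅(MvPolynomial.pderiv i : Derivation ℝ (MvPolynomial (Fin n) ℝ) _),
      MvPolynomial.pderiv (R := ℝ) j⁆ = 0 := by
    refine MvPolynomial.derivation_ext fun k => ?_
    rw [Derivation.commutator_apply, MvPolynomial.pderiv_X, MvPolynomial.pderiv_X,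
      Pi.single_apply, Pi.single_apply, apply_ite (MvPolynomial.pderiv (R := ℝ) i),
      apply_ite (MvPolynomial.pderiv (R := ℝ) j)]
    simp
  refine LinearMap.ext fun P => ?_
  have := DFunLike.congr_fun h P
  rw [Derivation.commutator_apply] at this
  exact sub_eq_zero.mp this

theorem partialXi_mul_mulXi (i j : Fin n) :
    (partialXi i * mulXi j : Module.End ℝ (MvPolynomial (Fin n) ℝ)) =
      mulXi j * partialXi i + if i = j then 1 else 0 := by
  refine LinearMap.ext fun P => ?_
  rw [LinearMap.add_apply, Module.End.mul_apply, Module.End.mul_apply, partialXi_apply,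
    partialXi_apply, mulXi_apply, mulXi_apply, MvPolynomial.pderiv_mul, MvPolynomial.pderiv_X,
    Pi.single_apply, add_comm]
  rcases eq_or_ne i j with rfl | hij
  · simp
  · simp [hij, hij.symm]

theorem contract_mul_wedge (i j : Fin n) :
    (contract i * wedge j : Module.End ℝ (ExteriorAlgebra ℝ (Fin n → ℝ))) =
      -(wedge j * contract i) + if i = j then 1 else 0 := by
  refine LinearMap.ext fun Λ => ?_
  rw [Module.End.mul_apply, LinearMap.add_apply, LinearMap.neg_apply, Module.End.mul_apply,
    wedge_apply, contract_ι_mul, wedge_apply, Pi.single_apply]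
  split_ifs <;> simp [sub_eq_neg_add]

theorem wedge_mul_wedge (i j : Fin n) :
    (wedge i * wedge j : Module.End ℝ (ExteriorAlgebra ℝ (Fin n → ℝ))) = -(wedge j * wedge i) :=
  LinearMap.ext fun Λ => wedge_ι_mul i _ Λ

theorem contract_mul_contract (i j : Fin n) :
    (contract i * contract j : Module.End ℝ (ExteriorAlgebra ℝ (Fin n → ℝ))) =
      -(contract j * contract i) :=
  LinearMap.ext fun Λ => CliffordAlgebra.contractLeft_comm _ _ Λ

variable (U) in
/-- The coordinates and derivatives in `x` and in `ξ`, and the exterior multiplications and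
contractions, acting on symbols. -/
noncomputable def symbolWC : WeylClifford n (Module.End ℝ (TotalSymbol U)) where
  x i := mulOp U (coord U i)
  d i := funOp U (partialD U i)
  ξ i := polOp U (mulXi i)
  η i := polOp U (partialXi i)
  w i := extOp U (wedge i)
  c i := extOp U (contract i)
  xx i j := (Commute.all (coord U i) (coord U j)).map (mulOp U)
  xξ i j := commute_funOp_polOp _ _
  xη i j := commute_funOp_polOp _ _
  xw i j := commute_funOp_extOp _ _
  xc i j := commute_funOp_extOp _ _
  dd i j := Commute.map (LinearMap.ext fun f => partialD_comm i j f) (funOp U)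
  dξ i j := commute_funOp_polOp _ _
  dη i j := commute_funOp_polOp _ _
  dw i j := commute_funOp_extOp _ _
  dc i j := commute_funOp_extOp _ _
  ξξ i j := Commute.map (LinearMap.ext fun P => mul_left_comm _ _ P) (polOp U)
  ηη i j := (partialXi_comm i j).map (polOp U)
  ξw i j := commute_polOp_extOp _ _
  ξc i j := commute_polOp_extOp _ _
  ηw i j := commute_polOp_extOp _ _
  ηc i j := commute_polOp_extOp _ _
  d_mul_x i j := by
    rw [mulOp_eq, ← map_mul, partialD_mul_mulFun_coord, map_add, map_mul, apply_ite (funOp U),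
      map_one, map_zero]
  η_mul_ξ i j := by
    rw [← map_mul, partialXi_mul_mulXi, map_add, map_mul, apply_ite (polOp U), map_one, map_zero]
  c_mul_w i j := by
    rw [← map_mul, contract_mul_wedge, map_add, map_neg, map_mul, apply_ite (extOp U), map_one,
      map_zero]
  w_mul_w i j := by
    rw [← map_mul, wedge_mul_wedge, map_neg, map_mul]
  c_mul_c i j := by
    rw [← map_mul, contract_mul_contract, map_neg, map_mul]

theorem delta_eq : delta U = (symbolWC U).δ :=
  totalSymbol_hom_ext fun f Λ P => by
    simp [delta, WeylClifford.δ, symbolWC, LinearMap.sum_apply, TensorProduct.tmul_sum]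

theorem deltaStar_eq : deltaStar U = (symbolWC U).δs :=
  totalSymbol_hom_ext fun f Λ P => by
    simp [deltaStar, WeylClifford.δs, symbolWC, LinearMap.sum_apply, TensorProduct.tmul_sum]

theorem divergence_eq : divergence U = (symbolWC U).div :=
  totalSymbol_hom_ext fun f Λ P => by
    simp [divergence, WeylClifford.div, symbolWC, LinearMap.sum_apply]

theorem mulFun_glAct (f : SmoothFun U) (i j : Fin n) :
    TensorProduct.map (mulFun f) (glAct i j) = mulOp U f * (symbolWC U).ρ i j :=
  totalSymbol_hom_ext fun g Λ P => by
    simp [glAct, WeylClifford.ρ, symbolWC, mulOp_eq, TensorProduct.tmul_add]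

theorem map_lieFun (X : VectorField U) :
    TensorProduct.map (lieFun X) LinearMap.id =
      (∑ i, mulOp U (X i) * (symbolWC U).d i : Module.End ℝ (TotalSymbol U)) :=
  totalSymbol_hom_ext fun g Λ P => by
    simp [lieFun, symbolWC, mulOp_eq, LinearMap.sum_apply, TensorProduct.sum_tmul]

/-- The Lie derivative of symbols in terms of the Weyl–Clifford system. -/
noncomputable def lieOp (X : VectorField U) : Module.End ℝ (TotalSymbol U) :=
  ∑ i, mulOp U (X i) * (symbolWC U).d i -
    ∑ i, ∑ j, mulOp U (partialD U j (X i)) * (symbolWC U).ρ i j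

theorem lieSymbol_eq (X : VectorField U) : lieSymbol X = lieOp X := by
  rw [lieSymbol, map_lieFun]
  simp only [mulFun_glAct]
  rfl

theorem lieSymbol_const (r : Fin n) :
    lieSymbol (Pi.single r 1 : VectorField U) = (symbolWC U).d r := by
  have h1 (i j : Fin n) : partialD U j ((Pi.single r 1 : VectorField U) i) = 0 := by
    rcases eq_or_ne i r with rfl | h
    · rw [Pi.single_eq_same, partialD_one]
    · rw [Pi.single_eq_of_ne h, map_zero]
  have h2 : ∑ i, mulOp U ((Pi.single r 1 : VectorField U) i) * (symbolWC U).d i =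
      (symbolWC U).d r := by
    simp [Pi.single_apply, apply_ite, ite_mul]
  have h3 : ∑ i, ∑ j, mulOp U (partialD U j ((Pi.single r 1 : VectorField U) i)) *
      (symbolWC U).ρ i j = 0 := by
    simp only [h1, map_zero, zero_mul, Finset.sum_const_zero]
  rw [lieSymbol_eq, lieOp, h2, h3]
  exact sub_zero ((symbolWC U).d r)

theorem lieSymbol_linear (r s : Fin n) :
    lieSymbol (Pi.single r (coord U s) : VectorField U) = (symbolWC U).lieLin s r := by
  have h1 (i j : Fin n) : partialD U j ((Pi.single r (coord U s) : VectorField U) i) =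
      if i = r then (if j = s then 1 else 0) else 0 := by
    rw [Pi.single_apply, apply_ite (partialD U j), partialD_coord, map_zero]
  have h2 : mulOp U (coord U s) = (symbolWC U).x s := rfl
  have h3 : ∑ i, mulOp U ((Pi.single r (coord U s) : VectorField U) i) * (symbolWC U).d i =
      (symbolWC U).x s * (symbolWC U).d r := by
    simp [Pi.single_apply, apply_ite, ite_mul, h2]
  have h4 : ∑ i, ∑ j, mulOp U (partialD U j ((Pi.single r (coord U s) : VectorField U) i)) *
      (symbolWC U).ρ i j = (symbolWC U).ρ r s := by
    simp only [h1]
    simp [apply_ite, ite_mul]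
  rw [lieSymbol_eq, lieOp, h3, h4]
  rfl

theorem lieSymbol_quadratic (r : Fin n) :
    lieSymbol (fun i => coord U r * coord U i : VectorField U) = (symbolWC U).lieQuad r := by
  have h1 (i j : Fin n) : partialD U j (coord U r * coord U i) =
      (if j = i then coord U r else 0) + (if j = r then coord U i else 0) := by
    rw [partialD_mul, partialD_coord, partialD_coord]; simp
  have h2 (s : Fin n) : mulOp U (coord U s) = (symbolWC U).x s := rfl
  have h3 : ∑ i, mulOp U (coord U r * coord U i) * (symbolWC U).d i =
      (symbolWC U).x r * (symbolWC U).eulerX := by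
    simp only [map_mul, h2, mul_assoc, ← Finset.mul_sum]
    rfl
  have h4 : ∑ i, ∑ j, mulOp U (partialD U j (coord U r * coord U i)) * (symbolWC U).ρ i j =
      (symbolWC U).x r * (symbolWC U).deg + ∑ i, (symbolWC U).x i * (symbolWC U).ρ i r := by
    simp only [h1, map_add, add_mul, Finset.sum_add_distrib, apply_ite (mulOp U), map_zero,
      ite_mul, zero_mul, Finset.sum_ite_eq', Finset.mem_univ, if_true, h2,
      WeylClifford.deg_eq_sum, Finset.mul_sum]
  rw [lieSymbol_eq, lieOp, h3, h4]
  exact (symbolWC U).lieQuad_eq r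

end Symbols

/-! ### Degrees of symbols -/

section Degrees

variable {n : ℕ} {U : Opens (Fin n → ℝ)}

theorem symbolDeg_induction {p k : ℕ} {S : Submodule ℝ (TotalSymbol U)}
    (h : ∀ f, ∀ Λ ∈ ⋀[ℝ]^p (Fin n → ℝ), ∀ P : MvPolynomial (Fin n) ℝ, P.IsHomogeneous k →
      f ⊗ₜ[ℝ] (Λ ⊗ₜ[ℝ] P) ∈ S) : symbolDeg U p k ≤ S := by
  refine Submodule.span_le.2 ?_
  rintro _ ⟨f, Λ, hΛ, P, hP, rfl⟩
  exact h f Λ hΛ P hP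

theorem tmul_mem_symbolDeg {p k : ℕ} (f : SmoothFun U) {Λ : ExteriorAlgebra ℝ (Fin n → ℝ)}
    (hΛ : Λ ∈ ⋀[ℝ]^p (Fin n → ℝ)) {P : MvPolynomial (Fin n) ℝ} (hP : P.IsHomogeneous k) :
    f ⊗ₜ[ℝ] (Λ ⊗ₜ[ℝ] P) ∈ symbolDeg U p k :=
  Submodule.subset_span ⟨f, Λ, hΛ, P, hP, rfl⟩

theorem eqOn_symbolDeg {V : Type*} [AddCommGroup V] [Module ℝ V] {p k : ℕ}
    {S T : TotalSymbol U →ₗ[ℝ] V}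
    (h : ∀ f, ∀ Λ ∈ ⋀[ℝ]^p (Fin n → ℝ), ∀ P : MvPolynomial (Fin n) ℝ, P.IsHomogeneous k →
      S (f ⊗ₜ[ℝ] (Λ ⊗ₜ[ℝ] P)) = T (f ⊗ₜ[ℝ] (Λ ⊗ₜ[ℝ] P)))
    {u : TotalSymbol U} (hu : u ∈ symbolDeg U p k) : S u = T u :=
  symbolDeg_induction (S := LinearMap.eqLocus S T) h hu

/-- The Euler identity on the exterior algebra. -/
theorem sum_wedge_contract {p : ℕ} {Λ : ExteriorAlgebra ℝ (Fin n → ℝ)}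
    (hΛ : Λ ∈ ⋀[ℝ]^p (Fin n → ℝ)) : ∑ i, wedge i (contract i Λ) = (p : ℝ) • Λ := by
  induction hΛ using Submodule.pow_induction_on_left' with
  | algebraMap r =>
    have (i : Fin n) : contract i (algebraMap ℝ (ExteriorAlgebra ℝ (Fin n → ℝ)) r) = 0 :=
      CliffordAlgebra.contractLeft_algebraMap _ _ _
    simp [this]
  | add x y i hx hy ihx ihy => simp only [map_add, Finset.sum_add_distrib, ihx, ihy, smul_add]
  | mem_mul m hm q x hx ih =>
    obtain ⟨v, rfl⟩ := hm
    have hv : ∑ i, elemEnd n i i v = v := by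
      ext j
      simp [elemEnd, Finset.sum_apply, Pi.single_apply]
    simp only [wedge_contract_ι_mul, Finset.sum_add_distrib, ← Finset.mul_sum, ← Finset.sum_mul,
      ← map_sum, hv, ih]
    rw [mul_smul_comm]
    push_cast
    module

theorem degξ_apply {p k : ℕ} {u : TotalSymbol U} (hu : u ∈ symbolDeg U p k) :
    (symbolWC U).degξ u = (k : ℝ) • u := by
  refine eqOn_symbolDeg (T := (k : ℝ) • LinearMap.id) (fun f Λ _ P hP => ?_) hu
  have h : (symbolWC U).degξ (f ⊗ₜ[ℝ] (Λ ⊗ₜ[ℝ] P)) =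
      f ⊗ₜ[ℝ] (Λ ⊗ₜ[ℝ] ∑ i, MvPolynomial.X i * MvPolynomial.pderiv i P) := by
    simp [WeylClifford.degξ, symbolWC, LinearMap.sum_apply, TensorProduct.tmul_sum,
      partialXi_apply, mulXi_apply]
  rw [h, hP.sum_X_mul_pderiv, ← Nat.cast_smul_eq_nsmul ℝ]
  simp

theorem degW_apply {p k : ℕ} {u : TotalSymbol U} (hu : u ∈ symbolDeg U p k) :
    (symbolWC U).degW u = (p : ℝ) • u := by
  refine eqOn_symbolDeg (T := (p : ℝ) • LinearMap.id) (fun f Λ hΛ P _ => ?_) hu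
  have h : (symbolWC U).degW (f ⊗ₜ[ℝ] (Λ ⊗ₜ[ℝ] P)) =
      f ⊗ₜ[ℝ] ((∑ i, wedge i (contract i Λ)) ⊗ₜ[ℝ] P) := by
    simp [WeylClifford.degW, symbolWC, LinearMap.sum_apply, TensorProduct.tmul_sum,
      TensorProduct.sum_tmul]
  rw [h, sum_wedge_contract hΛ, ← TensorProduct.smul_tmul', TensorProduct.tmul_smul]
  rfl

theorem deg_apply {p k : ℕ} {u : TotalSymbol U} (hu : u ∈ symbolDeg U p k) :
    (symbolWC U).deg u = ((k : ℝ) + p) • u := by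
  rw [WeylClifford.deg, LinearMap.add_apply, degξ_apply hu, degW_apply hu, add_smul, add_comm]

theorem η_apply_eq_zero {p : ℕ} {u : TotalSymbol U} (hu : u ∈ symbolDeg U p 0) (r : Fin n) :
    (symbolWC U).η r u = 0 := by
  refine eqOn_symbolDeg (T := 0) (fun f Λ _ P hP => ?_) hu
  rw [← MvPolynomial.totalDegree_zero_iff_isHomogeneous,
    MvPolynomial.totalDegree_eq_zero_iff_eq_C] at hP
  rw [hP]
  simp [symbolWC, partialXi_apply]

theorem δ_tmul (f : SmoothFun U) (Λ : ExteriorAlgebra ℝ (Fin n → ℝ))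
    (P : MvPolynomial (Fin n) ℝ) : (symbolWC U).δ (f ⊗ₜ[ℝ] (Λ ⊗ₜ[ℝ] P)) =
      ∑ i, f ⊗ₜ[ℝ] (wedge i Λ ⊗ₜ[ℝ] MvPolynomial.pderiv i P) := by
  simp [WeylClifford.δ, symbolWC, LinearMap.sum_apply, partialXi_apply]

theorem δs_tmul (f : SmoothFun U) (Λ : ExteriorAlgebra ℝ (Fin n → ℝ))
    (P : MvPolynomial (Fin n) ℝ) : (symbolWC U).δs (f ⊗ₜ[ℝ] (Λ ⊗ₜ[ℝ] P)) =
      ∑ i, f ⊗ₜ[ℝ] (contract i Λ ⊗ₜ[ℝ] (MvPolynomial.X i * P)) := by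
  simp [WeylClifford.δs, symbolWC, LinearMap.sum_apply, mulXi_apply]

theorem div_tmul (f : SmoothFun U) (Λ : ExteriorAlgebra ℝ (Fin n → ℝ))
    (P : MvPolynomial (Fin n) ℝ) : (symbolWC U).div (f ⊗ₜ[ℝ] (Λ ⊗ₜ[ℝ] P)) =
      ∑ i, partialD U i f ⊗ₜ[ℝ] (Λ ⊗ₜ[ℝ] MvPolynomial.pderiv i P) := by
  simp [WeylClifford.div, symbolWC, LinearMap.sum_apply, partialXi_apply]

theorem A_mem {p k : ℕ} {u : TotalSymbol U} (hu : u ∈ symbolDeg U p (k + 1)) :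
    (symbolWC U).A u ∈ symbolDeg U p k := by
  refine symbolDeg_induction (S := (symbolDeg U p k).comap (symbolWC U).A)
    (fun f Λ hΛ P hP => ?_) hu
  have h : (symbolWC U).A (f ⊗ₜ[ℝ] (Λ ⊗ₜ[ℝ] P)) = ∑ l, ∑ j, ∑ i, partialD U j f ⊗ₜ[ℝ]
      (wedge i (contract l Λ) ⊗ₜ[ℝ] MvPolynomial.pderiv i (MvPolynomial.pderiv j
        (MvPolynomial.X l * P))) := by
    rw [WeylClifford.A, Module.End.mul_apply, Module.End.mul_apply, δs_tmul]
    simp only [map_sum, div_tmul, δ_tmul]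
  rw [Submodule.mem_comap, h]
  refine Submodule.sum_mem _ fun l _ => Submodule.sum_mem _ fun j _ => Submodule.sum_mem _
    fun i _ => tmul_mem_symbolDeg _ (wedge_contract_mem i l p Λ hΛ) ?_
  have := (((MvPolynomial.isHomogeneous_X ℝ l).mul hP).pderiv (i := j)).pderiv (i := i)
  rwa [show 1 + (k + 1) - 1 - 1 = k by omega] at this

theorem B_mem {p k : ℕ} {u : TotalSymbol U} (hu : u ∈ symbolDeg U p (k + 1)) :
    (symbolWC U).B u ∈ symbolDeg U p k := by
  refine symbolDeg_induction (S := (symbolDeg U p k).comap (symbolWC U).B)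
    (fun f Λ hΛ P hP => ?_) hu
  have h : (symbolWC U).B (f ⊗ₜ[ℝ] (Λ ⊗ₜ[ℝ] P)) = ∑ l, ∑ j, ∑ i, partialD U j f ⊗ₜ[ℝ]
      (contract i (wedge l Λ) ⊗ₜ[ℝ] (MvPolynomial.X i * MvPolynomial.pderiv j
        (MvPolynomial.pderiv l P))) := by
    rw [WeylClifford.B, Module.End.mul_apply, Module.End.mul_apply, δ_tmul]
    simp only [map_sum, div_tmul, δs_tmul]
  have hc (i l : Fin n) : contract i (wedge l Λ) ∈ ⋀[ℝ]^p (Fin n → ℝ) := by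
    have := LinearMap.congr_fun (contract_mul_wedge i l) Λ
    rw [Module.End.mul_apply] at this
    rw [this]
    refine Submodule.add_mem _ (Submodule.neg_mem _ (wedge_contract_mem l i p Λ hΛ)) ?_
    split_ifs
    · exact hΛ
    · exact Submodule.zero_mem _
  rw [Submodule.mem_comap, h]
  refine Submodule.sum_mem _ fun l _ => Submodule.sum_mem _ fun j _ => Submodule.sum_mem _
    fun i _ => ?_
  rcases k with _ | k
  · have h0 : MvPolynomial.pderiv j (MvPolynomial.pderiv l P) = 0 := by
      have := hP.pderiv (i := l)
      rw [zero_add, Nat.sub_self, ← MvPolynomial.totalDegree_zero_iff_isHomogeneous,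
        MvPolynomial.totalDegree_eq_zero_iff_eq_C] at this
      rw [this, MvPolynomial.pderiv_C]
    rw [h0, mul_zero, TensorProduct.tmul_zero, TensorProduct.tmul_zero]
    exact Submodule.zero_mem _
  · refine tmul_mem_symbolDeg _ (hc i l) ?_
    have := (MvPolynomial.isHomogeneous_X ℝ i).mul ((hP.pderiv (i := l)).pderiv (i := j))
    rwa [show 1 + (k + 1 + 1 - 1 - 1) = k + 1 by omega] at this

theorem A_pow_mem {p k l : ℕ} (h : l ≤ k) {u : TotalSymbol U} (hu : u ∈ symbolDeg U p k) :
    ((symbolWC U).A ^ l) u ∈ symbolDeg U p (k - l) := by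
  induction l with
  | zero => exact hu
  | succ l ih =>
    rw [pow_succ']
    refine A_mem ?_
    rw [show k - (l + 1) + 1 = k - l by omega]
    exact ih (by omega)

theorem B_pow_mem {p k l : ℕ} (h : l ≤ k) {u : TotalSymbol U} (hu : u ∈ symbolDeg U p k) :
    ((symbolWC U).B ^ l) u ∈ symbolDeg U p (k - l) := by
  induction l with
  | zero => exact hu
  | succ l ih =>
    rw [pow_succ']
    refine B_mem ?_
    rw [show k - (l + 1) + 1 = k - l by omega]
    exact ih (by omega)

end Degrees

/-! ### Composition of differential operators in terms of symbols -/

section DiffOp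

variable {n : ℕ} {U : Opens (Fin n → ℝ)} {p : ℕ}

theorem toDiffOp_tmul_apply (f : SmoothFun U) (Λ : ExteriorAlgebra ℝ (Fin n → ℝ))
    (P : MvPolynomial (Fin n) ℝ) (ω : Form U p) :
    toDiffOp U p (f ⊗ₜ[ℝ] (Λ ⊗ₜ[ℝ] P)) ω = f * evalForm U p Λ (onForm p (constCoeffOp U P) ω) := by
  simp [toDiffOp]

theorem evalForm_apply (Λ : ExteriorAlgebra ℝ (Fin n → ℝ)) (ω : Form U p) :
    evalForm U p Λ ω = ExteriorAlgebra.liftAlternating (R := ℝ) (Pi.single p ω) Λ :=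
  rfl

theorem evalForm_ιMulti (v : Fin p → Fin n → ℝ) (ω : Form U p) :
    evalForm U p (ExteriorAlgebra.ιMulti ℝ p v) ω = ω v := by
  rw [evalForm_apply, ExteriorAlgebra.liftAlternating_apply_ιMulti, Pi.single_eq_same]

theorem evalForm_ιMulti_of_ne {q : ℕ} (h : q ≠ p) (v : Fin q → Fin n → ℝ) (ω : Form U p) :
    evalForm U p (ExteriorAlgebra.ιMulti ℝ q v) ω = 0 := by
  rw [evalForm_apply, ExteriorAlgebra.liftAlternating_apply_ιMulti, Pi.single_eq_of_ne h]
  rfl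

theorem exteriorAlgebra_hom_ext {V : Type*} [AddCommGroup V] [Module ℝ V]
    {S T : ExteriorAlgebra ℝ (Fin n → ℝ) →ₗ[ℝ] V}
    (h : ∀ q, ∀ v : Fin q → Fin n → ℝ, S (ExteriorAlgebra.ιMulti ℝ q v) =
      T (ExteriorAlgebra.ιMulti ℝ q v)) : S = T :=
  ExteriorAlgebra.lhom_ext fun q => AlternatingMap.ext fun v => h q v

theorem apply_evalForm (T : Module.End ℝ (SmoothFun U)) (Λ : ExteriorAlgebra ℝ (Fin n → ℝ))
    (ω : Form U p) : T (evalForm U p Λ ω) = evalForm U p Λ (onForm p T ω) := by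
  have : T ∘ₗ (evalForm U p).flip ω = (evalForm U p).flip (onForm p T ω) := by
    refine exteriorAlgebra_hom_ext fun q v => ?_
    simp only [LinearMap.comp_apply, LinearMap.flip_apply]
    rcases eq_or_ne q p with rfl | h
    · rw [evalForm_ιMulti, evalForm_ιMulti]; rfl
    · rw [evalForm_ιMulti_of_ne h, evalForm_ιMulti_of_ne h, map_zero]
  exact LinearMap.congr_fun this Λ

/-- `ρ(E_{ij})` acts on a product of vectors by the Leibniz rule. -/
theorem wedge_contract_ιMulti (i j : Fin n) (v : Fin p → Fin n → ℝ) :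
    wedge i (contract j (ExteriorAlgebra.ιMulti ℝ p v)) =
      ∑ m, ExteriorAlgebra.ιMulti ℝ p (Function.update v m (elemEnd n i j (v m))) := by
  induction p with
  | zero =>
    have : contract j (1 : ExteriorAlgebra ℝ (Fin n → ℝ)) = 0 :=
      CliffordAlgebra.contractLeft_one (Q := 0) _
    simp [ExteriorAlgebra.ιMulti_zero_apply, this]
  | succ p ih =>
    rw [ExteriorAlgebra.ιMulti_succ_apply, wedge_contract_ι_mul, ih, Fin.sum_univ_succ,
      Finset.mul_sum]
    congr 1
    · rw [ExteriorAlgebra.ιMulti_succ_apply, Function.update_self]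
      congr 2
    · refine Finset.sum_congr rfl fun m _ => ?_
      rw [ExteriorAlgebra.ιMulti_succ_apply, Function.update_of_ne (Fin.succ_ne_zero m).symm]
      congr 2
      funext l
      simp only [Matrix.vecTail, Function.comp_apply, Function.update_apply, Fin.succ_inj]

theorem evalForm_formAct (i j : Fin n) (Λ : ExteriorAlgebra ℝ (Fin n → ℝ)) (ω : Form U p) :
    evalForm U p Λ (formAct p (elemEnd n i j) ω) = evalForm U p (wedge i (contract j Λ)) ω := by
  have : (evalForm U p).flip (formAct p (elemEnd n i j) ω) =
      (evalForm U p).flip ω ∘ₗ wedge i ∘ₗ contract j := by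
    refine exteriorAlgebra_hom_ext fun q v => ?_
    simp only [LinearMap.comp_apply, LinearMap.flip_apply, wedge_contract_ιMulti, map_sum]
    rcases eq_or_ne q p with rfl | h
    · simp only [evalForm_ιMulti]; rfl
    · simp only [evalForm_ιMulti_of_ne h, Finset.sum_const_zero]
  exact LinearMap.congr_fun this Λ

theorem formAct_onForm (A : (Fin n → ℝ) →ₗ[ℝ] (Fin n → ℝ)) (T : Module.End ℝ (SmoothFun U))
    (ω : Form U p) : formAct p A (onForm p T ω) = onForm p T (formAct p A ω) := by
  refine AlternatingMap.ext fun v => ?_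
  change ∑ m : Fin p, T (ω _) = T (∑ m : Fin p, ω _)
  rw [map_sum]

/-! ### Constant coefficient operators -/

theorem list_prod_pow_add_single {R : Type*} [Monoid R] {ι : Type*} [DecidableEq ι] (D : ι → R)
    (hD : ∀ i j, Commute (D i) (D j)) (α : ι →₀ ℕ) (i : ι) (l : List ι) (hl : l.Nodup) :
    (l.map fun j => D j ^ (α + Finsupp.single i 1 : ι →₀ ℕ) j).prod =
      if i ∈ l then D i * (l.map fun j => D j ^ α j).prod else (l.map fun j => D j ^ α j).prod := by
  induction l with
  | nil => simp
  | cons j l ih =>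
    rw [List.nodup_cons] at hl
    rw [List.map_cons, List.prod_cons, ih hl.2, List.map_cons, List.prod_cons]
    rcases eq_or_ne i j with rfl | h
    · rw [if_neg hl.1, if_pos List.mem_cons_self, Finsupp.add_apply, Finsupp.single_eq_same,
        pow_succ', mul_assoc]
    · rw [Finsupp.add_apply, Finsupp.single_eq_of_ne h.symm, add_zero]
      by_cases hi : i ∈ l
      · rw [if_pos hi, if_pos (List.mem_cons_of_mem _ hi), ← mul_assoc,
          ((hD i j).pow_right _).symm.eq, mul_assoc]
      · rw [if_neg hi, if_neg (by simp [h, hi])]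

theorem constCoeffOp_monomial (α : Fin n →₀ ℕ) (r : ℝ) :
    constCoeffOp U (MvPolynomial.monomial α r) = r • iterPartial U α := by
  have := (MvPolynomial.basisMonomials (Fin n) ℝ).constr_basis ℝ (iterPartial U) α
  rw [MvPolynomial.coe_basisMonomials] at this
  rw [← mul_one r, ← smul_eq_mul, ← MvPolynomial.smul_monomial, map_smul]
  rw [smul_eq_mul, mul_one]
  exact congrArg _ this

theorem constCoeffOp_X_mul (i : Fin n) (P : MvPolynomial (Fin n) ℝ) :
    constCoeffOp U (MvPolynomial.X i * P) = partialD U i * constCoeffOp U P := by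
  induction P using MvPolynomial.induction_on' with
  | monomial α r =>
    have h : iterPartial U (α + Finsupp.single i 1) = partialD U i * iterPartial U α := by
      have hD (i j : Fin n) :
          Commute (partialD U i : Module.End ℝ (SmoothFun U)) (partialD U j) :=
        LinearMap.ext fun f => partialD_comm i j f
      rw [iterPartial, list_prod_pow_add_single _ hD α i _ (List.nodup_finRange n),
        if_pos (List.mem_finRange i)]
      rfl
    have h1 : MvPolynomial.X i * MvPolynomial.monomial α r =
        MvPolynomial.monomial (α + Finsupp.single i 1) r := by
      rw [MvPolynomial.monomial_add_single, pow_one, mul_comm]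
    rw [h1, constCoeffOp_monomial,
      constCoeffOp_monomial, h, mul_smul_comm]
  | add P Q hP hQ => rw [mul_add, map_add, map_add, hP, hQ, mul_add]

theorem constCoeffOp_C (r : ℝ) : constCoeffOp U (MvPolynomial.C r) = r • 1 := by
  rw [← MvPolynomial.monomial_zero', constCoeffOp_monomial]
  simp [iterPartial]

theorem commute_constCoeffOp (i : Fin n) (P : MvPolynomial (Fin n) ℝ) :
    Commute (partialD U i : Module.End ℝ (SmoothFun U)) (constCoeffOp U P) := by
  induction P using MvPolynomial.induction_on with
  | C r => rw [constCoeffOp_C]; exact (Commute.one_right _).smul_right r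
  | add P Q hP hQ => rw [map_add]; exact hP.add_right hQ
  | mul_X P j hP =>
    rw [mul_comm, constCoeffOp_X_mul]
    exact Commute.mul_right (LinearMap.ext fun f => partialD_comm i j f) hP

/-- The commutator of `P(∂)` with the coordinate `x^i` is `(∂_{ξ_i} P)(∂)`. -/
theorem constCoeffOp_mul_coord (i : Fin n) (P : MvPolynomial (Fin n) ℝ) :
    constCoeffOp U P * mulFun (coord U i) =
      mulFun (coord U i) * constCoeffOp U P + constCoeffOp U (MvPolynomial.pderiv i P) := by
  induction P using MvPolynomial.induction_on with
  | C r => rw [constCoeffOp_C, MvPolynomial.pderiv_C, map_zero]; simp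
  | add P Q hP hQ =>
    rw [map_add, map_add, map_add, add_mul, hP, hQ, mul_add]; abel
  | mul_X P j hP =>
    rw [MvPolynomial.pderiv_mul, MvPolynomial.pderiv_X, mul_comm P, mul_comm _ (MvPolynomial.X j),
      map_add, constCoeffOp_X_mul, constCoeffOp_X_mul, mul_assoc, hP, mul_add, ← mul_assoc,
      partialD_mul_mulFun_coord, Pi.single_apply]
    rcases eq_or_ne j i with rfl | h
    · simp only [if_true, add_mul, one_mul, mul_one, mul_assoc]; abel
    · simp only [if_neg h, add_mul, zero_mul, mul_zero, map_zero, mul_assoc]; abel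

end DiffOp

/-! ### The Lie derivative of differential operators in terms of symbols -/

section Intertwining

variable {n : ℕ} {U : Opens (Fin n → ℝ)} {p : ℕ}

/-- Composition on the left with the operator `S` on functions corresponds to the operator `T` on
symbols. -/
def IsLeftComp (p : ℕ) (S : Module.End ℝ (SmoothFun U)) (T : Module.End ℝ (TotalSymbol U)) : Prop :=
  ∀ u ω, S (toDiffOp U p u ω) = toDiffOp U p (T u) ω

/-- Composition on the right with the operator `S` on forms corresponds to the operator `T` on
symbols. -/
def IsRightComp (S : Module.End ℝ (Form U p)) (T : Module.End ℝ (TotalSymbol U)) : Prop :=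
  ∀ u ω, toDiffOp U p u (S ω) = toDiffOp U p (T u) ω

theorem IsLeftComp.mul {S S' : Module.End ℝ (SmoothFun U)} {T T' : Module.End ℝ (TotalSymbol U)}
    (h : IsLeftComp p S T) (h' : IsLeftComp p S' T') : IsLeftComp p (S * S') (T * T') :=
  fun u ω => by rw [Module.End.mul_apply, Module.End.mul_apply, h', h]

theorem IsLeftComp.sum {ι : Type*} {s : Finset ι} {S : ι → Module.End ℝ (SmoothFun U)}
    {T : ι → Module.End ℝ (TotalSymbol U)} (h : ∀ i ∈ s, IsLeftComp p (S i) (T i)) :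
    IsLeftComp p (∑ i ∈ s, S i) (∑ i ∈ s, T i) := fun u ω => by
  rw [LinearMap.sum_apply, LinearMap.sum_apply, map_sum, LinearMap.sum_apply]
  exact Finset.sum_congr rfl fun i hi => h i hi u ω

theorem IsRightComp.mul {S S' : Module.End ℝ (Form U p)} {T T' : Module.End ℝ (TotalSymbol U)}
    (h : IsRightComp S T) (h' : IsRightComp S' T') : IsRightComp (S * S') (T' * T) :=
  fun u ω => by rw [Module.End.mul_apply, Module.End.mul_apply, h, h']

theorem IsRightComp.add {S S' : Module.End ℝ (Form U p)} {T T' : Module.End ℝ (TotalSymbol U)}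
    (h : IsRightComp S T) (h' : IsRightComp S' T') : IsRightComp (S + S') (T + T') :=
  fun u ω => by
    rw [LinearMap.add_apply, LinearMap.add_apply, map_add, map_add, LinearMap.add_apply, h, h']

theorem IsRightComp.sum {ι : Type*} {s : Finset ι} {S : ι → Module.End ℝ (Form U p)}
    {T : ι → Module.End ℝ (TotalSymbol U)} (h : ∀ i ∈ s, IsRightComp (S i) (T i)) :
    IsRightComp (∑ i ∈ s, S i) (∑ i ∈ s, T i) := fun u ω => by
  rw [LinearMap.sum_apply, LinearMap.sum_apply, map_sum, map_sum, LinearMap.sum_apply]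
  exact Finset.sum_congr rfl fun i hi => h i hi u ω

theorem IsLeftComp.of_tmul {S : Module.End ℝ (SmoothFun U)} {T : Module.End ℝ (TotalSymbol U)}
    (h : ∀ f Λ P ω, S (toDiffOp U p (f ⊗ₜ[ℝ] (Λ ⊗ₜ[ℝ] P)) ω) =
      toDiffOp U p (T (f ⊗ₜ[ℝ] (Λ ⊗ₜ[ℝ] P))) ω) : IsLeftComp p S T := fun u ω =>
  LinearMap.congr_fun (totalSymbol_hom_ext (S := S ∘ₗ (toDiffOp U p).flip ω)
    (T := (toDiffOp U p).flip ω ∘ₗ T) fun f Λ P => h f Λ P ω) u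

theorem IsRightComp.of_tmul {S : Module.End ℝ (Form U p)} {T : Module.End ℝ (TotalSymbol U)}
    (h : ∀ f Λ P ω, toDiffOp U p (f ⊗ₜ[ℝ] (Λ ⊗ₜ[ℝ] P)) (S ω) =
      toDiffOp U p (T (f ⊗ₜ[ℝ] (Λ ⊗ₜ[ℝ] P))) ω) : IsRightComp S T := fun u ω =>
  LinearMap.congr_fun (totalSymbol_hom_ext (S := (toDiffOp U p).flip (S ω))
    (T := (toDiffOp U p).flip ω ∘ₗ T) fun f Λ P => h f Λ P ω) u

theorem onForm_mul_apply (S T : Module.End ℝ (SmoothFun U)) (ω : Form U p) :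
    onForm p (S * T) ω = onForm p S (onForm p T ω) :=
  rfl

theorem onForm_add_apply (S T : Module.End ℝ (SmoothFun U)) (ω : Form U p) :
    onForm p (S + T) ω = onForm p S ω + onForm p T ω :=
  rfl

theorem isLeftComp_mulFun (f : SmoothFun U) : IsLeftComp p (mulFun f) (mulOp U f) :=
  .of_tmul fun g Λ P ω => by
    rw [mulOp_eq, funOp_tmul, toDiffOp_tmul_apply, toDiffOp_tmul_apply, LinearMap.mulLeft_apply,
      LinearMap.mulLeft_apply, mul_assoc]

theorem isLeftComp_partialD (i : Fin n) :
    IsLeftComp p (partialD U i) ((symbolWC U).d i + (symbolWC U).ξ i) :=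
  .of_tmul fun f Λ P ω => by
    have h : ((symbolWC U).d i + (symbolWC U).ξ i) (f ⊗ₜ[ℝ] (Λ ⊗ₜ[ℝ] P)) =
        partialD U i f ⊗ₜ[ℝ] (Λ ⊗ₜ[ℝ] P) + f ⊗ₜ[ℝ] (Λ ⊗ₜ[ℝ] (MvPolynomial.X i * P)) := rfl
    rw [h, map_add, LinearMap.add_apply, toDiffOp_tmul_apply, toDiffOp_tmul_apply,
      toDiffOp_tmul_apply, partialD_mul, constCoeffOp_X_mul, onForm_mul_apply,
      ← apply_evalForm (partialD U i), add_comm]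

theorem isRightComp_coord (i : Fin n) :
    IsRightComp (onForm p (mulFun (coord U i))) ((symbolWC U).x i + (symbolWC U).η i) :=
  .of_tmul fun f Λ P ω => by
    have h : ((symbolWC U).x i + (symbolWC U).η i) (f ⊗ₜ[ℝ] (Λ ⊗ₜ[ℝ] P)) =
        (coord U i * f) ⊗ₜ[ℝ] (Λ ⊗ₜ[ℝ] P) +
          f ⊗ₜ[ℝ] (Λ ⊗ₜ[ℝ] (MvPolynomial.pderiv i P)) := rfl
    rw [h, map_add, LinearMap.add_apply, toDiffOp_tmul_apply, toDiffOp_tmul_apply,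
      toDiffOp_tmul_apply, ← onForm_mul_apply, constCoeffOp_mul_coord,
      onForm_add_apply, map_add, mul_add, onForm_mul_apply, ← apply_evalForm (mulFun (coord U i)),
      LinearMap.mulLeft_apply]
    ring

theorem isRightComp_partialD (i : Fin n) :
    IsRightComp (onForm p (partialD U i)) ((symbolWC U).ξ i) :=
  .of_tmul fun f Λ P ω => by
    have h : (symbolWC U).ξ i (f ⊗ₜ[ℝ] (Λ ⊗ₜ[ℝ] P)) =
        f ⊗ₜ[ℝ] (Λ ⊗ₜ[ℝ] (MvPolynomial.X i * P)) := rfl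
    rw [h, toDiffOp_tmul_apply, toDiffOp_tmul_apply, ← onForm_mul_apply, constCoeffOp_X_mul,
      (commute_constCoeffOp i P).eq]

theorem isRightComp_formAct (i j : Fin n) :
    IsRightComp (formAct p (elemEnd n i j) : Module.End ℝ (Form U p))
      ((symbolWC U).w i * (symbolWC U).c j) :=
  .of_tmul fun f Λ P ω => by
    have h : ((symbolWC U).w i * (symbolWC U).c j) (f ⊗ₜ[ℝ] (Λ ⊗ₜ[ℝ] P)) =
        f ⊗ₜ[ℝ] (wedge i (contract j Λ) ⊗ₜ[ℝ] P) := rfl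
    rw [h, toDiffOp_tmul_apply, toDiffOp_tmul_apply, ← formAct_onForm, evalForm_formAct]

theorem lieDiffOp_toDiffOp {X : VectorField U} {S T : Module.End ℝ (TotalSymbol U)}
    (hS : IsLeftComp p (lieFun X) S) (hT : IsRightComp (lieForm p X) T) (u : TotalSymbol U) :
    lieDiffOp X (toDiffOp U p u) = toDiffOp U p (S u) - toDiffOp U p (T u) := by
  refine LinearMap.ext fun ω => ?_
  rw [lieDiffOp, LinearMap.sub_apply, LinearMap.sub_apply, LinearMap.comp_apply,
    LinearMap.comp_apply, hS, hT]

theorem isLeftComp_lieFun (X : VectorField U) : IsLeftComp p (lieFun X)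
    (∑ i, mulOp U (X i) * ((symbolWC U).d i + (symbolWC U).ξ i)) :=
  .sum fun i _ => (isLeftComp_mulFun (X i)).mul (isLeftComp_partialD i)

theorem onForm_lieFun (X : VectorField U) : (onForm p (lieFun X) : Module.End ℝ (Form U p)) =
    ∑ i, (onForm p (mulFun (X i)) : Module.End ℝ (Form U p)) * onForm p (partialD U i) := by
  let φ : Module.End ℝ (SmoothFun U) →+ Module.End ℝ (Form U p) :=
    AddMonoidHom.mk' (fun T => onForm p T) fun _ _ => rfl
  exact map_sum φ (fun i => mulFun (X i) ∘ₗ partialD U i) Finset.univ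

theorem isRightComp_lieForm {X : VectorField U} {R : Fin n → Module.End ℝ (TotalSymbol U)}
    {R' : Fin n → Fin n → Module.End ℝ (TotalSymbol U)}
    (hR : ∀ i, IsRightComp (onForm p (mulFun (X i))) (R i))
    (hR' : ∀ i j, IsRightComp (onForm p (mulFun (partialD U j (X i)))) (R' i j)) :
    IsRightComp (lieForm p X) (∑ i, (symbolWC U).ξ i * R i +
      ∑ i, ∑ j, (symbolWC U).w i * (symbolWC U).c j * R' i j) := by
  refine IsRightComp.add (S := onForm p (lieFun X)) ?_
    (.sum fun i _ => .sum fun j _ => (hR' i j).mul (isRightComp_formAct i j))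
  rw [onForm_lieFun]
  exact .sum fun i _ => (hR i).mul (isRightComp_partialD i)

theorem isRightComp_one : IsRightComp (onForm p (mulFun (1 : SmoothFun U))) 1 := fun u ω => by
  congr 1
  refine AlternatingMap.ext fun v => one_mul (ω v)

theorem isRightComp_zero : IsRightComp (onForm p (mulFun (0 : SmoothFun U))) 0 := fun u ω => by
  have h : onForm p (mulFun (0 : SmoothFun U)) ω = 0 :=
    AlternatingMap.ext fun v => zero_mul (ω v)
  rw [LinearMap.zero_apply, map_zero, LinearMap.zero_apply, h, map_zero]

theorem isRightComp_mul {f g : SmoothFun U} {S T : Module.End ℝ (TotalSymbol U)}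
    (hf : IsRightComp (onForm p (mulFun f)) S) (hg : IsRightComp (onForm p (mulFun g)) T) :
    IsRightComp (onForm p (mulFun (f * g))) (T * S) := by
  convert hf.mul hg using 1
  exact LinearMap.ext fun ω => AlternatingMap.ext fun v => mul_assoc f g (ω v)

theorem isRightComp_add {f g : SmoothFun U} {S T : Module.End ℝ (TotalSymbol U)}
    (hf : IsRightComp (onForm p (mulFun f)) S) (hg : IsRightComp (onForm p (mulFun g)) T) :
    IsRightComp (onForm p (mulFun (f + g))) (S + T) := by
  convert hf.add hg using 1
  exact LinearMap.ext fun ω => AlternatingMap.ext fun v => add_mul f g (ω v)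

theorem isRightComp_ite {f : SmoothFun U} {S : Module.End ℝ (TotalSymbol U)} (P : Prop)
    [Decidable P] (hf : IsRightComp (onForm p (mulFun f)) S) :
    IsRightComp (onForm p (mulFun (if P then f else 0))) (if P then S else 0) := by
  split_ifs
  · exact hf
  · exact isRightComp_zero

theorem lieDiffOp_of_eq {X : VectorField U} {L S T : Module.End ℝ (TotalSymbol U)}
    (hS : IsLeftComp p (lieFun X) S) (hT : IsRightComp (lieForm p X) T) (h : S = L + T)
    (u : TotalSymbol U) : lieDiffOp X (toDiffOp U p u) = toDiffOp U p (L u) := by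
  rw [lieDiffOp_toDiffOp hS hT, h, LinearMap.add_apply, map_add, add_sub_cancel_right]

theorem lieDiffOp_const (r : Fin n) (u : TotalSymbol U) :
    lieDiffOp (Pi.single r 1) (toDiffOp U p u) = toDiffOp U p ((symbolWC U).d r u) := by
  have hR (i : Fin n) : IsRightComp (onForm p (mulFun ((Pi.single r 1 : VectorField U) i)))
      (if i = r then 1 else 0) := by
    rw [Pi.single_apply]; exact isRightComp_ite _ isRightComp_one
  have hR' (i j : Fin n) : IsRightComp
      (onForm p (mulFun (partialD U j ((Pi.single r 1 : VectorField U) i)))) 0 := by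
    rw [Pi.single_apply, apply_ite (partialD U j), partialD_one, map_zero, ite_self]
    exact isRightComp_zero
  refine lieDiffOp_of_eq (isLeftComp_lieFun _) (isRightComp_lieForm hR hR') ?_ u
  simp [Pi.single_apply, apply_ite, ite_mul]

theorem lieDiffOp_linear (r s : Fin n) (u : TotalSymbol U) :
    lieDiffOp (Pi.single r (coord U s)) (toDiffOp U p u) =
      toDiffOp U p ((symbolWC U).lieLin s r u) := by
  have hR (i : Fin n) : IsRightComp
      (onForm p (mulFun ((Pi.single r (coord U s) : VectorField U) i)))
      (if i = r then (symbolWC U).x s + (symbolWC U).η s else 0) := by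
    rw [Pi.single_apply]; exact isRightComp_ite _ (isRightComp_coord s)
  have hR' (i j : Fin n) : IsRightComp
      (onForm p (mulFun (partialD U j ((Pi.single r (coord U s) : VectorField U) i))))
      (if i = r then (if j = s then 1 else 0) else 0) := by
    rw [Pi.single_apply, apply_ite (partialD U j), partialD_coord, map_zero]
    exact isRightComp_ite _ (isRightComp_ite _ isRightComp_one)
  refine lieDiffOp_of_eq (isLeftComp_lieFun _) (isRightComp_lieForm hR hR') ?_ u
  have h (s : Fin n) : mulOp U (coord U s) = (symbolWC U).x s := rfl
  simp only [Pi.single_apply, apply_ite, ite_mul, h, map_zero, zero_mul, mul_zero,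
    Finset.sum_ite_eq', Finset.mem_univ, if_true, mul_one, Finset.sum_ite_irrel,
    Finset.sum_const_zero]
  exact (symbolWC U).lieLin_add_right s r

theorem lieDiffOp_quadratic (r : Fin n) (u : TotalSymbol U) :
    lieDiffOp (fun i => coord U r * coord U i) (toDiffOp U p u) =
      toDiffOp U p ((symbolWC U).lieQuad r u - ((symbolWC U).a r + (symbolWC U).b r) u) := by
  have hR (i : Fin n) : IsRightComp (onForm p (mulFun (coord U r * coord U i)))
      (((symbolWC U).x i + (symbolWC U).η i) * ((symbolWC U).x r + (symbolWC U).η r)) :=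
    isRightComp_mul (isRightComp_coord r) (isRightComp_coord i)
  have hR' (i j : Fin n) : IsRightComp
      (onForm p (mulFun (partialD U j (coord U r * coord U i))))
      ((if j = i then (symbolWC U).x r + (symbolWC U).η r else 0) +
        (if j = r then (symbolWC U).x i + (symbolWC U).η i else 0)) := by
    have h1 : partialD U j (coord U r * coord U i) =
        (if j = i then coord U r else 0) + (if j = r then coord U i else 0) := by
      rw [partialD_mul, partialD_coord, partialD_coord]; simp
    rw [h1]
    exact isRightComp_add (isRightComp_ite _ (isRightComp_coord r))
      (isRightComp_ite _ (isRightComp_coord i))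
  rw [lieDiffOp_toDiffOp (isLeftComp_lieFun _) (isRightComp_lieForm hR hR'), ← map_sub]
  congr 1
  have h := LinearMap.congr_fun ((symbolWC U).lieQuad_add_right r) u
  rw [LinearMap.add_apply, LinearMap.add_apply _ _ u] at h
  rw [sub_eq_sub_iff_add_eq_add]
  simp only [map_mul]
  exact h

end Intertwining

/-! ### Unitriangular operators on a graded space -/

section Graded

variable {V : Type*} [AddCommGroup V] [Module ℝ V] {G : ℕ → Submodule ℝ V}

/-- The filtration `⨁_{r < k} G_r` attached to the gradation `G`. -/
def lowerPart (G : ℕ → Submodule ℝ V) (k : ℕ) : Submodule ℝ V := ⨆ r : Fin k, G r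

/-- An operator which is the identity up to terms of lower degree. -/
def IsUnitriangular (G : ℕ → Submodule ℝ V) (T : V →ₗ[ℝ] V) : Prop :=
  ∀ k, ∀ u ∈ G k, T u - u ∈ lowerPart G k

theorem le_lowerPart {r k : ℕ} (h : r < k) : G r ≤ lowerPart G k :=
  le_iSup (fun r : Fin k => G r) ⟨r, h⟩

theorem lowerPart_le {k : ℕ} {S : Submodule ℝ V} (h : ∀ r < k, G r ≤ S) : lowerPart G k ≤ S :=
  iSup_le fun r => h r r.2

theorem lowerPart_mono : Monotone (lowerPart G) := fun _ _ h =>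
  lowerPart_le fun _ hr => le_lowerPart (hr.trans_le h)

theorem mem_lowerPart_succ {k : ℕ} {u : V} (hu : u ∈ lowerPart G (k + 1)) :
    ∃ v ∈ G k, ∃ w ∈ lowerPart G k, v + w = u := by
  rw [← Submodule.mem_sup]
  refine lowerPart_le (fun r hr => ?_) hu
  rcases (Nat.lt_succ_iff_lt_or_eq.1 hr) with h | rfl
  · exact (le_lowerPart h).trans le_sup_right
  · exact le_sup_left

theorem mem_lowerPart_zero {u : V} (hu : u ∈ lowerPart G 0) : u = 0 := by
  have : lowerPart G 0 ≤ ⊥ := lowerPart_le fun r hr => absurd hr (Nat.not_lt_zero r)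
  exact (Submodule.mem_bot ℝ).1 (this hu)

theorem exists_mem_lowerPart (htop : ⨆ k, G k = ⊤) (u : V) : ∃ k, u ∈ lowerPart G k := by
  have h : (⊤ : Submodule ℝ V) ≤ ⨆ k, lowerPart G k := by
    rw [← htop]
    exact iSup_le fun k => (le_lowerPart k.lt_succ_self).trans (le_iSup (lowerPart G) (k + 1))
  exact (Submodule.mem_iSup_of_directed _ lowerPart_mono.directed_le).1 (h trivial)

/-- A family of linear maps, one for each degree, glues to a linear map. -/
theorem exists_linearMap_eqOn {V' : Type*} [AddCommMonoid V'] [Module ℝ V'] (hG : iSupIndep G)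
    (htop : ⨆ k, G k = ⊤) (q : ℕ → V →ₗ[ℝ] V') :
    ∃ T : V →ₗ[ℝ] V', ∀ k, ∀ u ∈ G k, T u = q k u := by
  have hint := DirectSum.isInternal_submodule_of_iSupIndep_of_iSup_eq_top hG htop
  let e := LinearEquiv.ofBijective (DirectSum.coeLinearMap G) hint
  refine ⟨DirectSum.toModule ℝ ℕ V' (fun k => q k ∘ₗ (G k).subtype) ∘ₗ e.symm.toLinearMap,
    fun k u hu => ?_⟩
  have : e.symm u = DirectSum.lof ℝ ℕ (fun k => G k) k ⟨u, hu⟩ := by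
    rw [LinearEquiv.symm_apply_eq]
    exact (DirectSum.coeLinearMap_lof G k ⟨u, hu⟩).symm
  rw [LinearMap.comp_apply, LinearEquiv.coe_coe, this, DirectSum.toModule_lof]
  rfl

namespace IsUnitriangular

variable {T : V →ₗ[ℝ] V}

theorem apply_mem (hT : IsUnitriangular G T) {k : ℕ} {u : V} (hu : u ∈ lowerPart G k) :
    T u ∈ lowerPart G k := by
  refine lowerPart_le (S := (lowerPart G k).comap T) (fun r hr v hv => ?_) hu
  rw [Submodule.mem_comap, ← sub_add_cancel (T v) v]
  exact add_mem (lowerPart_mono hr.le (hT r v hv)) (le_lowerPart hr hv)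

theorem exists_apply_eq (hT : IsUnitriangular G T) {k : ℕ} {v : V} (hv : v ∈ lowerPart G k) :
    ∃ u ∈ lowerPart G k, T u = v := by
  induction k generalizing v with
  | zero => exact ⟨0, zero_mem _, by rw [mem_lowerPart_zero hv, map_zero]⟩
  | succ k ih =>
    obtain ⟨x, hx, y, hy, rfl⟩ := mem_lowerPart_succ hv
    obtain ⟨z, hz, hTz⟩ := ih (Submodule.sub_mem _ hy (hT k x hx))
    refine ⟨x + z, add_mem (le_lowerPart k.lt_succ_self hx)
      (lowerPart_mono k.le_succ hz), ?_⟩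
    rw [map_add, hTz]; abel

theorem surjective (hT : IsUnitriangular G T) (htop : ⨆ k, G k = ⊤) :
    Function.Surjective T := fun v => by
  obtain ⟨k, hk⟩ := exists_mem_lowerPart htop v
  obtain ⟨u, -, hu⟩ := hT.exists_apply_eq hk
  exact ⟨u, hu⟩

theorem injective (hT : IsUnitriangular G T) (htop : ⨆ k, G k = ⊤) :
    Function.Injective T := by
  have key (k : ℕ) : ∀ u ∈ lowerPart G k, T u = 0 → u = 0 := by
    induction k with
    | zero => exact fun u hu _ => mem_lowerPart_zero hu
    | succ k ih =>
      intro u hu h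
      obtain ⟨x, hx, y, hy, rfl⟩ := mem_lowerPart_succ hu
      have hx' : x ∈ lowerPart G k := by
        have e : x = -(T x - x + T y) := by
          rw [map_add] at h
          rw [sub_add_eq_add_sub, h]; abel
        rw [e]
        exact neg_mem (add_mem (hT k x hx) (hT.apply_mem hy))
      exact ih _ (add_mem hx' hy) h
  refine (injective_iff_map_eq_zero T).2 fun u h => ?_
  obtain ⟨k, hk⟩ := exists_mem_lowerPart htop u
  exact key k u hk h

theorem mem_of_apply_mem (hT : IsUnitriangular G T) (hinj : Function.Injective T) {k : ℕ} {u : V}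
    (hu : T u ∈ lowerPart G k) : u ∈ lowerPart G k := by
  obtain ⟨v, hv, h⟩ := hT.exists_apply_eq hu
  rwa [← hinj h]

theorem of_comp {S : V →ₗ[ℝ] V} (hT : IsUnitriangular G T) (hST : IsUnitriangular G (S ∘ₗ T)) :
    IsUnitriangular G S := by
  have key (k : ℕ) : ∀ u ∈ lowerPart G k, S u ∈ lowerPart G k := fun u hu => by
    obtain ⟨v, hv, rfl⟩ := hT.exists_apply_eq hu
    exact hST.apply_mem hv
  intro k u hu
  have e : S u - u = (S ∘ₗ T) u - u - S (T u - u) := by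
    rw [map_sub, LinearMap.comp_apply]; abel
  rw [e]
  exact Submodule.sub_mem _ (hST k u hu) (key k _ (hT k u hu))

/-- A unitriangular operator commuting with an operator `C` whose eigenvalues `a_k`, `b_k` in
degree `k` differ from those in all lower degrees is the identity. -/
theorem eq_id_of_commute {S C : Module.End ℝ V} (hS : IsUnitriangular G S) (htop : ⨆ k, G k = ⊤)
    (hSC : Commute S C) {a b : ℕ → ℝ} (hC : ∀ k, ∀ u ∈ G k,
      C (C u) - (a k + b k) • C u + (a k * b k) • u = 0)
    (hne : ∀ k, ∀ r < k, a k ≠ a r ∧ a k ≠ b r ∧ b k ≠ a r ∧ b k ≠ b r) : S = LinearMap.id := by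
  let g : ℕ → Polynomial ℝ := fun k =>
    (Polynomial.X - Polynomial.C (a k)) * (Polynomial.X - Polynomial.C (b k))
  have hg (k : ℕ) (u : V) (hu : u ∈ G k) : Polynomial.aeval C (g k) u = 0 := by
    rw [← hC k u hu]
    simp only [g, map_mul, map_sub, Polynomial.aeval_X, Polynomial.aeval_C, Module.End.mul_apply,
      LinearMap.sub_apply, Module.algebraMap_end_apply, map_sub, map_smul]
    module
  have hh (k : ℕ) (u : V) (hu : u ∈ lowerPart G k) :
      Polynomial.aeval C (∏ r ∈ Finset.range k, g r) u = 0 := by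
    refine lowerPart_le (S := LinearMap.ker (Polynomial.aeval C (∏ r ∈ Finset.range k, g r)))
      (fun r hr v hv => ?_) hu
    rw [LinearMap.mem_ker, ← Finset.prod_erase_mul _ _ (Finset.mem_range.2 hr), map_mul,
      Module.End.mul_apply, hg r v hv, map_zero]
  have hcop (k : ℕ) : IsCoprime (g k) (∏ r ∈ Finset.range k, g r) := by
    refine IsCoprime.prod_right fun r hr => ?_
    have h1 {x y : ℝ} (h : x ≠ y) :
        IsCoprime (Polynomial.X - Polynomial.C x) (Polynomial.X - Polynomial.C y) :=
      Polynomial.isCoprime_X_sub_C_of_isUnit_sub (sub_ne_zero.2 h).isUnit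
    obtain ⟨h2, h3, h4, h5⟩ := hne k r (Finset.mem_range.1 hr)
    exact ((h1 h2).mul_right (h1 h3)).mul_left ((h1 h4).mul_right (h1 h5))
  have key (k : ℕ) (u : V) (hu : u ∈ G k) : S u = u := by
    obtain ⟨x, y, hxy⟩ := hcop k
    have hcomm : Commute S (Polynomial.aeval C (g k)) := by
      induction g k using Polynomial.induction_on' with
      | add p q hp hq => rw [map_add]; exact hp.add_right hq
      | monomial m r =>
        rw [Polynomial.aeval_monomial]
        exact (Algebra.commute_algebraMap_right r S).mul_right (hSC.pow_right m)
    have h1 : Polynomial.aeval C (g k) (S u - u) = 0 := by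
      have : Polynomial.aeval C (g k) (S u) = S (Polynomial.aeval C (g k) u) :=
        (LinearMap.congr_fun hcomm.eq u).symm
      rw [map_sub, this, hg k u hu, map_zero, sub_zero]
    have h2 := congrArg (fun P => Polynomial.aeval C P (S u - u)) hxy
    simp only [map_add, map_mul, LinearMap.add_apply, Module.End.mul_apply, h1,
      hh k _ (hS k u hu), map_zero, add_zero, map_one, Module.End.one_apply] at h2
    exact (sub_eq_zero.1 h2.symm)
  have : (⊤ : Submodule ℝ V) ≤ LinearMap.eqLocus S LinearMap.id := by
    rw [← htop]
    exact iSup_le fun k u hu => key k u hu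
  exact LinearMap.ext fun u => this trivial

end IsUnitriangular

end Graded

/-! ### Symbols are determined by their operators -/

section Injective

variable {n : ℕ} {U : Opens (Fin n → ℝ)} {p : ℕ}

theorem η_mem {k : ℕ} {u : TotalSymbol U} (hu : u ∈ symbolDeg U p (k + 1)) (r : Fin n) :
    (symbolWC U).η r u ∈ symbolDeg U p k := by
  refine symbolDeg_induction (S := (symbolDeg U p k).comap ((symbolWC U).η r))
    (fun f Λ hΛ P hP => ?_) hu
  exact tmul_mem_symbolDeg f hΛ (hP.pderiv (i := r))

theorem symbolDeg_le_symbolLT {r k : ℕ} (h : r < k) : symbolDeg U p r ≤ symbolLT U p k :=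
  le_lowerPart (G := symbolDeg U p) h

theorem η_mem_symbolLT {k : ℕ} {u : TotalSymbol U} (hu : u ∈ symbolLT U p (k + 1)) (r : Fin n) :
    (symbolWC U).η r u ∈ symbolLT U p k := by
  refine lowerPart_le (S := (symbolLT U p k).comap ((symbolWC U).η r)) (fun s hs v hv => ?_) hu
  rw [Submodule.mem_comap]
  rcases s with _ | s
  · rw [η_apply_eq_zero hv]; exact Submodule.zero_mem _
  · exact le_lowerPart (Nat.lt_of_succ_lt_succ hs) (η_mem hv r)

/-- `toDiffOp (η_r u)` is the commutator of `toDiffOp u` with the coordinate `x^r`. -/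
theorem toDiffOp_η {u : TotalSymbol U} (hu : toDiffOp U p u = 0) (r : Fin n) :
    toDiffOp U p ((symbolWC U).η r u) = 0 := by
  refine LinearMap.ext fun ω => ?_
  have h1 := isRightComp_coord (p := p) r u ω
  have h2 := isLeftComp_mulFun (p := p) (coord U r) u ω
  rw [LinearMap.add_apply, map_add, LinearMap.add_apply] at h1
  rw [hu, LinearMap.zero_apply, map_zero] at h2
  have h3 : toDiffOp U p ((symbolWC U).x r u) ω = 0 := h2.symm
  rw [hu, LinearMap.zero_apply, h3, zero_add] at h1
  exact h1.symm

/-- An operator of order zero is a contraction with a multivector field, and is tested on constant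
forms. -/
theorem eq_zero_of_toDiffOp_eq_zero_deg_zero {u : TotalSymbol U} (hu : u ∈ symbolDeg U p 0)
    (h : toDiffOp U p u = 0) : u = 0 := by
  classical
  let Φ : SmoothFun U ⊗[ℝ] ⋀[ℝ]^p (Fin n → ℝ) →ₗ[ℝ] TotalSymbol U :=
    LinearMap.lTensor _ ((TensorProduct.mk ℝ _ (MvPolynomial (Fin n) ℝ)).flip 1 ∘ₗ
      (⋀[ℝ]^p (Fin n → ℝ)).subtype)
  have hΦ : u ∈ LinearMap.range Φ := by
    refine symbolDeg_induction (fun f Λ hΛ P hP => ?_) hu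
    rw [← MvPolynomial.totalDegree_zero_iff_isHomogeneous,
      MvPolynomial.totalDegree_eq_zero_iff_eq_C] at hP
    refine ⟨(P.coeff 0 • f) ⊗ₜ ⟨Λ, hΛ⟩, ?_⟩
    change (P.coeff 0 • f) ⊗ₜ[ℝ] (Λ ⊗ₜ[ℝ] (1 : MvPolynomial (Fin n) ℝ)) = _
    rw [TensorProduct.smul_tmul, ← TensorProduct.tmul_smul, MvPolynomial.smul_eq_C_mul, mul_one,
      ← hP]
  obtain ⟨z, rfl⟩ := hΦ
  let b := Module.Basis.ofVectorSpace ℝ (⋀[ℝ]^p (Fin n → ℝ))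
  -- The constant form dual to the basis vector `b i`.
  let ω (i) : Form U p := (Algebra.linearMap ℝ (SmoothFun U) ∘ₗ b.coord i).compAlternatingMap
    (exteriorPower.ιMulti ℝ p)
  have hω (i) (Λ : ⋀[ℝ]^p (Fin n → ℝ)) :
      evalForm U p (Λ : ExteriorAlgebra ℝ (Fin n → ℝ)) (ω i) = algebraMap ℝ _ (b.repr Λ i) := by
    have : (evalForm U p).flip (ω i) ∘ₗ (⋀[ℝ]^p (Fin n → ℝ)).subtype =
        Algebra.linearMap ℝ (SmoothFun U) ∘ₗ b.coord i := by
      refine exteriorPower.linearMap_ext (AlternatingMap.ext fun v => ?_)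
      exact evalForm_ιMulti v (ω i)
    exact LinearMap.congr_fun this Λ
  have key (z : SmoothFun U ⊗[ℝ] ⋀[ℝ]^p (Fin n → ℝ)) (i) :
      TensorProduct.equivFinsuppOfBasisRight b z i = toDiffOp U p (Φ z) (ω i) := by
    induction z using TensorProduct.induction_on with
    | zero => simp
    | add x y hx hy =>
      rw [map_add, map_add, map_add, LinearMap.add_apply, ← hx, ← hy, Finsupp.add_apply]
    | tmul f Λ =>
      have e : Φ (f ⊗ₜ Λ) = f ⊗ₜ[ℝ] ((Λ : ExteriorAlgebra ℝ (Fin n → ℝ)) ⊗ₜ[ℝ] MvPolynomial.C 1) :=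
        rfl
      have e1 : onForm p (constCoeffOp U (MvPolynomial.C 1)) (ω i) = ω i := by
        rw [constCoeffOp_C, one_smul]; rfl
      rw [e, toDiffOp_tmul_apply, e1, hω, TensorProduct.equivFinsuppOfBasisRight_apply_tmul_apply,
        Algebra.smul_def, mul_comm]
  have hz : z = 0 := by
    refine (TensorProduct.equivFinsuppOfBasisRight b).injective (Finsupp.ext fun i => ?_)
    rw [key, h, map_zero]
    rfl
  rw [hz, map_zero]

/-- A symbol is determined by its operator: the commutators with the coordinates reduce the claim
to symbols of degree zero. -/
theorem eq_zero_of_toDiffOp_eq_zero {u : TotalSymbol U} {k : ℕ} (hu : u ∈ symbolLT U p k)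
    (h : toDiffOp U p u = 0) : u = 0 := by
  induction k generalizing u with
  | zero => exact mem_lowerPart_zero hu
  | succ k ih =>
    have hη (r : Fin n) : (symbolWC U).η r u = 0 := ih (η_mem_symbolLT hu r) (toDiffOp_η h r)
    -- By Euler's identity the component of degree `k` of `u` can be recovered from its lower part.
    have hdeg : (symbolWC U).degξ u = 0 := by
      simp [WeylClifford.degξ, LinearMap.sum_apply, hη]
    rcases k with _ | k
    · refine eq_zero_of_toDiffOp_eq_zero_deg_zero ?_ h
      exact lowerPart_le (G := symbolDeg U p) (fun r hr => by
        obtain rfl : r = 0 := by omega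
        exact le_rfl) hu
    · obtain ⟨v, hv, w, hw, rfl⟩ := mem_lowerPart_succ (G := symbolDeg U p) hu
      refine ih (Submodule.add_mem _ ?_ hw) h
      have hw' : (symbolWC U).degξ w ∈ symbolLT U p (k + 1) := by
        refine lowerPart_le (S := (symbolLT U p (k + 1)).comap (symbolWC U).degξ)
          (fun r hr x hx => ?_) hw
        rw [Submodule.mem_comap, degξ_apply hx]
        exact Submodule.smul_mem _ _ (le_lowerPart (G := symbolDeg U p) hr hx)
      rw [map_add, degξ_apply hv] at hdeg
      have : v = -(((k + 1 : ℕ) : ℝ)⁻¹ • (symbolWC U).degξ w) := by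
        rw [eq_neg_of_add_eq_zero_right hdeg, smul_neg, neg_neg, smul_smul,
          inv_mul_cancel₀ (Nat.cast_ne_zero.2 k.succ_ne_zero), one_smul]
      rw [this]
      exact Submodule.neg_mem _ (Submodule.smul_mem _ _ hw')

/-- The spaces `𝒮^k_p` lie in distinct eigenspaces of the Euler operator. -/
theorem iSupIndep_symbolDeg : iSupIndep (symbolDeg U p) :=
  ((symbolWC U).degξ.eigenspaces_iSupIndep.comp (Nat.cast_injective (R := ℝ))).mono
    fun _ _ hu => Module.End.mem_eigenspace_iff.2 (degξ_apply hu)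

end Injective

/-! ### The gradation of the space of symbols -/

section SymbolSpace

variable {n : ℕ}

/-- The space `𝒮_p` as a type of its own, so that its additive group structure does not have to be
compared with the one of the tensor product. -/
def SymbolType (U : Opens (Fin n → ℝ)) (p : ℕ) : Type :=
  symbolSpace U p

noncomputable instance (U : Opens (Fin n → ℝ)) (p : ℕ) : AddCommGroup (SymbolType U p) :=
  inferInstanceAs (AddCommGroup (symbolSpace U p))

noncomputable instance (U : Opens (Fin n → ℝ)) (p : ℕ) : Module ℝ (SymbolType U p) :=
  inferInstanceAs (Module ℝ (symbolSpace U p))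

/-- The identification of `SymbolType U p` with the subspace `𝒮_p`. -/
noncomputable def symbolEquiv (U : Opens (Fin n → ℝ)) (p : ℕ) :
    SymbolType U p ≃ₗ[ℝ] symbolSpace U p :=
  LinearEquiv.refl ℝ (symbolSpace U p)

/-- The inclusion of `𝒮_p` into the space of all symbols. -/
noncomputable def incl (U : Opens (Fin n → ℝ)) (p : ℕ) : SymbolType U p →ₗ[ℝ] TotalSymbol U :=
  (symbolSpace U p).subtype ∘ₗ (symbolEquiv U p).toLinearMap

/-- The space `𝒮^k_p` as a subspace of `𝒮_p`. -/
noncomputable def degPart (U : Opens (Fin n → ℝ)) (p k : ℕ) : Submodule ℝ (SymbolType U p) :=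
  (symbolDeg U p k).comap (incl U p)

variable {U : Opens (Fin n → ℝ)} {p : ℕ}

theorem mem_degPart {k : ℕ} {u : SymbolType U p} :
    u ∈ degPart U p k ↔ incl U p u ∈ symbolDeg U p k :=
  Iff.rfl

theorem incl_injective : Function.Injective (incl U p) :=
  Subtype.val_injective

theorem incl_mem (u : SymbolType U p) : incl U p u ∈ symbolSpace U p :=
  (symbolEquiv U p u).2

theorem exists_incl_eq {u : TotalSymbol U} (hu : u ∈ symbolSpace U p) :
    ∃ v : SymbolType U p, incl U p v = u :=
  ⟨(symbolEquiv U p).symm ⟨u, hu⟩, rfl⟩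

theorem symbolDeg_le_symbolSpace (k : ℕ) : symbolDeg U p k ≤ symbolSpace U p :=
  le_iSup (symbolDeg U p) k

theorem mem_lowerPart_degPart {k : ℕ} {u : SymbolType U p} :
    u ∈ lowerPart (degPart U p) k ↔ incl U p u ∈ symbolLT U p k := by
  constructor
  · intro hu
    have : lowerPart (degPart U p) k ≤ (symbolLT U p k).comap (incl U p) := by
      refine lowerPart_le fun r hr v hv => ?_
      exact symbolDeg_le_symbolLT hr (mem_degPart.1 hv)
    exact this hu
  · intro hu
    have : symbolLT U p k ≤ (lowerPart (degPart U p) k).map (incl U p) := by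
      refine lowerPart_le fun r hr v hv => ?_
      obtain ⟨w, rfl⟩ := exists_incl_eq (symbolDeg_le_symbolSpace r hv)
      exact Submodule.mem_map_of_mem (le_lowerPart hr (mem_degPart.2 hv))
    obtain ⟨v, hv, h⟩ := this hu
    rwa [← incl_injective h]

theorem iSup_degPart : ⨆ k, degPart U p k = ⊤ := by
  refine eq_top_iff.2 fun u _ => ?_
  have : symbolSpace U p ≤ (⨆ k, degPart U p k).map (incl U p) := by
    refine iSup_le fun k v hv => ?_
    obtain ⟨w, rfl⟩ := exists_incl_eq (symbolDeg_le_symbolSpace k hv)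
    exact Submodule.mem_map_of_mem (Submodule.mem_iSup_of_mem k (mem_degPart.2 hv))
  obtain ⟨v, hv, h⟩ := this (incl_mem u)
  rwa [← incl_injective h]

theorem iSupIndep_degPart : iSupIndep (degPart U p) := by
  refine fun k => Submodule.disjoint_def.2 fun u hu hu' => incl_injective ?_
  rw [map_zero]
  refine Submodule.disjoint_def.1 (iSupIndep_symbolDeg (U := U) (p := p) k) _ hu ?_
  have : ⨆ j, ⨆ (_ : j ≠ k), degPart U p j ≤
      (⨆ j, ⨆ (_ : j ≠ k), symbolDeg U p j).comap (incl U p) :=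
    iSup₂_le fun j hj v hv => Submodule.mem_iSup_of_mem j (Submodule.mem_iSup_of_mem hj hv)
  exact this hu'

/-- Linear maps out of `𝒮_p` are determined by their values on homogeneous symbols. -/
theorem symbolType_hom_ext {V : Type*} [AddCommMonoid V] [Module ℝ V]
    {S T : SymbolType U p →ₗ[ℝ] V} (h : ∀ k, ∀ u ∈ degPart U p k, S u = T u) : S = T := by
  have : (⊤ : Submodule ℝ (SymbolType U p)) ≤ LinearMap.eqLocus S T := by
    rw [← iSup_degPart]
    exact iSup_le fun k u hu => h k u hu
  exact LinearMap.ext fun u => this trivial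

theorem eq_zero_of_toDiffOp_incl {u : SymbolType U p} (h : toDiffOp U p (incl U p u) = 0) :
    u = 0 := by
  obtain ⟨k, hk⟩ := exists_mem_lowerPart iSup_degPart u
  apply incl_injective
  rw [map_zero]
  exact eq_zero_of_toDiffOp_eq_zero (mem_lowerPart_degPart.1 hk) h

variable (U p) in
/-- The identification of symbols with differential operators. -/
noncomputable def diffOpEquiv : SymbolType U p ≃ₗ[ℝ] diffOpSpace U p :=
  LinearEquiv.ofBijective
    ((toDiffOp U p ∘ₗ incl U p).codRestrict (diffOpSpace U p)
      fun u => Submodule.mem_map_of_mem (incl_mem u))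
    ⟨(injective_iff_map_eq_zero _).2 fun _ h => eq_zero_of_toDiffOp_incl (congrArg Subtype.val h),
      fun ⟨D, u, hu, hD⟩ => by
        obtain ⟨v, rfl⟩ := exists_incl_eq hu
        exact ⟨v, Subtype.ext hD⟩⟩

end SymbolSpace

/-! ### The coefficients of the quantization map -/

section Coefficients

/-- The coefficient of `(δ ∘ (η∂) ∘ δ^*)^l` in the quantization of symbols of degree `k`. -/
noncomputable def coefA (n p k l : ℕ) : ℝ :=
  (1 / ((n : ℝ) + 1)) ^ l * ∏ j ∈ Finset.Icc 1 l, 1 / (casimirA n p k - casimirA n p (k - j))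

/-- The coefficient of `(δ^* ∘ (η∂) ∘ δ)^l` in the quantization of symbols of degree `k`. -/
noncomputable def coefB (n p k l : ℕ) : ℝ :=
  (1 / ((n : ℝ) + 1)) ^ l * ∏ j ∈ Finset.Icc 1 l, 1 / (casimirB n p k - casimirB n p (k - j))

theorem coefA_zero (n p k : ℕ) : coefA n p k 0 = 1 := by simp [coefA]

theorem coefB_zero (n p k : ℕ) : coefB n p k 0 = 1 := by simp [coefB]

/-- The factor is `n + 1` times `α^k_p - α^{k-l-1}_p`. -/
theorem coefA_succ (n p : ℕ) {k l : ℕ} (h : l < k) :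
    coefA n p k (l + 1) * ((l + 1) * (n + p + 2 * k - l)) = coefA n p k l := by
  have hl : (l : ℝ) + 1 ≤ k := by exact_mod_cast h
  have hk : ((k - (l + 1) : ℕ) : ℝ) = k - (l + 1) := by
    rw [Nat.cast_sub h]; push_cast; ring
  have hn : (n : ℝ) + 1 ≠ 0 := by positivity
  have h1 : (l : ℝ) + 1 ≠ 0 := by positivity
  have h2 : (n + p + 2 * k - l : ℝ) ≠ 0 := by
    have : (0 : ℝ) < n + p + 2 * k - l := by
      have := Nat.cast_nonneg (α := ℝ) n
      have := Nat.cast_nonneg (α := ℝ) p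
      have := Nat.cast_nonneg (α := ℝ) l
      linarith
    exact this.ne'
  have h3 : casimirA n p k - casimirA n p (k - (l + 1)) =
      ((l + 1) * (n + p + 2 * k - l)) / (n + 1) := by
    rw [casimirA, casimirA, hk]; field_simp; ring
  rw [coefA, Finset.prod_Icc_succ_top (Nat.le_add_left 1 l), h3, coefA, pow_succ]
  field_simp

/-- The factor is `n + 1` times `β^k_p - β^{k-l-1}_p`. -/
theorem coefB_succ (n p : ℕ) {k l : ℕ} (h : l < k) :
    coefB n p k (l + 1) * ((l + 1) * (n + p + 2 * k - 1 - l)) = coefB n p k l := by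
  have hl : (l : ℝ) + 1 ≤ k := by exact_mod_cast h
  have hk : ((k - (l + 1) : ℕ) : ℝ) = k - (l + 1) := by
    rw [Nat.cast_sub h]; push_cast; ring
  have hn : (n : ℝ) + 1 ≠ 0 := by positivity
  have h1 : (l : ℝ) + 1 ≠ 0 := by positivity
  have h2 : (n + p + 2 * k - 1 - l : ℝ) ≠ 0 := by
    have : (0 : ℝ) < n + p + 2 * k - 1 - l := by
      have := Nat.cast_nonneg (α := ℝ) n
      have := Nat.cast_nonneg (α := ℝ) p
      have := Nat.cast_nonneg (α := ℝ) l
      linarith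
    exact this.ne'
  have h3 : casimirB n p k - casimirB n p (k - (l + 1)) =
      ((l + 1) * (n + p + 2 * k - 1 - l)) / (n + 1) := by
    rw [casimirB, casimirB, hk]; field_simp; ring
  rw [coefB, Finset.prod_Icc_succ_top (Nat.le_add_left 1 l), h3, coefB, pow_succ]
  field_simp

/-- The Casimir eigenvalues in degree `r` are smaller than those in any higher degree `k`. -/
theorem casimir_lt {n p r k : ℕ} (h : r < k) :
    (2 * (((r : ℝ) + n + 1) * (r + p)) : ℝ) < 2 * ((k + n) * (k + p)) := by
  have h1 : (r : ℝ) + 1 ≤ k := by exact_mod_cast h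
  have hr := Nat.cast_nonneg (α := ℝ) r
  have hp := Nat.cast_nonneg (α := ℝ) p
  have hn := Nat.cast_nonneg (α := ℝ) n
  have h2 : ((r : ℝ) + n + 1) * (r + p) ≤ (k + n) * (r + p) :=
    mul_le_mul_of_nonneg_right (by linarith) (by positivity)
  have h3 : ((k : ℝ) + n) * (r + p) < (k + n) * (k + p) :=
    mul_lt_mul_of_pos_left (by linarith) (by linarith)
  linarith

theorem casimir_le (n p k : ℕ) :
    (2 * (((k : ℝ) + n) * (k + p)) : ℝ) ≤ 2 * ((k + n + 1) * (k + p)) := by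
  have : ((k : ℝ) + n) * (k + p) ≤ (k + n + 1) * (k + p) :=
    mul_le_mul_of_nonneg_right (by linarith) (by positivity)
  linarith

end Coefficients

/-! ### Lie derivatives depend linearly on the vector field -/

section Linear

variable {n : ℕ} {U : Opens (Fin n → ℝ)} {p : ℕ}

theorem lieFun_add (X Y : VectorField U) : lieFun (X + Y) = lieFun X + lieFun Y := by
  refine LinearMap.ext fun f => ?_
  simp [lieFun, LinearMap.sum_apply, add_mul, Finset.sum_add_distrib]

theorem lieFun_smul (c : ℝ) (X : VectorField U) : lieFun (c • X) = c • lieFun X := by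
  refine LinearMap.ext fun f => ?_
  simp [lieFun, LinearMap.sum_apply, Finset.smul_sum]

theorem onForm_add (S T : Module.End ℝ (SmoothFun U)) :
    onForm p (S + T) = onForm p S + onForm p T :=
  rfl

theorem onForm_smul (c : ℝ) (S : Module.End ℝ (SmoothFun U)) :
    onForm p (c • S) = c • onForm p S :=
  rfl

theorem mulFun_add (f g : SmoothFun U) : mulFun (f + g) = mulFun f + mulFun g :=
  LinearMap.ext fun h => add_mul f g h

theorem mulFun_smul (c : ℝ) (f : SmoothFun U) : mulFun (c • f) = c • mulFun f :=
  LinearMap.ext fun h => smul_mul_assoc c f h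

theorem lieForm_add (X Y : VectorField U) : lieForm p (X + Y) = lieForm p X + lieForm p Y := by
  simp only [lieForm, lieFun_add, onForm_add, Pi.add_apply, map_add, mulFun_add,
    LinearMap.add_comp, Finset.sum_add_distrib]
  abel

theorem lieForm_smul (c : ℝ) (X : VectorField U) : lieForm p (c • X) = c • lieForm p X := by
  simp only [lieForm, lieFun_smul, onForm_smul, Pi.smul_apply, map_smul, mulFun_smul,
    LinearMap.smul_comp, smul_add, Finset.smul_sum]

theorem lieDiffOp_add (X Y : VectorField U) (D : Form U p →ₗ[ℝ] SmoothFun U) :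
    lieDiffOp (X + Y) D = lieDiffOp X D + lieDiffOp Y D := by
  simp only [lieDiffOp, lieFun_add, lieForm_add, LinearMap.add_comp, LinearMap.comp_add]
  abel

theorem lieDiffOp_smul (c : ℝ) (X : VectorField U) (D : Form U p →ₗ[ℝ] SmoothFun U) :
    lieDiffOp (c • X) D = c • lieDiffOp X D := by
  simp only [lieDiffOp, lieFun_smul, lieForm_smul, LinearMap.smul_comp, LinearMap.comp_smul,
    smul_sub]

theorem lieSymbol_apply (X : VectorField U) (u : TotalSymbol U) : lieSymbol X u =
    ∑ i, mulOp U (X i) ((symbolWC U).d i u) -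
      ∑ i, ∑ j, mulOp U (partialD U j (X i)) ((symbolWC U).ρ i j u) := by
  rw [lieSymbol_eq, lieOp, LinearMap.sub_apply]
  simp only [LinearMap.sum_apply, Module.End.mul_apply]

theorem lieSymbol_add (X Y : VectorField U) (u : TotalSymbol U) :
    lieSymbol (X + Y) u = lieSymbol X u + lieSymbol Y u := by
  simp only [lieSymbol_apply, Pi.add_apply, map_add, LinearMap.add_apply, Finset.sum_add_distrib]
  abel

theorem lieSymbol_smul (c : ℝ) (X : VectorField U) (u : TotalSymbol U) :
    lieSymbol (c • X) u = c • lieSymbol X u := by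
  simp only [lieSymbol_apply, Pi.smul_apply, map_smul, LinearMap.smul_apply, Finset.smul_sum,
    smul_sub]

variable (p) in
/-- The Lie derivative on `𝒮_p`. -/
noncomputable def lieT (X : VectorField U) : Module.End ℝ (SymbolType U p) :=
  (symbolEquiv U p).symm.toLinearMap ∘ₗ
    (lieSymbol X ∘ₗ incl U p).codRestrict (symbolSpace U p) fun u => lieSymbol_mem X (incl_mem u)

theorem incl_lieT (X : VectorField U) (u : SymbolType U p) :
    incl U p (lieT p X u) = lieSymbol X (incl U p u) :=
  rfl

theorem lieT_mem {X : VectorField U} {k : ℕ} {u : SymbolType U p} (hu : u ∈ degPart U p k) :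
    lieT p X u ∈ degPart U p k :=
  lieSymbol_mem_deg X hu

theorem symbolEquiv_lieT (X : VectorField U) (u : SymbolType U p) :
    symbolEquiv U p (lieT p X u) =
      ⟨lieSymbol X (symbolEquiv U p u), lieSymbol_mem X (symbolEquiv U p u).2⟩ :=
  rfl

end Linear

/-! ### The quantization map -/

section Quantization

/-- The shape of the quantization map in one degree: `1 + ∑_{1 ≤ l ≤ K} (s_l A^l + t_l B^l)`. -/
def quantSum {R : Type*} [Ring R] [Algebra ℝ R] (A B : R) (s t : ℕ → ℝ) (K : ℕ) : R :=
  1 + ∑ l ∈ Finset.range K, (s (l + 1) • A ^ (l + 1) + t (l + 1) • B ^ (l + 1))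

theorem commute_quantSum {R : Type*} [Ring R] [Algebra ℝ R] {A B x : R} (hA : Commute x A)
    (hB : Commute x B) (s t : ℕ → ℝ) (K : ℕ) : Commute x (quantSum A B s t K) := by
  refine (Commute.one_right x).add_right (Commute.sum_right _ _ _ fun l _ => ?_)
  exact ((hA.pow_right _).smul_right _).add_right ((hB.pow_right _).smul_right _)

theorem quantSum_apply {V : Type*} [AddCommGroup V] [Module ℝ V] (A B : Module.End ℝ V)
    (s t : ℕ → ℝ) (K : ℕ) (u : V) : quantSum A B s t K u =
      u + ∑ l ∈ Finset.Icc 1 K, (s l • (A ^ l) u + t l • (B ^ l) u) := by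
  have h : ∑ l ∈ Finset.Icc 1 K, (s l • (A ^ l) u + t l • (B ^ l) u) =
      ∑ l ∈ Finset.range K, (s (l + 1) • (A ^ (l + 1)) u + t (l + 1) • (B ^ (l + 1)) u) := by
    rw [Finset.range_eq_Ico, Finset.sum_Ico_add' (fun l => s l • (A ^ l) u + t l • (B ^ l) u)]
    rfl
  rw [h, quantSum, LinearMap.add_apply, LinearMap.sum_apply]
  rfl

variable {n : ℕ} (U : Opens (Fin n → ℝ)) (p : ℕ)

/-- The quantization map in degree `k`, as an operator on symbols. -/
noncomputable def quantOp (k : ℕ) : Module.End ℝ (TotalSymbol U) :=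
  quantSum (symbolWC U).A (symbolWC U).B (coefA n p k) (coefB n p k) k

theorem quantA_eq (k l : ℕ) : quantA U p k l = coefA n p k l • (symbolWC U).A ^ l := by
  rw [quantA, delta_eq, divergence_eq, deltaStar_eq]
  rfl

theorem quantB_eq (k l : ℕ) : quantB U p k l = coefB n p k l • (symbolWC U).B ^ l := by
  rw [quantB, delta_eq, divergence_eq, deltaStar_eq]
  rfl

theorem quantOp_apply (k : ℕ) (u : TotalSymbol U) :
    quantOp U p k u = u + ∑ l ∈ Finset.Icc 1 k, (quantA U p k l u + quantB U p k l u) := by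
  rw [quantOp, quantSum_apply]
  refine congrArg (u + ·) (Finset.sum_congr rfl fun l _ => ?_)
  rw [quantA_eq, quantB_eq]
  rfl

variable {U p}

theorem quantOp_sub_mem {k : ℕ} {u : TotalSymbol U} (hu : u ∈ symbolDeg U p k) :
    quantOp U p k u - u ∈ symbolLT U p k := by
  rw [quantOp, quantSum_apply, add_sub_cancel_left]
  refine Submodule.sum_mem _ fun l hl => ?_
  obtain ⟨h1, h2⟩ := Finset.mem_Icc.1 hl
  have h : k - l < k := by omega
  exact Submodule.add_mem _
    (Submodule.smul_mem _ _ (symbolDeg_le_symbolLT h (A_pow_mem h2 hu)))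
    (Submodule.smul_mem _ _ (symbolDeg_le_symbolLT h (B_pow_mem h2 hu)))

theorem toDiffOp_quantOp_const (r : Fin n) (k : ℕ) (u : TotalSymbol U) :
    toDiffOp U p (quantOp U p k (lieSymbol (Pi.single r 1) u)) =
      lieDiffOp (Pi.single r 1) (toDiffOp U p (quantOp U p k u)) := by
  rw [lieSymbol_const, lieDiffOp_const]
  exact congrArg (toDiffOp U p) (LinearMap.congr_fun (commute_quantSum ((symbolWC U).A_d r)
    ((symbolWC U).B_d r) (coefA n p k) (coefB n p k) k).eq u).symm

theorem toDiffOp_quantOp_linear (r s : Fin n) (k : ℕ) (u : TotalSymbol U) :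
    toDiffOp U p (quantOp U p k (lieSymbol (Pi.single r (coord U s)) u)) =
      lieDiffOp (Pi.single r (coord U s)) (toDiffOp U p (quantOp U p k u)) := by
  rw [lieSymbol_linear, lieDiffOp_linear]
  exact congrArg (toDiffOp U p) (LinearMap.congr_fun (commute_quantSum ((symbolWC U).lieLin_A s r)
    ((symbolWC U).lieLin_B s r) (coefA n p k) (coefB n p k) k).eq u).symm

theorem toDiffOp_quantOp_quadratic (r : Fin n) {k : ℕ} {u : TotalSymbol U}
    (hu : u ∈ symbolDeg U p k) :
    toDiffOp U p (quantOp U p k (lieSymbol (fun i => coord U r * coord U i) u)) =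
      lieDiffOp (fun i => coord U r * coord U i) (toDiffOp U p (quantOp U p k u)) := by
  rw [lieSymbol_quadratic, lieDiffOp_quadratic]
  have hA := A_pow_mem le_rfl hu
  have hB := B_pow_mem le_rfl hu
  rw [Nat.sub_self] at hA hB
  exact congrArg (toDiffOp U p) ((symbolWC U).quantization_lieQuad (degξ_apply hu) (deg_apply hu) r
    (coefA_zero n p k) (coefB_zero n p k) (fun l hl => coefA_succ n p hl)
    (fun l hl => coefB_succ n p hl) ((symbolWC U).a_apply_eq_zero (η_apply_eq_zero hA) r)
    ((symbolWC U).b_apply_eq_zero (η_apply_eq_zero hB) r) rfl)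

variable (U p) in
/-- The operators `quantOp`, one for each degree, glue to an operator on `𝒮_p`. -/
theorem exists_quantization : ∃ T : SymbolType U p →ₗ[ℝ] SymbolType U p,
    ∀ k, ∀ u ∈ degPart U p k, incl U p (T u) = quantOp U p k (incl U p u) := by
  obtain ⟨T, hT⟩ := exists_linearMap_eqOn (V' := TotalSymbol U) (iSupIndep_degPart (p := p))
    iSup_degPart (fun k => quantOp U p k ∘ₗ incl U p)
  have hmem (u : SymbolType U p) : T u ∈ symbolSpace U p := by
    have : (⊤ : Submodule ℝ (SymbolType U p)) ≤ (symbolSpace U p).comap T := by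
      rw [← iSup_degPart]
      refine iSup_le fun k v hv => ?_
      rw [Submodule.mem_comap, hT k v hv, LinearMap.comp_apply,
        ← sub_add_cancel (quantOp U p k (incl U p v)) (incl U p v)]
      refine Submodule.add_mem _ ?_ (incl_mem v)
      exact lowerPart_le (G := symbolDeg U p) (fun r _ => symbolDeg_le_symbolSpace r)
        (quantOp_sub_mem hv)
    exact this trivial
  exact ⟨(symbolEquiv U p).symm.toLinearMap ∘ₗ T.codRestrict _ hmem, hT⟩

theorem isUnitriangular_of_eq_quantOp {T : SymbolType U p →ₗ[ℝ] SymbolType U p}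
    (hT : ∀ k, ∀ u ∈ degPart U p k, incl U p (T u) = quantOp U p k (incl U p u)) :
    IsUnitriangular (degPart U p) T := fun k u hu => by
  rw [mem_lowerPart_degPart, map_sub, hT k u hu]
  exact quantOp_sub_mem hu

/-- The Lie derivative of operators, as a linear map. -/
noncomputable def lieDiffOpHom (X : VectorField U) :
    (Form U p →ₗ[ℝ] SmoothFun U) →ₗ[ℝ] (Form U p →ₗ[ℝ] SmoothFun U) where
  toFun := lieDiffOp X
  map_add' D E := by
    simp only [lieDiffOp, LinearMap.comp_add, LinearMap.add_comp]
    abel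
  map_smul' c D := by
    simp only [lieDiffOp, LinearMap.comp_smul, LinearMap.smul_comp, smul_sub, RingHom.id_apply]

theorem toDiffOp_lieT_of_eqOn {T : SymbolType U p →ₗ[ℝ] SymbolType U p}
    (hT : ∀ k, ∀ u ∈ degPart U p k, incl U p (T u) = quantOp U p k (incl U p u))
    {X : VectorField U} (hX : ∀ k, ∀ u ∈ symbolDeg U p k,
      toDiffOp U p (quantOp U p k (lieSymbol X u)) =
        lieDiffOp X (toDiffOp U p (quantOp U p k u))) (u : SymbolType U p) :
    toDiffOp U p (incl U p (T (lieT p X u))) = lieDiffOp X (toDiffOp U p (incl U p (T u))) := by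
  have : (toDiffOp U p ∘ₗ incl U p ∘ₗ T) ∘ₗ lieT p X =
      lieDiffOpHom X ∘ₗ (toDiffOp U p ∘ₗ incl U p ∘ₗ T) := by
    refine symbolType_hom_ext fun k u hu => ?_
    change toDiffOp U p (incl U p (T (lieT p X u))) = lieDiffOp X (toDiffOp U p (incl U p (T u)))
    rw [hT k _ (lieT_mem hu), hT k u hu, incl_lieT]
    exact hX k _ hu
  exact LinearMap.congr_fun this u

theorem toDiffOp_lieT {T : SymbolType U p →ₗ[ℝ] SymbolType U p}
    (hT : ∀ k, ∀ u ∈ degPart U p k, incl U p (T u) = quantOp U p k (incl U p u))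
    {X : VectorField U} (hX : X ∈ projectiveAlgebra U) (u : SymbolType U p) :
    toDiffOp U p (incl U p (T (lieT p X u))) = lieDiffOp X (toDiffOp U p (incl U p (T u))) := by
  have hadd (X Y : VectorField U) : lieT p (X + Y) u = lieT p X u + lieT p Y u :=
    incl_injective (lieSymbol_add X Y (incl U p u))
  have hsmul (c : ℝ) (X : VectorField U) : lieT p (c • X) u = c • lieT p X u :=
    incl_injective (lieSymbol_smul c X (incl U p u))
  induction hX using Submodule.span_induction with
  | mem X hX =>
    refine toDiffOp_lieT_of_eqOn hT (fun k v hv => ?_) u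
    rcases hX with (⟨r, rfl⟩ | ⟨rs, rfl⟩) | ⟨r, rfl⟩
    · exact toDiffOp_quantOp_const r k v
    · exact toDiffOp_quantOp_linear rs.1 rs.2 k v
    · exact toDiffOp_quantOp_quadratic r hv
  | zero => rw [← zero_smul ℝ (0 : VectorField U), hsmul, lieDiffOp_smul]; simp
  | add X Y _ _ h1 h2 => rw [hadd, lieDiffOp_add, map_add, map_add, map_add, h1, h2]
  | smul c X _ h => rw [hsmul, lieDiffOp_smul, map_smul, map_smul, map_smul, h]

variable (U p) in
/-- Existence, together with the formula in each degree. -/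
theorem exists_isEquivariantQuantization :
    ∃ Q : symbolSpace U p ≃ₗ[ℝ] diffOpSpace U p,
      (∀ (k : ℕ) (u : symbolSpace U p), (u : TotalSymbol U) ∈ symbolDeg U p k →
        (Q u : Form U p →ₗ[ℝ] SmoothFun U) = toDiffOp U p (quantOp U p k (u : TotalSymbol U))) ∧
      IsEquivariantQuantization U p Q := by
  obtain ⟨T, hT⟩ := exists_quantization U p
  have hU := isUnitriangular_of_eq_quantOp hT
  let e : SymbolType U p ≃ₗ[ℝ] SymbolType U p :=
    LinearEquiv.ofBijective T ⟨hU.injective iSup_degPart, hU.surjective iSup_degPart⟩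
  let Q : symbolSpace U p ≃ₗ[ℝ] diffOpSpace U p :=
    (symbolEquiv U p).symm ≪≫ₗ e ≪≫ₗ diffOpEquiv U p
  have hQ (u : SymbolType U p) : (Q (symbolEquiv U p u) : Form U p →ₗ[ℝ] SmoothFun U) =
      toDiffOp U p (incl U p (T u)) := rfl
  refine ⟨Q, fun k u hu => ?_, ⟨fun X hX u => ?_, fun k D σ hσ => ?_⟩⟩
  · obtain ⟨u, rfl⟩ := (symbolEquiv U p).surjective u
    rw [hQ]
    exact congrArg (toDiffOp U p) (hT k u hu)
  · obtain ⟨u, rfl⟩ := (symbolEquiv U p).surjective u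
    rw [← symbolEquiv_lieT, hQ, hQ]
    exact toDiffOp_lieT hT hX u
  · obtain ⟨u, rfl⟩ := Q.surjective D
    obtain ⟨u, rfl⟩ := (symbolEquiv U p).surjective u
    obtain ⟨hσk, τ, hτ, hD⟩ := hσ
    rw [LinearEquiv.symm_apply_apply]
    obtain ⟨s, rfl⟩ := exists_incl_eq (symbolDeg_le_symbolSpace k hσk)
    obtain ⟨t, rfl⟩ := exists_incl_eq
      (lowerPart_le (G := symbolDeg U p) (fun r _ => symbolDeg_le_symbolSpace r) hτ)
    have hs : s ∈ degPart U p k := hσk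
    have ht : t ∈ lowerPart (degPart U p) k := mem_lowerPart_degPart.2 hτ
    rw [hQ, ← map_add] at hD
    have hTu : T u = s + t := (diffOpEquiv U p).injective (Subtype.ext hD)
    have key : u - s ∈ lowerPart (degPart U p) k := by
      refine hU.mem_of_apply_mem (hU.injective iSup_degPart) ?_
      -- `T (u - s)` is of lower degree, and `T` maps the lower part onto itself.
      have e : T (u - s) = t - (T s - s) := by rw [map_sub, hTu]; abel
      rw [e]
      exact Submodule.sub_mem _ ht (hU k s hs)
    have := mem_lowerPart_degPart.1 key
    rwa [map_sub] at this

end Quantization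

/-! ### Uniqueness -/

section Uniqueness

/-- The Casimir operator is natural for intertwining maps. -/
theorem map_casimirOf {V V' : Type*} [AddCommGroup V] [Module ℝ V] [AddCommGroup V'] [Module ℝ V']
    (j : V' →ₗ[ℝ] V) {n : ℕ} {lin : Fin n → Fin n → Module.End ℝ V}
    {quad tr : Fin n → Module.End ℝ V} {lin' : Fin n → Fin n → Module.End ℝ V'}
    {quad' tr' : Fin n → Module.End ℝ V'} (h1 : ∀ s r u, j (lin' s r u) = lin s r (j u))
    (h2 : ∀ r u, j (quad' r u) = quad r (j u)) (h3 : ∀ r u, j (tr' r u) = tr r (j u)) (u : V') :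
    j (WeylClifford.casimirOf lin' quad' tr' u) = WeylClifford.casimirOf lin quad tr (j u) := by
  simp [WeylClifford.casimirOf, LinearMap.sum_apply, h1, h2, h3]

theorem commute_casimirOf {R : Type*} [Ring R] {n : ℕ} {lin : Fin n → Fin n → R}
    {quad tr : Fin n → R} {S : R} (h1 : ∀ s r, Commute S (lin s r)) (h2 : ∀ r, Commute S (quad r))
    (h3 : ∀ r, Commute S (tr r)) : Commute S (WeylClifford.casimirOf lin quad tr) := by
  have h4 : Commute S (∑ i, lin i i) := Commute.sum_right _ _ _ fun i _ => h1 i i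
  refine Commute.sub_right (Commute.add_right (Commute.sub_right ?_ ?_) (h4.mul_right h4))
    (h4.smul_right _)
  · exact Commute.sum_right _ _ _ fun i _ => Commute.sum_right _ _ _ fun j _ =>
      (h1 j i).mul_right (h1 i j)
  · exact (Commute.sum_right _ _ _ fun i _ => (h2 i).mul_right (h3 i)).smul_right _

variable {n : ℕ} {U : Opens (Fin n → ℝ)} {p : ℕ}

theorem const_mem_projectiveAlgebra (r : Fin n) :
    (Pi.single r 1 : VectorField U) ∈ projectiveAlgebra U :=
  Submodule.subset_span (.inl (.inl ⟨r, rfl⟩))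

theorem linear_mem_projectiveAlgebra (r s : Fin n) :
    (Pi.single r (coord U s) : VectorField U) ∈ projectiveAlgebra U :=
  Submodule.subset_span (.inl (.inr ⟨(r, s), rfl⟩))

theorem quadratic_mem_projectiveAlgebra (r : Fin n) :
    (fun i => coord U r * coord U i : VectorField U) ∈ projectiveAlgebra U :=
  Submodule.subset_span (.inr ⟨r, rfl⟩)

variable (U p) in
/-- The Casimir operator of `sl_{n+1}` on `𝒮_p`. -/
noncomputable def casimirT : Module.End ℝ (SymbolType U p) :=
  WeylClifford.casimirOf (fun s r => lieT p (Pi.single r (coord U s)))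
    (fun r => lieT p fun i => coord U r * coord U i) (fun r => lieT p (Pi.single r 1))

theorem incl_casimirT (u : SymbolType U p) :
    incl U p (casimirT U p u) = (symbolWC U).casimir (incl U p u) :=
  map_casimirOf (incl U p) (fun s r u => by rw [incl_lieT, lieSymbol_linear])
    (fun r u => by rw [incl_lieT, lieSymbol_quadratic])
    (fun r u => by rw [incl_lieT, lieSymbol_const]) u

theorem casimirT_quadratic {k : ℕ} {u : SymbolType U p} (hu : u ∈ degPart U p k) :
    casimirT U p (casimirT U p u) -
      (2 * (((k : ℝ) + n + 1) * (k + p)) + 2 * ((k + n) * (k + p))) • casimirT U p u +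
      ((2 * (((k : ℝ) + n + 1) * (k + p))) * (2 * ((k + n) * (k + p)))) • u = 0 := by
  apply incl_injective
  rw [map_add, map_sub, map_smul, map_smul, map_zero, incl_casimirT, incl_casimirT]
  exact (symbolWC U).casimir_quadratic (degξ_apply hu) (degW_apply hu)

/-- An operator on `𝒮_p` which is the identity up to terms of lower degree and which commutes with
`sl_{n+1}` commutes with the Casimir operator, hence is the identity. -/
theorem eq_id_of_commute_lieT {S : Module.End ℝ (SymbolType U p)}
    (hS : IsUnitriangular (degPart U p) S)
    (hc : ∀ X ∈ projectiveAlgebra U, Commute S (lieT p X)) : S = LinearMap.id := by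
  refine hS.eq_id_of_commute iSup_degPart (C := casimirT U p)
    (commute_casimirOf (fun s r => hc _ (linear_mem_projectiveAlgebra r s))
      (fun r => hc _ (quadratic_mem_projectiveAlgebra r))
      (fun r => hc _ (const_mem_projectiveAlgebra r))) (fun k u hu => casimirT_quadratic hu)
    fun k r h => ?_
  have h1 := casimir_lt (n := n) (p := p) h
  have h2 := casimir_le n p k
  have h3 := casimir_le n p r
  exact ⟨ne_of_gt (by linarith), ne_of_gt (by linarith), ne_of_gt (by linarith),
    ne_of_gt (by linarith)⟩

/-- Normalization says that `Q⁻¹` is unitriangular when operators are identified with symbols. -/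
theorem isUnitriangular_symm {Q : symbolSpace U p ≃ₗ[ℝ] diffOpSpace U p}
    (hQ : IsEquivariantQuantization U p Q) : IsUnitriangular (degPart U p)
      ((diffOpEquiv U p ≪≫ₗ Q.symm ≪≫ₗ (symbolEquiv U p).symm).toLinearMap) := fun k u hu => by
  rw [mem_lowerPart_degPart, map_sub]
  exact hQ.normalized k (diffOpEquiv U p u) (incl U p u)
    ⟨hu, 0, Submodule.zero_mem _, by rw [add_zero]; rfl⟩

theorem IsEquivariantQuantization.unique {Q Q' : symbolSpace U p ≃ₗ[ℝ] diffOpSpace U p}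
    (hQ : IsEquivariantQuantization U p Q) (hQ' : IsEquivariantQuantization U p Q') : Q' = Q := by
  let E := symbolEquiv U p
  -- `S = Q'⁻¹ Q` is unitriangular because `S` composed with `Q⁻¹` is `Q'⁻¹`.
  let S : SymbolType U p ≃ₗ[ℝ] SymbolType U p := E ≪≫ₗ Q ≪≫ₗ Q'.symm ≪≫ₗ E.symm
  have hS : S.toLinearMap = LinearMap.id := by
    refine eq_id_of_commute_lieT ((isUnitriangular_symm hQ).of_comp ?_) fun X hX => ?_
    · convert isUnitriangular_symm hQ' using 1
      refine LinearMap.ext fun u => ?_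
      simp [S, E]
    · refine LinearMap.ext fun u => ?_
      change E.symm (Q'.symm (Q (E (lieT p X u)))) = lieT p X (E.symm (Q'.symm (Q (E u))))
      rw [LinearEquiv.symm_apply_eq, LinearEquiv.symm_apply_eq]
      apply Subtype.ext
      rw [symbolEquiv_lieT, symbolEquiv_lieT, hQ.equivariant X hX, hQ'.equivariant X hX]
      congr 2
      simp [E]
  refine LinearEquiv.ext fun u => ?_
  have h := LinearMap.congr_fun hS (E.symm u)
  change E.symm (Q'.symm (Q (E (E.symm u)))) = E.symm u at h
  rw [LinearEquiv.apply_symm_apply] at h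
  exact ((LinearEquiv.symm_apply_eq Q').1 (E.symm.injective h)).symm

end Uniqueness
end ProjQuant

theorem mainTheorem1 (n : ℕ) (hn : 2 ≤ n) (U : TopologicalSpace.Opens (Fin n → ℝ)) (p : ℕ) :
    ∃ Q : ProjQuant.symbolSpace U p ≃ₗ[ℝ] ProjQuant.diffOpSpace U p,
      (∀ (k : ℕ) (u : ProjQuant.symbolSpace U p),
        (u : ProjQuant.TotalSymbol U) ∈ ProjQuant.symbolDeg U p k →
          (Q u : ProjQuant.Form U p →ₗ[ℝ] ProjQuant.SmoothFun U) =
            ProjQuant.toDiffOp U p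
              ((u : ProjQuant.TotalSymbol U) +
                ∑ l ∈ Finset.Icc 1 k,
                  (ProjQuant.quantA U p k l (u : ProjQuant.TotalSymbol U) +
                    ProjQuant.quantB U p k l (u : ProjQuant.TotalSymbol U)))) ∧
      ProjQuant.IsEquivariantQuantization U p Q ∧
      ∀ Q' : ProjQuant.symbolSpace U p ≃ₗ[ℝ] ProjQuant.diffOpSpace U p,
        ProjQuant.IsEquivariantQuantization U p Q' → Q' = Q := by
  obtain ⟨Q, hf, hQ⟩ := ProjQuant.exists_isEquivariantQuantization U p
  refine ⟨Q, fun k u hu => ?_, hQ, fun Q' hQ' => hQ.unique hQ'⟩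
  rw [hf k u hu, ProjQuant.quantOp_apply]
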